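/- **Distribution-free tester for depth-$d$ decision trees by depth-$d^2$ decision trees.** A *decision tree* over $x_1,\dots,x_n$ is a rooted binary tree whose internal nodes are labelled by variables and whose leaves are labelled by bits; it computes a Boolean function $\{0,1\}^n\to\{0,1\}$ by following, from the root, the left or right edge according to whether the variable at the node is $0$ or $1$. A *depth-$d$ decision tree* is a function computed by a decision tree all of whose root-to-leaf paths have at most $d$ edges. For a probability distribution $\mathcal D$ on $\{0,1\}^n$, a function $f$ is *$\epsilon$-far* from a class $H$ if $\Pr_{x\sim\mathcal D}[f(x)\ne g(x)]>\epsilon$ for every $g\in H$. The algorithm can make two kinds of queries to the unknown $f:\{0,1\}^n\to\{0,1\}$: a black box query, which returns $f(x)$ for an $x$ of its choice, and a random example query, which returns $(x,f(x))$ for a fresh $x$ drawn from the unknown distribution $\mathcal D$. There is a single randomized algorithm which, given $n\ge 1$, $d\ge 0$ and $0<\epsilon\le 1$ (through $\lceil 1/\epsilon\rceil$), and given query access to an arbitrary $f:\{0,1\}^n\to\{0,1\}$ and an arbitrary distribution $\mathcal D$ on $\{0,1\}^n$, always makes at most $q=q(d,\epsilon)$ queries in total, where $$q=\tilde O\!\left(\frac{2^{2d}}{\epsilon}\right),\qquad\text{i.e.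 } q\le A\,\frac{2^{2d}}{\epsilon}\Bigl(1+\log\frac{2^{2d}}{\epsilon}\Bigr)^{a}\ \text{for absolute constants } A,a,$$ always halts in time $O(qn)$, with an absolute implied constant, and 1. accepts with probability at least $2/3$ if $f$ is a depth-$d$ decision tree; 2. rejects with probability at least $2/3$ if $f$ is $\epsilon$-far, with respect to $\mathcal D$, from every depth-$d^2$ decision tree. Time is measured on a word RAM with random bits, for every word length $w\ge K\log(2^d n/\epsilon)+K$ with an absolute constant $K$; elementary operations on words and random bits cost $1$ and each query costs $n+1$. -/

import Mathlib

noncomputable section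

namespace DTTest

/-! ### Decision trees -/

/-- Points of the cube `{0,1}^n`. -/
abbrev Cube (n : ℕ) : Type := Fin n → Bool

/-- Decision trees over the variables `x_i`, `i : Fin n`; the first child is for `x_i = 0`. -/
inductive DecisionTree (n : ℕ) : Type
  | leaf (b : Bool) : DecisionTree n
  | node (i : Fin n) (left right : DecisionTree n) : DecisionTree n

namespace DecisionTree

/-- The Boolean function computed by a decision tree. -/
def eval {n : ℕ} : DecisionTree n → Cube n → Bool
  | leaf b, _ => b
  | node i l r, x => if x i then r.eval x else l.eval x

/-- The largest number of edges on a path from the root to a leaf. -/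
def depth {n : ℕ} : DecisionTree n → ℕ
  | leaf _ => 0
  | node _ l r => max l.depth r.depth + 1

end DecisionTree

/-- `f` is (computed by) a depth-`d` decision tree, i.e. a decision tree of depth at most `d`. -/
def IsDepthDT {n : ℕ} (d : ℕ) (f : Cube n → Bool) : Prop :=
  ∃ T : DecisionTree n, T.depth ≤ d ∧ ∀ x, T.eval x = f x

/-- `f` is `ε`-far, with respect to `D`, from every depth-`d` decision tree:
`Pr_{x ∼ D}[g x ≠ f x] > ε` for each such function `g`. -/
def FarFromDepthDT {n : ℕ} (D : PMF (Cube n)) (ε : ℝ) (d : ℕ) (f : Cube n → Bool) : Prop :=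
  ∀ g : Cube n → Bool, IsDepthDT d g →
    ENNReal.ofReal ε < D.toOuterMeasure {x | g x ≠ f x}

/-! ### Randomized word-RAM programs with oracle access

Programs are while-programs over registers and arrays (both indexed by natural numbers) that hold
words of `w` bits.  Registers and arrays are named in the program text; the cell of an array is
chosen by the content of a register (indirect addressing). -/

/-- Word operations; comparisons return `0` or `1`. -/
inductive Op : Type
  | add | sub | mul | div | mod | lt | eq

/-- Meaning of the operations on natural numbers; the result is cut to `w` bits when stored. -/
def Op.apply : Op → ℕ → ℕ → ℕ
  | add, a, b => a + b
  | sub, a, b => a - b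
  | mul, a, b => a * b
  | div, a, b => a / b
  | mod, a, b => a % b
  | lt, a, b => if a < b then 1 else 0
  | eq, a, b => if a = b then 1 else 0

/-- Programs. -/
inductive Cmd : Type
  /-- do nothing -/
  | skip : Cmd
  /-- `reg r := v` -/
  | const (r v : ℕ) : Cmd
  /-- `reg r := reg a ∘ reg b` -/
  | op (o : Op) (r a b : ℕ) : Cmd
  /-- `reg r := arr A [reg i]` -/
  | load (r A i : ℕ) : Cmd
  /-- `arr A [reg i] := reg r` -/
  | store (A i r : ℕ) : Cmd
  /-- `reg r :=` a fresh uniform random bit -/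
  | coin (r : ℕ) : Cmd
  /-- black box query: `reg r := f x`, where `x` is read from the first `n` cells of `arr A` -/
  | query (r A : ℕ) : Cmd
  /-- random example query: draw `x` from `D`, write `x` to the first `n` cells of `arr A`,
  and `reg r := f x` -/
  | sample (r A : ℕ) : Cmd
  /-- sequential composition -/
  | seq (c₁ c₂ : Cmd) : Cmd
  /-- `if reg r ≠ 0 then c₁ else c₂` -/
  | ite (r : ℕ) (c₁ c₂ : Cmd) : Cmd
  /-- `while reg r ≠ 0 do c` -/
  | loop (r : ℕ) (c : Cmd) : Cmd
  /-- stop with the answer `b` (`true`: accept, `false`: reject) -/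
  | answer (b : Bool) : Cmd

/-- Configurations: the commands still to be executed, the memory, the answer if one has been
given, the time used and the number of queries (of both kinds) made so far. -/
structure Config : Type where
  todo : List Cmd
  reg : ℕ → ℕ
  arr : ℕ → ℕ → ℕ
  output : Option Bool
  time : ℕ
  queries : ℕ

/-- Write the `w` low bits of `v` to register `r`. -/
def Config.setReg (w : ℕ) (c : Config) (r v : ℕ) : Config :=
  { c with reg := Function.update c.reg r (v % 2 ^ w) }

/-- Write the `w` low bits of `v` to cell `i` of array `A`. -/
def Config.setCell (w : ℕ) (c : Config) (A i v : ℕ) : Config :=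
  { c with arr := Function.update c.arr A (Function.update (c.arr A) i (v % 2 ^ w)) }

/-- The point of the cube stored in the first `n` cells of array `A` (nonzero means `1`). -/
def Config.readPoint (n : ℕ) (c : Config) (A : ℕ) : Cube n :=
  fun i => decide (c.arr A i ≠ 0)

/-- Write the point `x` to the first `n` cells of array `A`. -/
def Config.writePoint {n : ℕ} (w : ℕ) (c : Config) (A : ℕ) (x : Cube n) : Config :=
  { c with
    arr := Function.update c.arr A
      (fun j => if h : j < n then (x ⟨j, h⟩).toNat % 2 ^ w else c.arr A j) }

/-- The running time charged for one step: `n + 1` for a query of either kind, whose example has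
`n` bits, and `1` for everything else. -/
def Cmd.cost (n : ℕ) : Cmd → ℕ
  | query _ _ => n + 1
  | sample _ _ => n + 1
  | _ => 1

/-- The number of queries made by one step. -/
def Cmd.queryCount : Cmd → ℕ
  | query _ _ => 1
  | sample _ _ => 1
  | _ => 0

/-- The effect of the command `cmd`, which has just been removed from `c.todo`. -/
def Cmd.exec {n : ℕ} (w : ℕ) (D : PMF (Cube n)) (f : Cube n → Bool) (c : Config) :
    Cmd → PMF Config
  | skip => PMF.pure c
  | const r v => PMF.pure (c.setReg w r v)
  | op o r a b => PMF.pure (c.setReg w r (o.apply (c.reg a) (c.reg b)))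
  | load r A i => PMF.pure (c.setReg w r (c.arr A (c.reg i)))
  | store A i r => PMF.pure (c.setCell w A (c.reg i) (c.reg r))
  | coin r => (PMF.uniformOfFintype Bool).bind fun b => PMF.pure (c.setReg w r b.toNat)
  | query r A => PMF.pure (c.setReg w r (f (c.readPoint n A)).toNat)
  | sample r A => D.bind fun x => PMF.pure ((c.writePoint w A x).setReg w r (f x).toNat)
  | seq c₁ c₂ => PMF.pure { c with todo := c₁ :: c₂ :: c.todo }
  | ite r c₁ c₂ => PMF.pure { c with todo := (if c.reg r ≠ 0 then c₁ else c₂) :: c.todo }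
  | loop r b => PMF.pure
      { c with todo := if c.reg r ≠ 0 then b :: loop r b :: c.todo else c.todo }
  | answer b => PMF.pure { c with todo := [], output := some b }

/-- One step of the computation; a configuration with nothing left to do does not change. -/
def step {n : ℕ} (w : ℕ) (D : PMF (Cube n)) (f : Cube n → Bool) (c : Config) : PMF Config :=
  match c.todo with
  | [] => PMF.pure c
  | cmd :: rest =>
      cmd.exec w D f
        { c with todo := rest, time := c.time + cmd.cost n, queries := c.queries + cmd.queryCount }

/-- The distribution of the configuration after `t` steps. -/
def run {n : ℕ} (w : ℕ) (D : PMF (Cube n)) (f : Cube n → Bool) : ℕ → Config → PMF Config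
  | 0, c => PMF.pure c
  | t + 1, c => (step w D f c).bind (run w D f t)

/-- The initial configuration: the registers `0`, `1`, `2` hold the numbers `n`, `d` and `m`,
all other memory is zero. -/
def initial (P : Cmd) (w n d m : ℕ) : Config where
  todo := [P]
  reg := fun r =>
    if r = 0 then n % 2 ^ w else if r = 1 then d % 2 ^ w else if r = 2 then m % 2 ^ w else 0
  arr := fun _ _ => 0
  output := none
  time := 0
  queries := 0

/-- The distribution of the configuration after `t` steps of the program `P` with word length `w`
on the parameters `n`, `d`, `ε`, with oracle access to `f` and `D`.
The real parameter `ε` is handed to the program as the number `⌈1/ε⌉`. -/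
def execution (P : Cmd) (w : ℕ) {n : ℕ} (d : ℕ) (ε : ℝ) (D : PMF (Cube n)) (f : Cube n → Bool)
    (t : ℕ) : PMF Config :=
  run w D f t (initial P w n d ⌈1 / ε⌉₊)

/-- In every possible run, `P` gives an answer within time `t` and makes at most `q` queries.
(Every step takes time at least `1`, so a run of time at most `t` has at most `t` steps.) -/
def AnswersWithin (P : Cmd) (w : ℕ) {n : ℕ} (d : ℕ) (ε : ℝ) (D : PMF (Cube n))
    (f : Cube n → Bool) (t q : ℕ) : Prop :=
  ∀ c ∈ (execution P w d ε D f t).support, c.output.isSome ∧ c.time ≤ t ∧ c.queries ≤ q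

/-- The probability that `P` has given the answer `b` within `t` steps. -/
def answerProb (P : Cmd) (w : ℕ) {n : ℕ} (d : ℕ) (ε : ℝ) (D : PMF (Cube n))
    (f : Cube n → Bool) (t : ℕ) (b : Bool) : ENNReal :=
  (execution P w d ε D f t).toOuterMeasure {c | c.output = some b}

end DTTest

end

/-! The tester draws about `4 / ε` samples `x`. For each it tries to evaluate at `x` the small
decision tree that `f` is supposed to be, and it compares the outcome with `f x`.

Completeness. The variables get random labels from a set of size `2 ^ (2 * d + 3)`. A tree of depth
`d` has fewer than `2 ^ d` variables, so with probability at least 7/8 these get distinct labels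
(`prob_randomLabels_le`), and on points that are constant on blocks `f` is a depth-`d` tree in the
labels. The evaluation keeps a partial assignment `ρ` of labels and a monomial `M` of further
labels, and it studies the derivative `G` over the field with two elements, with respect to `M`, of
the function restricted by `ρ`. As `G` has degree at most `d`, a nonconstant `G` differs from any
given value with probability at least `2⁻ᵈ` (`IsDeg.le_prob`), so random search finds `Z` with `G Z
≠ G U`. Binary search between `U` and `Z` yields a label on which `G` depends. On the block of this
label the derivative is a literal or its negation, in an unknown variable, and the value of this
variable at `x` is `g z + g (z + x)` for any `z`. The label and the value join `M`. When `G` has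
become constant and `M` is nonempty, `G` is constantly 1; then every path of the restricted tree
meets a label of `M`, because on a path avoiding `M` the derivative would vanish. Committing the
values of `M` to `ρ` therefore shortens every path. Hence there are at most `d` monomials, each with
at most `d` labels, and after `d * d + d` rounds the restricted function is constant with value `f
x` (`Inv`, `prob_round_le`, `prob_sampleTest_true_le`).

Soundness. The point `x` influences the evaluation only through the bits returned for the literals.
For an arbitrary function `g` in place of the literal there is a coordinate `i` such that a bit
different from `x i` passes one test round with probability at most 31/32 (`exists_litTest_le`). So,
up to a small error, the evaluation of `f` at `x` is the evaluation at `x` of a random decision tree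
of depth at most `d ^ 2` drawn independently of `x` (`exists_random_tree`). If `f` is far from all
such trees, each of them errs on a random sample with probability more than `ε`, and enough samples
reveal this (`prob_sampleTest_le`, `prob_tester_le`).

Cost. A derivative takes at most `2 ^ d` queries. Up to powers of `kappa`, there are `2 ^ d`
derivatives per sample and `1 / ε` samples.

Programs and probability are kept apart. The random experiment `tester` is a `PMF`, and a program
logic shows that the answer of `testerCmd` has exactly this distribution (`testerCmd_yields`); all
estimates are then made for `tester`. -/

noncomputable section

namespace DTTest

/-! ### A program logic for the word RAM -/

/-- The memory part of a configuration. -/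
structure Mem : Type where
  reg : ℕ → ℕ
  arr : ℕ → ℕ → ℕ

/-- The oracles and the word length. -/
structure Env : Type where
  n : ℕ
  w : ℕ
  D : PMF (Cube n)
  f : Cube n → Bool

/-- The configuration with given commands, memory and counters that has not answered yet. -/
def Mem.config (s : Mem) (todo : List Cmd) (time queries : ℕ) : Config :=
  ⟨todo, s.reg, s.arr, none, time, queries⟩

/-- From memory `s`, the commands `todo` answer within time `N` and with at most `M` queries, and
the answer has distribution `ν`. -/
def Yields (E : Env) (todo : List Cmd) (s : Mem) (N M : ℕ) (ν : PMF Bool) : Prop :=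
  ∀ time queries t, N ≤ t →
    (run E.w E.D E.f t (s.config todo time queries)).map Config.output = ν.map some ∧
    ∀ c ∈ (run E.w E.D E.f t (s.config todo time queries)).support,
      c.time ≤ time + N ∧ c.queries ≤ queries + M

lemma Yields.mono {E : Env} {todo : List Cmd} {s : Mem} {N M N' M' : ℕ} {ν : PMF Bool}
    (h : Yields E todo s N M ν) (hN : N ≤ N') (hM : M ≤ M') : Yields E todo s N' M' ν := by
  intro time queries t ht
  obtain ⟨h1, h2⟩ := h time queries t (hN.trans ht)
  exact ⟨h1, fun c hc => ⟨(h2 c hc).1.trans (by omega), (h2 c hc).2.trans (by omega)⟩⟩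

/-- The link to the machine: the randomness `U` of one command is averaged over the answer
distributions `ν b` of the computations that follow. The rules below for all commands except
`answer` rest on it. -/
lemma Yields.step {E : Env} {cmd : Cmd} {rest todo : List Cmd} {s : Mem} {N M : ℕ} {β : Type}
    {U : PMF β} {σ : β → Mem} {ν : β → PMF Bool}
    (hex : ∀ time queries, cmd.exec E.w E.D E.f (s.config rest time queries) =
      U.bind fun b => PMF.pure ((σ b).config todo time queries))
    (h : ∀ b, Yields E todo (σ b) N M (ν b)) :
    Yields E (cmd :: rest) s (N + cmd.cost E.n) (M + cmd.queryCount) (U.bind ν) := by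
  intro time queries t ht
  -- Since every step costs at least 1, a bound for the time also bounds the number of steps, and
  -- `N` steps remain after this one.
  have hcost : 1 ≤ cmd.cost E.n := by cases cmd <;> simp [Cmd.cost]
  obtain ⟨t, rfl⟩ : ∃ t', t = t' + 1 := ⟨t - 1, by omega⟩
  have hrun : run E.w E.D E.f (t + 1) (s.config (cmd :: rest) time queries) =
      U.bind fun b => run E.w E.D E.f t
        ((σ b).config todo (time + cmd.cost E.n) (queries + cmd.queryCount)) := by
    have := hex (time + cmd.cost E.n) (queries + cmd.queryCount)
    simp only [Mem.config] at this
    simp only [run, DTTest.step, Mem.config, this, PMF.bind_bind, PMF.pure_bind]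
  rw [hrun]
  have key := fun b => h b (time + cmd.cost E.n) (queries + cmd.queryCount) t (by omega)
  constructor
  · rw [PMF.map_bind, PMF.map_bind]
    exact congrArg _ (funext fun b => (key b).1)
  · intro c hc
    obtain ⟨b, -, hb⟩ := (PMF.mem_support_bind_iff _ _ _).1 hc
    have := (key b).2 c hb
    omega

/-- `c.wr r`: the command `c` may write to register `r`. -/
def Cmd.wr : Cmd → ℕ → Bool
  | const r _, x => Nat.beq r x
  | op _ r _ _, x => Nat.beq r x
  | load r _ _, x => Nat.beq r x
  | coin r, x => Nat.beq r x
  | query r _, x => Nat.beq r x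
  | sample r _, x => Nat.beq r x
  | seq c₁ c₂, x => c₁.wr x || c₂.wr x
  | ite _ c₁ c₂, x => c₁.wr x || c₂.wr x
  | loop _ c, x => c.wr x
  | _, _ => false

/-- `c.wa A`: the command `c` may write to array `A`. -/
def Cmd.wa : Cmd → ℕ → Bool
  | store A _ _, x => Nat.beq A x
  | sample _ A, x => Nat.beq A x
  | seq c₁ c₂, x => c₁.wa x || c₂.wa x
  | ite _ c₁ c₂, x => c₁.wa x || c₂.wa x
  | loop _ c, x => c.wa x
  | _, _ => false

/-- `s'` differs from `s` only in places to which `c` may write. -/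
def Frame (c : Cmd) (s s' : Mem) : Prop :=
  (∀ r, c.wr r = false → s'.reg r = s.reg r) ∧ ∀ A, c.wa A = false → s'.arr A = s.arr A

lemma Frame.refl (c : Cmd) (s : Mem) : Frame c s s := ⟨fun _ _ => rfl, fun _ _ => rfl⟩

lemma Frame.trans {c : Cmd} {s s' s'' : Mem} (h : Frame c s s') (h' : Frame c s' s'') :
    Frame c s s'' :=
  ⟨fun r hr => (h'.1 r hr).trans (h.1 r hr), fun A hA => (h'.2 A hA).trans (h.2 A hA)⟩

lemma Frame.weaken {c c' : Cmd} {s s' : Mem} (h : Frame c s s')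
    (hr : ∀ r, c'.wr r = false → c.wr r = false) (ha : ∀ A, c'.wa A = false → c.wa A = false) :
    Frame c' s s' :=
  ⟨fun r h' => h.1 r (hr r h'), fun A h' => h.2 A (ha A h')⟩

/-- From memory `s`, the command `c` terminates without an answer within time `T` and with at most
`Q` queries; the final memory represents, in the sense of `R`, a random element with
distribution `μ`. -/
def Tr (E : Env) (c : Cmd) (s : Mem) (T Q : ℕ) {α : Type} (μ : PMF α) (R : α → Mem → Prop) :
    Prop :=
  -- The number of steps that `c` takes differs from run to run, so there is no fixed moment at
  -- which its result could be inspected. Quantifying over the continuation `rest` avoids this: only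
  -- the final answer, stable from some time on, is compared.
  ∀ (rest : List Cmd) (N M : ℕ) (ν : α → PMF Bool),
    (∀ a s', R a s' → Frame c s s' → Yields E rest s' N M (ν a)) →
    Yields E (c :: rest) s (N + T) (M + Q) (μ.bind ν)

/-- `Tr` for a command whose final memory is described by a predicate. -/
abbrev TrD (E : Env) (c : Cmd) (s : Mem) (T Q : ℕ) (R : Mem → Prop) : Prop :=
  Tr E c s T Q (PMF.pure ()) fun _ => R

namespace Tr

variable {E : Env} {α β : Type}

lemma mono {c : Cmd} {s : Mem} {T Q T' Q' : ℕ} {μ : PMF α} {R R' : α → Mem → Prop}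
    (h : Tr E c s T Q μ R) (hT : T ≤ T') (hQ : Q ≤ Q')
    (hR : ∀ a s', R a s' → Frame c s s' → R' a s') : Tr E c s T' Q' μ R' := by
  intro rest N M ν hν
  exact (h rest N M ν fun a s' hR1 hF => hν a s' (hR a s' hR1 hF) hF).mono (by omega) (by omega)

lemma map {c : Cmd} {s : Mem} {T Q T' Q' : ℕ} {μ : PMF α} {R : α → Mem → Prop}
    {R' : β → Mem → Prop} (φ : α → β) (h : Tr E c s T Q μ R) (hT : T ≤ T') (hQ : Q ≤ Q')
    (hR : ∀ a s', R a s' → Frame c s s' → R' (φ a) s') : Tr E c s T' Q' (μ.map φ) R' := by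
  intro rest N M ν hν
  rw [PMF.bind_map]
  exact (h rest N M (ν ∘ φ) fun a s' hR1 hF => hν _ s' (hR a s' hR1 hF) hF).mono
    (by omega) (by omega)

/-- The law `κ a` of the second command may depend on the outcome `a` represented by the memory that
the first one leaves, so composition of commands becomes `PMF.bind`. `seqD` and `seqMap` are the
cases of a deterministic first or second command. -/
lemma seq {c₁ c₂ : Cmd} {s : Mem} {T₁ Q₁ T₂ Q₂ : ℕ} {μ : PMF α} {κ : α → PMF β}
    {R₁ : α → Mem → Prop} {R₂ : β → Mem → Prop} (h₁ : Tr E c₁ s T₁ Q₁ μ R₁)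
    (h₂ : ∀ a s', R₁ a s' → Frame c₁ s s' → Tr E c₂ s' T₂ Q₂ (κ a) R₂) :
    Tr E (.seq c₁ c₂) s (T₁ + T₂ + 1) (Q₁ + Q₂) (μ.bind κ) R₂ := by
  intro rest N M ν hν
  have : Yields E (c₁ :: c₂ :: rest) s (N + T₂ + T₁) (M + Q₂ + Q₁)
      (μ.bind fun a => (κ a).bind ν) := by
    refine h₁ _ _ _ _ fun a s' hR hF => h₂ a s' hR hF _ _ _ _ fun b s'' hR' hF' => ?_
    refine hν b s'' hR' (Frame.trans (s' := s') ?_ ?_)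
    · exact hF.weaken (by simp +contextual [Cmd.wr]) (by simp +contextual [Cmd.wa])
    · exact hF'.weaken (by simp +contextual [Cmd.wr]) (by simp +contextual [Cmd.wa])
  have h := Yields.step (E := E) (cmd := .seq c₁ c₂) (rest := rest) (todo := c₁ :: c₂ :: rest)
    (s := s) (U := PMF.pure ()) (σ := fun _ => s) (ν := fun _ => μ.bind fun a => (κ a).bind ν)
    (by intros; simp [Cmd.exec, Mem.config]) (fun _ => this)
  rw [PMF.pure_bind] at h
  rw [PMF.bind_bind]
  exact h.mono (by simp [Cmd.cost]; omega) (by simp [Cmd.queryCount]; omega)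

lemma seqD {c₁ c₂ : Cmd} {s : Mem} {T₁ Q₁ T₂ Q₂ : ℕ} {μ : PMF β}
    {R₁ : Mem → Prop} {R₂ : β → Mem → Prop} (h₁ : TrD E c₁ s T₁ Q₁ R₁)
    (h₂ : ∀ s', R₁ s' → Frame c₁ s s' → Tr E c₂ s' T₂ Q₂ μ R₂) :
    Tr E (.seq c₁ c₂) s (T₁ + T₂ + 1) (Q₁ + Q₂) μ R₂ := by
  have := seq (κ := fun _ : Unit => μ) h₁ (fun _ s' hR hF => h₂ s' hR hF)
  rwa [PMF.pure_bind] at this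

lemma seqMap {c₁ c₂ : Cmd} {s : Mem} {T₁ Q₁ T₂ Q₂ : ℕ} {μ : PMF α}
    {R₁ : α → Mem → Prop} {R₂ : β → Mem → Prop} (φ : α → β) (h₁ : Tr E c₁ s T₁ Q₁ μ R₁)
    (h₂ : ∀ a s', R₁ a s' → Frame c₁ s s' → TrD E c₂ s' T₂ Q₂ (R₂ (φ a))) :
    Tr E (.seq c₁ c₂) s (T₁ + T₂ + 1) (Q₁ + Q₂) (μ.map φ) R₂ := by
  refine seq (κ := fun a => PMF.pure (φ a)) h₁ fun a s' hR hF => ?_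
  have := (h₂ a s' hR hF).map (R' := R₂) (fun _ => φ a) le_rfl le_rfl (fun _ _ h _ => h)
  rwa [PMF.pure_map] at this

lemma ite {r : ℕ} {c₁ c₂ : Cmd} {s : Mem} {T Q : ℕ} {μ : PMF α} {R : α → Mem → Prop}
    (h₁ : s.reg r ≠ 0 → Tr E c₁ s T Q μ R) (h₂ : s.reg r = 0 → Tr E c₂ s T Q μ R) :
    Tr E (.ite r c₁ c₂) s (T + 1) Q μ R := by
  intro rest N M ν hν
  have : Yields E ((if s.reg r ≠ 0 then c₁ else c₂) :: rest) s (N + T) (M + Q) (μ.bind ν) := by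
    split_ifs with h
    · exact h₁ h _ _ _ _ fun a s' hR hF => hν a s' hR
        (hF.weaken (by simp +contextual [Cmd.wr]) (by simp +contextual [Cmd.wa]))
    · exact h₂ (not_not.1 h) _ _ _ _ fun a s' hR hF => hν a s' hR
        (hF.weaken (by simp +contextual [Cmd.wr]) (by simp +contextual [Cmd.wa]))
  have h := Yields.step (E := E) (cmd := .ite r c₁ c₂) (rest := rest)
    (s := s) (U := PMF.pure ()) (σ := fun _ => s) (ν := fun _ => μ.bind ν)
    (by intros; rw [PMF.pure_bind]; rfl) (fun _ => this)
  rw [PMF.pure_bind] at h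
  exact h.mono (by simp only [Cmd.cost]; omega) (by simp [Cmd.queryCount])

end Tr

/-! ### Straight-line code -/

/-- Set a register. -/
def Mem.set (s : Mem) (r v : ℕ) : Mem := ⟨Function.update s.reg r v, s.arr⟩

/-- Set a cell of an array. -/
def Mem.put (s : Mem) (A i v : ℕ) : Mem :=
  ⟨s.reg, Function.update s.arr A (Function.update (s.arr A) i v)⟩

lemma Mem.reg_set (s : Mem) (r v r' : ℕ) :
    (s.set r v).reg r' = if r' = r then v else s.reg r' := by
  simp [Mem.set, Function.update_apply]

lemma Mem.arr_set (s : Mem) (r v : ℕ) : (s.set r v).arr = s.arr := rfl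

lemma Mem.reg_put (s : Mem) (A i v : ℕ) : (s.put A i v).reg = s.reg := rfl

lemma Mem.arr_put (s : Mem) (A i v A' i' : ℕ) :
    (s.put A i v).arr A' i' = if A' = A ∧ i' = i then v else s.arr A' i' := by
  by_cases h : A' = A
  · subst h; simp [Mem.put, Function.update_apply]
  · simp [Mem.put, h]

/-- The point stored in an array. -/
def Mem.point (n : ℕ) (s : Mem) (A : ℕ) : Cube n := fun i => decide (s.arr A i ≠ 0)

/-- Straight-line code. -/
def Cmd.isSL : Cmd → Bool
  | skip => true
  | const _ _ => true
  | op _ _ _ _ => true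
  | load _ _ _ => true
  | store _ _ _ => true
  | query _ _ => true
  | seq c₁ c₂ => c₁.isSL && c₂.isSL
  | ite _ c₁ c₂ => c₁.isSL && c₂.isSL
  | _ => false

/-- The effect of straight-line code. -/
def Cmd.sl (E : Env) : Cmd → Mem → Mem
  | const r v, s => s.set r (v % 2 ^ E.w)
  | op o r a b, s => s.set r (o.apply (s.reg a) (s.reg b) % 2 ^ E.w)
  | load r A i, s => s.set r (s.arr A (s.reg i) % 2 ^ E.w)
  | store A i r, s => s.put A (s.reg i) (s.reg r % 2 ^ E.w)
  | query r A, s => s.set r ((E.f (s.point E.n A)).toNat % 2 ^ E.w)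
  | seq c₁ c₂, s => c₂.sl E (c₁.sl E s)
  | ite r c₁ c₂, s => if s.reg r ≠ 0 then c₁.sl E s else c₂.sl E s
  | _, s => s

/-- A bound for the running time of straight-line code. -/
def Cmd.slTime (n : ℕ) : Cmd → ℕ
  | query _ _ => n + 1
  | seq c₁ c₂ => c₁.slTime n + c₂.slTime n + 1
  | ite _ c₁ c₂ => max (c₁.slTime n) (c₂.slTime n) + 1
  | _ => 1

/-- A bound for the number of queries of straight-line code. -/
def Cmd.slQueries : Cmd → ℕ
  | query _ _ => 1
  | seq c₁ c₂ => c₁.slQueries + c₂.slQueries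
  | ite _ c₁ c₂ => max c₁.slQueries c₂.slQueries
  | _ => 0

lemma Tr.atom {E : Env} {cmd : Cmd} {s s' : Mem}
    (hex : ∀ rest time queries, cmd.exec E.w E.D E.f (s.config rest time queries) =
      PMF.pure (s'.config rest time queries)) (hF : Frame cmd s s') :
    TrD E cmd s (cmd.cost E.n) cmd.queryCount (fun m => m = s') := by
  intro rest N M ν hν
  exact Yields.step (E := E) (cmd := cmd) (rest := rest) (todo := rest)
    (s := s) (U := PMF.pure ()) (σ := fun _ => s') (ν := ν)
    (by intro t q; rw [hex, PMF.pure_bind]) (fun b => hν b s' rfl hF)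

lemma Frame.of_set {c : Cmd} {s : Mem} {r v : ℕ} (h : c.wr r = true) : Frame c s (s.set r v) := by
  refine ⟨fun r' hr' => ?_, fun _ _ => rfl⟩
  rw [Mem.reg_set, if_neg]
  rintro rfl
  simp [h] at hr'

lemma Tr.sl {E : Env} {c : Cmd} {s : Mem} (hc : c.isSL = true) :
    TrD E c s (c.slTime E.n) c.slQueries (fun m => m = c.sl E s) := by
  induction c generalizing s with
  | skip => exact Tr.atom (fun _ _ _ => rfl) (Frame.refl _ _)
  | const r v =>
    exact Tr.atom (fun _ _ _ => rfl) (Frame.of_set (by simp [Cmd.wr]))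
  | op o r a b => exact Tr.atom (fun _ _ _ => rfl) (Frame.of_set (by simp [Cmd.wr]))
  | load r A i => exact Tr.atom (fun _ _ _ => rfl) (Frame.of_set (by simp [Cmd.wr]))
  | store A i r =>
    refine Tr.atom (fun _ _ _ => rfl) ⟨fun _ _ => rfl, fun A' hA' => ?_⟩
    have : A' ≠ A := by rintro rfl; simp [Cmd.wa] at hA'
    simp [Cmd.sl, Mem.put, this]
  | query r A => exact Tr.atom (fun _ _ _ => rfl) (Frame.of_set (by simp [Cmd.wr]))
  | seq c₁ c₂ h₁ h₂ =>
    simp only [Cmd.isSL, Bool.and_eq_true] at hc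
    refine (Tr.seqD (h₁ hc.1) fun s' hs' _ => ?_)
    subst hs'
    exact h₂ hc.2
  | ite r c₁ c₂ h₁ h₂ =>
    simp only [Cmd.isSL, Bool.and_eq_true] at hc
    refine Tr.ite (fun h => ?_) (fun h => ?_)
    · exact (h₁ hc.1).mono (le_max_left _ _) (le_max_left _ _)
        (fun _ _ hR _ => by simp [Cmd.sl, h, hR])
    · exact (h₂ hc.2).mono (le_max_right _ _) (le_max_right _ _)
        (fun _ _ hR _ => by simp [Cmd.sl, h, hR])
  | _ => simp [Cmd.isSL] at hc

lemma Tr.coin {E : Env} {s : Mem} (r : ℕ) (hw : 0 < E.w) :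
    Tr E (.coin r) s 1 0 (PMF.uniformOfFintype Bool) (fun b m => m = s.set r b.toNat) := by
  intro rest N M ν hν
  refine Yields.step (E := E) (cmd := .coin r) (rest := rest) (todo := rest)
    (s := s) (U := PMF.uniformOfFintype Bool) (σ := fun b => s.set r b.toNat) (ν := ν)
    ?_ (fun b => hν b _ rfl (Frame.of_set (by simp [Cmd.wr])))
  intro t q
  have : ∀ b : Bool, b.toNat % 2 ^ E.w = b.toNat := fun b =>
    Nat.mod_eq_of_lt (lt_of_le_of_lt b.toNat_le (Nat.one_lt_two_pow hw.ne'))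
  simp [Cmd.exec, Config.setReg, Mem.config, Mem.set, this]

lemma Tr.sample {E : Env} {s : Mem} (r A : ℕ) (hw : 0 < E.w) :
    Tr E (.sample r A) s (E.n + 1) 1 E.D (fun x m => (∀ i : Fin E.n, m.arr A i = (x i).toNat) ∧
      m.reg r = (E.f x).toNat) := by
  have hb : ∀ b : Bool, b.toNat % 2 ^ E.w = b.toNat := fun b =>
    Nat.mod_eq_of_lt (lt_of_le_of_lt b.toNat_le (Nat.one_lt_two_pow hw.ne'))
  intro rest N M ν hν
  refine Yields.step (E := E) (cmd := .sample r A) (rest := rest) (todo := rest)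
    (s := s) (U := E.D) (σ := fun x => ⟨Function.update s.reg r (E.f x).toNat,
      Function.update s.arr A
      (fun j => if h : j < E.n then (x ⟨j, h⟩).toNat else s.arr A j)⟩) (ν := ν)
    ?_ (fun x => hν x _ ?_ ?_)
  · intro t q
    simp [Cmd.exec, Config.setReg, Config.writePoint, Mem.config, hb]
  · simp
  · constructor
    · intro r' hr'
      have : r' ≠ r := by rintro rfl; simp [Cmd.wr] at hr'
      simp [this]
    · intro r' hr'
      have : r' ≠ A := by rintro rfl; simp [Cmd.wa] at hr'
      simp [this]

/-! ### Counting loops -/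

/-- Iterating a random step whose number is `t, t + 1, …`. -/
def iterK {α : Type} (step : ℕ → α → PMF α) : ℕ → ℕ → α → PMF α
  | _, 0, a => PMF.pure a
  | t, r + 1, a => (step t a).bind (iterK step (t + 1) r)

/-- `for i < reg k do body`, with `c` for the loop condition; register `3` holds `1`. -/
def forLoop (i c k : ℕ) (body : Cmd) : Cmd :=
  .seq (.const i 0) (.seq (.op .lt c i k)
    (.loop c (.seq body (.seq (.op .add i i 3) (.op .lt c i k)))))

/-- The conditions on the registers used by a counting loop. -/
def forOK (i c k : ℕ) (body : Cmd) : Bool :=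
  !Nat.beq i c && !Nat.beq i k && !Nat.beq c k && !Nat.beq i 3 && !Nat.beq c 3 &&
    !body.wr i && !body.wr k && !body.wr 3

/-- Memories that differ only in the registers `i` and `c`. -/
def SameBut (i c : ℕ) (s s' : Mem) : Prop :=
  (∀ r, r ≠ i → r ≠ c → s'.reg r = s.reg r) ∧ s'.arr = s.arr

/-- Induction on the number `j` of remaining iterations. The pair `fc`, `s₀` transports a frame
condition relative to the memory before the loop, so that the invariant `I` only has to mention what
the body changes; `hI` says that it ignores the two bookkeeping registers. -/
lemma Tr.loop {E : Env} {α : Type} {i c k : ℕ} {body : Cmd} {m T Q : ℕ}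
    (hok : forOK i c k body = true) (hm : m < 2 ^ E.w)
    {I : ℕ → α → Mem → Prop} {step : ℕ → α → PMF α}
    (hI : ∀ t a s s', SameBut i c s s' → I t a s → I t a s') {s₀ : Mem} {fc : Cmd}
    (hfr : ∀ r, fc.wr r = false → r ≠ i ∧ r ≠ c ∧ body.wr r = false)
    (hfa : ∀ A, fc.wa A = false → body.wa A = false)
    (hstep : ∀ t a s, t < m → I t a s → s.reg i = t → s.reg k = m → s.reg 3 = 1 →
      Frame fc s₀ s → Tr E body s T Q (step t a) (I (t + 1))) :
    ∀ (j t : ℕ) (a : α) (s : Mem), t + j = m → I t a s → s.reg i = t → s.reg k = m →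
      s.reg 3 = 1 → s.reg c = (if t < m then 1 else 0) → Frame fc s₀ s →
      Tr E (.loop c (.seq body (.seq (.op .add i i 3) (.op .lt c i k)))) s (j * (T + 6) + 1)
        (j * Q) (iterK step t j a) (I m) := by
  simp only [forOK, Bool.and_eq_true, Bool.not_eq_true'] at hok
  obtain ⟨⟨⟨⟨⟨⟨⟨hic, hik⟩, hck⟩, hi3⟩, hc3⟩, hbi⟩, hbk⟩, hb3⟩ := hok
  replace hic : i ≠ c := by rintro rfl; simp at hic
  replace hik : i ≠ k := by rintro rfl; simp at hik
  replace hck : c ≠ k := by rintro rfl; simp at hck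
  replace hi3 : i ≠ 3 := by rintro rfl; simp at hi3
  replace hc3 : c ≠ 3 := by rintro rfl; simp at hc3
  intro j
  induction j with
  | zero =>
    intro t a s htj hIs hi hk h3 hc hF rest N M ν hν
    have htm : t = m := by omega
    subst htm
    rw [if_neg (lt_irrefl _)] at hc
    have h := Yields.step (E := E)
      (cmd := .loop c (.seq body (.seq (.op .add i i 3) (.op .lt c i k)))) (rest := rest)
      (todo := rest) (s := s) (U := PMF.pure ()) (σ := fun _ => s) (ν := fun _ => ν a)
      (by intros; simp [Cmd.exec, Mem.config, hc])
      (fun _ => hν a s hIs (Frame.refl _ _))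
    rw [PMF.pure_bind] at h
    rw [iterK, PMF.pure_bind]
    exact h.mono (by simp [Cmd.cost]) (by simp [Cmd.queryCount])
  | succ j ih =>
    intro t a s htj hIs hi hk h3 hc hF rest N M ν hν
    have htm : t < m := by omega
    rw [if_pos htm] at hc
    set lp := Cmd.loop c (.seq body (.seq (.op .add i i 3) (.op .lt c i k))) with hlp
    have hbody : Tr E (.seq body (.seq (.op .add i i 3) (.op .lt c i k))) s (T + 3 + 1) (Q + 0)
        ((step t a).map id) (fun a' s' => I (t + 1) a' s' ∧ s'.reg i = t + 1 ∧ s'.reg k = m ∧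
          s'.reg 3 = 1 ∧ s'.reg c = (if t + 1 < m then 1 else 0) ∧ Frame fc s₀ s') := by
      refine Tr.seqMap id (hstep t a s htm hIs hi hk h3 hF) fun a' s' hR hF' => ?_
      refine (Tr.sl rfl).mono le_rfl le_rfl fun _ s'' hs'' _ => ?_
      have e1 : s'.reg i = t := by rw [hF'.1 i hbi, hi]
      have e2 : s'.reg k = m := by rw [hF'.1 k hbk, hk]
      have e3 : s'.reg 3 = 1 := by rw [hF'.1 3 hb3, h3]
      have m1 : (t + 1) % 2 ^ E.w = t + 1 := Nat.mod_eq_of_lt (by omega)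
      have m2 : (if t + 1 < m then 1 else 0) % 2 ^ E.w = if t + 1 < m then 1 else 0 :=
        Nat.mod_eq_of_lt (by split_ifs <;> omega)
      have hsame : SameBut i c s' s'' := by
        subst hs''
        refine ⟨fun r h1 h2 => ?_, rfl⟩
        simp [Cmd.sl, Mem.reg_set, h1, h2]
      refine ⟨hI _ _ _ _ hsame hR, ?_, ?_, ?_, ?_, ?_⟩
      · subst hs''
        simp [Cmd.sl, Mem.reg_set, hic, Op.apply, e1, e3, m1]
      · rw [hsame.1 k hik.symm hck.symm, e2]
      · rw [hsame.1 3 hi3.symm hc3.symm, e3]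
      · subst hs''
        simp [Cmd.sl, Mem.reg_set, hik.symm, Op.apply, e1, e2, e3, m1, m2]
      · refine hF.trans (Frame.trans (s' := s') ?_ ?_)
        · exact hF'.weaken (fun r hr => (hfr r hr).2.2) hfa
        · exact ⟨fun r hr => hsame.1 r (hfr r hr).1 (hfr r hr).2.1, fun A _ => by rw [hsame.2]⟩
    rw [PMF.map_id] at hbody
    have : Yields E ((.seq body (.seq (.op .add i i 3) (.op .lt c i k))) :: lp :: rest) s
        (N + (j * (T + 6) + 1) + (T + 3 + 1)) (M + j * Q + (Q + 0))
        ((step t a).bind fun a' => (iterK step (t + 1) j a').bind ν) := by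
      refine hbody _ _ _ _ fun a' s' hR hF' => ?_
      obtain ⟨h1, h2, h3, h4, h5, h6⟩ := hR
      refine ih (t + 1) a' s' (by omega) h1 h2 h3 h4 h5 h6 _ _ _ _ fun b s'' hb hF'' => ?_
      refine hν b s'' hb (Frame.trans (s' := s') ?_ hF'')
      exact hF'.weaken (by simp [Cmd.wr, hlp]) (by simp [Cmd.wa, hlp])
    have h := Yields.step (E := E)
      (cmd := lp) (rest := rest)
      (s := s) (U := PMF.pure ()) (σ := fun _ => s)
      (ν := fun _ => (step t a).bind fun a' => (iterK step (t + 1) j a').bind ν)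
      (by intros; simp [Cmd.exec, Mem.config, hc, hlp])
      (fun _ => this)
    rw [PMF.pure_bind] at h
    rw [iterK, PMF.bind_bind]
    refine h.mono ?_ ?_
    · simp only [Cmd.cost, hlp]; ring_nf; omega
    · simp only [Cmd.queryCount, hlp]; ring_nf; omega

lemma Tr.forLoop {E : Env} {α : Type} {i c k : ℕ} {body : Cmd} {m T Q : ℕ} {s : Mem}
    (hok : forOK i c k body = true) (hm : m < 2 ^ E.w) (hk : s.reg k = m) (h3 : s.reg 3 = 1)
    (I : ℕ → α → Mem → Prop) (step : ℕ → α → PMF α) (a : α)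
    (hI : ∀ t a s s', SameBut i c s s' → I t a s → I t a s') (h0 : I 0 a s)
    (hstep : ∀ t a s', t < m → I t a s' → s'.reg i = t → s'.reg k = m → s'.reg 3 = 1 →
      Frame (forLoop i c k body) s s' → Tr E body s' T Q (step t a) (I (t + 1))) :
    Tr E (forLoop i c k body) s (m * (T + 6) + 5) (m * Q) (iterK step 0 m a) (I m) := by
  have hok' := hok
  simp only [forOK, Bool.and_eq_true, Bool.not_eq_true'] at hok'
  obtain ⟨⟨⟨⟨⟨⟨⟨hic, hik⟩, hck⟩, hi3⟩, hc3⟩, hbi⟩, hbk⟩, hb3⟩ := hok'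
  replace hic : i ≠ c := by rintro rfl; simp at hic
  replace hik : i ≠ k := by rintro rfl; simp at hik
  replace hck : c ≠ k := by rintro rfl; simp at hck
  replace hi3 : i ≠ 3 := by rintro rfl; simp at hi3
  replace hc3 : c ≠ 3 := by rintro rfl; simp at hc3
  have m2 : (if 0 < m then 1 else 0) % 2 ^ E.w = if 0 < m then 1 else 0 :=
    Nat.mod_eq_of_lt (by split_ifs <;> omega)
  have hfr : ∀ r, (DTTest.forLoop i c k body).wr r = false →
      r ≠ i ∧ r ≠ c ∧ body.wr r = false := by
    intro r hr
    simp only [DTTest.forLoop, Cmd.wr, Bool.or_eq_false_iff] at hr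
    refine ⟨?_, ?_, hr.2.2.1⟩
    · rintro rfl; simp at hr
    · rintro rfl; simp at hr
  refine Tr.mono (T := 1 + (1 + (m * (T + 6) + 1) + 1) + 1) (Q := 0 + (0 + m * Q))
    (R := I m) ?_ (by omega) (by omega) (fun _ _ h _ => h)
  refine Tr.seqD (Tr.sl rfl) fun s₁ hs₁ _ => Tr.seqD (Tr.sl rfl) fun s₂ hs₂ _ => ?_
  have hsame : SameBut i c s s₂ := by
    subst hs₂; subst hs₁
    refine ⟨fun r h1 h2 => ?_, rfl⟩
    simp [Cmd.sl, Mem.reg_set, h1, h2]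
  refine Tr.loop (fc := DTTest.forLoop i c k body) (s₀ := s) hok hm hI hfr ?_ hstep m 0 a s₂
    (by omega) (hI _ _ _ _ hsame h0) ?_ ?_ ?_ ?_ ?_
  · intro A hA
    simp only [DTTest.forLoop, Cmd.wa, Bool.or_eq_false_iff] at hA
    exact hA.2.2.1
  · subst hs₂; subst hs₁
    simp [Cmd.sl, Mem.reg_set, hic]
  · rw [hsame.1 k hik.symm hck.symm, hk]
  · rw [hsame.1 3 hi3.symm hc3.symm, h3]
  · subst hs₂; subst hs₁
    simp [Cmd.sl, Mem.reg_set, hik.symm, Op.apply, hk, m2]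
  · exact ⟨fun r hr => hsame.1 r (hfr r hr).1 (hfr r hr).2.1, fun A _ => by rw [hsame.2]⟩

lemma iterK_pure {α : Type} (g : ℕ → α → α) (t r : ℕ) (a : α) :
    iterK (fun t a => PMF.pure (g t a)) t r a =
      PMF.pure ((List.range' t r).foldl (fun a t => g t a) a) := by
  induction r generalizing t a with
  | zero => rfl
  | succ r ih => simp [iterK, PMF.pure_bind, ih, List.range'_succ]

lemma Tr.forD {E : Env} {i c k : ℕ} {body : Cmd} {m T Q : ℕ} {s : Mem}
    (hok : forOK i c k body = true) (hm : m < 2 ^ E.w) (hk : s.reg k = m) (h3 : s.reg 3 = 1)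
    (I : ℕ → Mem → Prop)
    (hI : ∀ t s s', SameBut i c s s' → I t s → I t s') (h0 : I 0 s)
    (hstep : ∀ t s', t < m → I t s' → s'.reg i = t → s'.reg k = m → s'.reg 3 = 1 →
      Frame (DTTest.forLoop i c k body) s s' → TrD E body s' T Q (I (t + 1))) :
    TrD E (DTTest.forLoop i c k body) s (m * (T + 6) + 5) (m * Q) (I m) := by
  have := Tr.forLoop hok hm hk h3 (fun t (_ : Unit) => I t) (fun _ _ => PMF.pure ()) ()
    (fun t _ => hI t) h0 (fun t _ s' => hstep t s')
  rwa [iterK_pure (fun _ _ => ())] at this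

end DTTest
end

noncomputable section

namespace DTTest

/-! ### Uniform distributions -/

lemma uniform_map_equiv {α β : Type} [Fintype α] [Fintype β] [Nonempty α] [Nonempty β]
    (e : α ≃ β) : (PMF.uniformOfFintype α).map e = PMF.uniformOfFintype β := by
  classical
  ext b
  rw [PMF.map_apply, tsum_eq_single (e.symm b)]
  · simp [Fintype.card_congr e]
  · intro a ha
    rw [if_neg]
    rintro rfl
    simp at ha

lemma uniform_prod {α β : Type} [Fintype α] [Fintype β] [Nonempty α] [Nonempty β] :
    ((PMF.uniformOfFintype α).bind fun a => (PMF.uniformOfFintype β).map fun b => (a, b)) =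
      PMF.uniformOfFintype (α × β) := by
  classical
  ext ⟨a, b⟩
  rw [PMF.bind_apply, tsum_eq_single a]
  · rw [PMF.map_apply, tsum_eq_single b]
    · simp only [if_true, PMF.uniformOfFintype_apply, Fintype.card_prod, Nat.cast_mul]
      rw [ENNReal.mul_inv] <;> simp
    · intro b' hb'
      rw [if_neg]
      rintro ⟨⟩
      exact hb' rfl
  · intro a' ha'
    rw [PMF.map_apply, ENNReal.tsum_eq_zero.2, mul_zero]
    intro b'
    rw [if_neg]
    rintro ⟨⟩
    exact ha' rfl

/-- Replacing a coordinate of a uniform vector by an independent uniform value. -/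
lemma uniform_update {ι β : Type} [Fintype ι] [DecidableEq ι] [Fintype β] [Nonempty β] (t : ι) :
    ((PMF.uniformOfFintype β).bind fun b =>
      (PMF.uniformOfFintype (ι → β)).map fun u => Function.update u t b) =
      PMF.uniformOfFintype (ι → β) := by
  -- Exchanging the fresh value with the coordinate `t` is an involution of the product, so it
  -- preserves the uniform distribution; its second component is the updated vector.
  let e : β × (ι → β) ≃ β × (ι → β) :=
    { toFun := fun p => (p.2 t, Function.update p.2 t p.1)
      invFun := fun p => (p.2 t, Function.update p.2 t p.1)
      left_inv := fun p => by simp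
      right_inv := fun p => by simp }
  have hsnd : (PMF.uniformOfFintype (β × (ι → β))).map Prod.snd =
      PMF.uniformOfFintype (ι → β) := by
    rw [← uniform_prod, PMF.map_bind]
    simp only [PMF.map_comp, Function.comp_def]
    exact (PMF.bind_const _ _).trans (PMF.map_id _)
  calc _ = (PMF.uniformOfFintype (β × (ι → β))).map (Prod.snd ∘ e) := by
        rw [← uniform_prod, PMF.map_bind]
        simp only [PMF.map_comp, Function.comp_def]
        rfl
    _ = _ := by rw [← PMF.map_comp, uniform_map_equiv, hsnd]

/-- Filling a vector with independent uniform values, one coordinate after the other. -/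
lemma iterK_fill {n : ℕ} {β : Type} [Fintype β] [Nonempty β] (t r : ℕ) (htr : t + r = n)
    (a : Fin n → β) :
    iterK (fun t a => (PMF.uniformOfFintype β).map fun b =>
      (fun i : Fin n => if (i : ℕ) = t then b else a i)) t r a =
      (PMF.uniformOfFintype (Fin n → β)).map fun u (i : Fin n) => if (i : ℕ) < t then a i else u i := by
  induction r generalizing t a with
  | zero =>
    have : (fun (u : Fin n → β) (i : Fin n) => if (i : ℕ) < t then a i else u i) = Function.const _ a := by
      ext u i
      simp [show (i : ℕ) < t by omega]
    rw [this, PMF.map_const, iterK]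
  | succ r ih =>
    have ht : t < n := by omega
    rw [iterK, PMF.bind_map]
    -- The uniform vector on the right is resampled at `t`, which matches the value drawn in this
    -- step on the left.
    conv_rhs => rw [← uniform_update (⟨t, ht⟩ : Fin n), PMF.map_bind]
    congr 1
    ext1 b
    rw [Function.comp_apply, ih (t + 1) (by omega), PMF.map_comp]
    congr 1
    ext u i
    simp only [Function.comp_apply, Function.update_apply, Fin.ext_iff]
    rcases lt_trichotomy (i : ℕ) t with h | h | h
    · simp [h, h.ne, show (i : ℕ) < t + 1 by omega]
    · simp [h]
    · simp [h.ne', show ¬ (i : ℕ) < t + 1 by omega, show ¬ (i : ℕ) < t by omega]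

lemma iterK_fill_zero {n : ℕ} {β : Type} [Fintype β] [Nonempty β] (a : Fin n → β) :
    iterK (fun t a => (PMF.uniformOfFintype β).map fun b =>
      (fun i : Fin n => if (i : ℕ) = t then b else a i)) 0 n a =
      PMF.uniformOfFintype (Fin n → β) := by
  rw [iterK_fill 0 n (by omega)]
  simp only [Nat.not_lt_zero, if_false]
  exact PMF.map_id _

/-! ### The tester as a random experiment -/

/-- The exclusive or of `g 0, …, g (k - 1)`. -/
def xorBelow (g : ℕ → Bool) : ℕ → Bool
  | 0 => false
  | k + 1 => xor (xorBelow g k) (g k)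

/-- Give the labels in a list the binary digits of `c`. -/
def assign (ρ : ℕ → Option Bool) : List ℕ → ℕ → ℕ → Option Bool
  | [], _ => ρ
  | j :: M, c => assign (Function.update ρ j (some (decide (c % 2 = 1)))) M (c / 2)

/-- Give labels the values with which they are listed. -/
def commit (ρ : ℕ → Option Bool) : List (ℕ × Bool) → ℕ → Option Bool
  | [] => ρ
  | p :: M => commit (Function.update ρ p.1 (some p.2)) M

variable {n : ℕ}

/-- The point that is `Y` on the block of variables labelled `j`, is given by `ρ` on the blocks with
labels in the domain of `ρ`, and is constant on each of the other blocks, with the value taken from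
`Z` for labels below `t` and from `U` for the others. -/
def hybrid (lab : Fin n → Fin n) (ρ : ℕ → Option Bool) (U Z : Cube n) (t j : ℕ) (Y : Cube n) :
    Cube n :=
  fun i => if (lab i : ℕ) = j then Y i
    else (ρ (lab i)).getD (if (lab i : ℕ) < t then Z (lab i) else U (lab i))

/-- The derivative of `f`, on blocks, with respect to the labels in `M`. -/
def deriv (f : Cube n → Bool) (lab : Fin n → Fin n) (ρ : ℕ → Option Bool) (M : List ℕ)
    (U Z : Cube n) (t j : ℕ) (Y : Cube n) : Bool :=
  xorBelow (fun c => f (hybrid lab (assign ρ M c) U Z t j Y)) (2 ^ M.length)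

/-- The uniform distribution on the cube. -/
abbrev unif (n : ℕ) : PMF (Cube n) := PMF.uniformOfFintype (Cube n)

/-- One random evaluation at `y` of the linear function close to `g`. -/
def evalLin (g : Cube n → Bool) (y : Cube n) : PMF Bool :=
  (unif n).map fun z => xor (g z) (g fun i => xor (z i) (y i))

/-- One round of the test that `g` is close to a literal, whose value at `x` is `v`. -/
def litTest (g : Cube n → Bool) (x : Cube n) (v : Bool) : PMF Bool :=
  (evalLin g x).bind fun a₀ => (unif n).bind fun y₁ => (unif n).bind fun y₂ =>
    (evalLin g y₁).bind fun a₁ => (evalLin g y₁).bind fun a₂ => (evalLin g y₂).bind fun a₃ =>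
      (evalLin g fun i => !(y₁ i && y₂ i)).map fun a₄ =>
        a₀ == v && a₁ == a₂ && a₄ == !(a₁ && a₃)

/-- The value at `x` of the literal close to `g`, and whether all tests were passed. -/
def litEval (g : Cube n → Bool) (x : Cube n) (reps : ℕ) : PMF (Bool × Bool) :=
  (evalLin g x).bind fun v =>
    (iterK (fun _ ok => (litTest g x v).map fun p => ok && p) 0 reps true).map fun ok => (v, ok)

/-- Search for a point where `φ` does not take the value `b`. -/
def search (φ : Cube n → Bool) (b : Bool) (tries : ℕ) : PMF (Option (Cube n)) :=
  iterK (fun _ (o : Option (Cube n)) => match o with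
    | some z => PMF.pure (some z)
    | none => (unif n).map fun z => if φ z = b then none else some z) 0 tries none

/-- One step of binary search for a place where `φ` changes from `b`. -/
def bisect (φ : ℕ → Bool) (b : Bool) (p : ℕ × ℕ) : ℕ × ℕ :=
  if φ ((p.1 + p.2) / 2) = b then ((p.1 + p.2) / 2, p.2) else (p.1, (p.1 + p.2) / 2)

/-- The state of the evaluation of the decision tree at a sample point. -/
structure TState : Type where
  ρ : ℕ → Option Bool
  M : List (ℕ × Bool)
  b : Bool
  cnt : ℕ
  flag : Bool

/-- The labels of the variables in the current monomial. -/
abbrev TState.labels (st : TState) : List ℕ := st.M.map Prod.fst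

/-- The numbers that control the tester: the depth `d`, the number `L` of labels, and the numbers
of rounds of the various loops. -/
structure Params : Type where
  d : ℕ
  L : ℕ
  halvings : ℕ
  tries : ℕ
  reps : ℕ
  rounds : ℕ

variable (P : Params) (f : Cube n → Bool) (lab : Fin n → Fin n)

/-- The derivative at the hybrid of `U` and `Z`. -/
def TState.val (st : TState) (U Z : Cube n) (t : ℕ) : Bool :=
  -- No label equals `n`, so the special block is empty here and the last argument plays no role.
  deriv f lab st.ρ st.labels U Z t n U

/-- The label at which the derivative changes between `U` and `Z`. -/
def TState.pivot (st : TState) (U Z : Cube n) (b : Bool) : ℕ :=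
  ((bisect (st.val f lab U Z) b)^[P.halvings] (0, P.L)).1

/-- The change of state after a variable has been found and evaluated. -/
def TState.push (st : TState) (b : Bool) (j : ℕ) (v ok : Bool) : TState :=
  -- For a depth-`d` tree with good labels and correct values so far, a genuine pivot always
  -- satisfies this condition (`Inv.push`). For other `f` it caps the number of variables at `d *
  -- d`, which is the depth of the tree in the soundness proof, and violating it leads to rejection.
  if st.M.length < P.d ∧ st.cnt < P.d * P.d then
    ⟨st.ρ, st.M ++ [(j, v)], b, st.cnt + 1, st.flag || !ok⟩
  else ⟨st.ρ, st.M, b, st.cnt, true⟩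

/-- One round of the evaluation of the decision tree at `x`. -/
def round (x : Cube n) (st : TState) : PMF TState :=
  (unif n).bind fun U => (search (fun Z => st.val f lab U Z P.L) (st.val f lab U U 0)
    P.tries).bind fun o => match o with
    | none => PMF.pure ⟨commit st.ρ st.M, [], st.val f lab U U 0, st.cnt, st.flag⟩
    | some Z =>
      (litEval (fun Y => deriv f lab st.ρ st.labels U Z
        (st.pivot P f lab U Z (st.val f lab U U 0)) (st.pivot P f lab U Z (st.val f lab U U 0)) Y)
        x P.reps).map fun p =>
          st.push P (st.val f lab U U 0) (st.pivot P f lab U Z (st.val f lab U U 0)) p.1 p.2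

/-- The initial state of an evaluation. -/
def TState.init (flag : Bool) : TState := ⟨fun _ => none, [], false, 0, flag⟩

/-- Test of one sample point; the result tells whether to reject. -/
def sampleTest (D : PMF (Cube n)) (flag : Bool) : PMF Bool :=
  D.bind fun x => (iterK (fun _ => round P f lab x) 0 P.rounds (TState.init flag)).map
    fun st => st.flag || !(st.b == f x)

/-- The number with given binary digits, of which the first `t` are used. -/
def encode {K : ℕ} (u : Cube K) : ℕ → ℕ
  | 0 => 0
  | t + 1 => 2 * encode u t + if h : t < K then (u ⟨t, h⟩).toNat else 0

lemma encode_lt {K : ℕ} (u : Cube K) (t : ℕ) : encode u t < 2 ^ t := by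
  induction t with
  | zero => simp [encode]
  | succ t ih =>
    have : (if h : t < K then (u ⟨t, h⟩).toNat else 0) ≤ 1 := by
      split_ifs
      · exact Bool.toNat_le _
      · exact Nat.zero_le _
    rw [encode, pow_succ]
    omega

/-- Random labels below `2 ^ K`, or distinct labels if there are at most `2 ^ K` variables. -/
def randomLabels (n K : ℕ) : PMF (Fin n → Fin n) :=
  if h : 2 ^ K < n then
    (PMF.uniformOfFintype (Fin n → Cube K)).map
      fun u i => ⟨encode (u i) K, (encode_lt _ _).trans h⟩
  else PMF.pure id

/-- The tester; the result tells whether to accept. -/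
def tester (K samples : ℕ) (D : PMF (Cube n)) : PMF Bool :=
  (randomLabels n K).bind fun lab =>
    (iterK (fun _ => sampleTest P f lab D) 0 samples false).map fun b => !b

end DTTest
end

noncomputable section

namespace DTTest

/-! ### The program and its correctness

Registers that are set once: `0` the number of variables `n`, `1` the depth `d`, `2` the number `m`,
`3` and `4` the constants `1` and `2`, `5` the number of labels, `6` the number of halvings,
`7` the bound for the number of variables, `8`, `9`, `10`, `11` the numbers of tries, repetitions,
rounds and samples.
State of the test: `12` reject flag, `13` the bit `b`, `14` the length of the monomial, `15` the
number of variables found, `16` the value of `f` at the sample.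
Work registers: `17` threshold and `18` label of a hybrid, `19` value of the derivative, `20` search
successful, `21`, `22` ends of the interval of binary search, `23` value of the literal,
`24` value of the linear function, `25` to `29` data of the literal test, `30` and higher scratch
and loop registers.
Arrays: `0` labels, `1` sample, `2` domain of the partial assignment, `3` its values,
`4` and `5` ends of the hybrid, `6` the point on the block, `7` labels in the monomial and `8` their
values, `9` query point, `10`, `11`, `12` points of the literal test. -/

variable {E : Env}

/-- Array `A` holds the point `u`. -/
def HasPoint {n : ℕ} (s : Mem) (A : ℕ) (u : Cube n) : Prop := ∀ i : Fin n, s.arr A i = (u i).toNat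

lemma HasPoint.congr {n : ℕ} {s s' : Mem} {A : ℕ} {u : Cube n} (h : HasPoint s A u)
    (hA : s'.arr A = s.arr A) : HasPoint s' A u := fun i => by rw [hA]; exact h i

lemma Cmd.sl_frame (E : Env) {o : Cmd} (ho : o.isSL = true) (s : Mem) : Frame o s (o.sl E s) := by
  induction o generalizing s with
  | seq c₁ c₂ h₁ h₂ =>
    simp only [Cmd.isSL, Bool.and_eq_true] at ho
    exact ((h₁ ho.1 s).weaken (by simp +contextual [Cmd.wr])
      (by simp +contextual [Cmd.wa])).trans ((h₂ ho.2 _).weaken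
      (by simp +contextual [Cmd.wr]) (by simp +contextual [Cmd.wa]))
  | ite r c₁ c₂ h₁ h₂ =>
    simp only [Cmd.isSL, Bool.and_eq_true] at ho
    simp only [Cmd.sl]
    split_ifs
    · exact (h₁ ho.1 s).weaken (by simp +contextual [Cmd.wr]) (by simp +contextual [Cmd.wa])
    · exact (h₂ ho.2 s).weaken (by simp +contextual [Cmd.wr]) (by simp +contextual [Cmd.wa])
  | store A i r =>
    refine ⟨fun _ _ => rfl, fun A' hA' => ?_⟩
    have : A' ≠ A := by rintro rfl; simp [Cmd.wa] at hA'
    simp [Cmd.sl, Mem.put, this]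
  | _ => first | exact Frame.refl _ _ | exact Frame.of_set (by simp [Cmd.wr])

lemma toNat_mod {w : ℕ} (hw : 0 < w) (b : Bool) : b.toNat % 2 ^ w = b.toNat :=
  Nat.mod_eq_of_lt (lt_of_le_of_lt b.toNat_le (Nat.one_lt_two_pow hw.ne'))

/-- Fill array `A` with random bits. -/
def fillCmd (A : ℕ) : Cmd := forLoop 46 47 0 (.seq (.coin 60) (.store A 46 60))

/-- After `t` iterations only the first `t` cells are claimed to agree with the vector. It starts as
an arbitrary one and is overwritten coordinate by coordinate, which gives the uniform law by
`iterK_fill_zero`. -/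
lemma fillCmd_spec {s : Mem} (A : ℕ) (h0 : s.reg 0 = E.n) (h3 : s.reg 3 = 1)
    (hn : E.n < 2 ^ E.w) (hw : 0 < E.w) :
    Tr E (fillCmd A) s (E.n * 9 + 5) 0 (unif E.n) (fun u s' => HasPoint s' A u) := by
  have := Tr.forLoop (E := E) (i := 46) (c := 47) (k := 0)
    (body := .seq (.coin 60) (.store A 46 60)) (m := E.n) (T := 3) (Q := 0) (s := s)
    rfl hn h0 h3 (fun t (a : Cube E.n) s => ∀ i : Fin E.n, (i : ℕ) < t → s.arr A i = (a i).toNat)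
    (fun t a => (PMF.uniformOfFintype Bool).map fun b =>
      (fun i : Fin E.n => if (i : ℕ) = t then b else a i)) (fun _ => false)
    (fun t a s s' hs h i hi => by rw [hs.2]; exact h i hi) (fun i hi => absurd hi (by omega))
    ?_
  · rw [iterK_fill_zero] at this
    exact this.mono le_rfl (by omega) (fun u s' h _ i => h i i.2)
  · intro t a s' ht hI hi hk h3 hF
    refine Tr.seqMap (T₁ := 1) (T₂ := 1) (Q₁ := 0) (Q₂ := 0) _ (Tr.coin 60 hw)
      fun b s₁ hs₁ _ => (Tr.sl rfl).mono le_rfl le_rfl fun _ s₂ hs₂ _ => ?_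
    intro i hit
    subst hs₂ hs₁
    simp only [Cmd.sl, Mem.arr_put, Mem.reg_set, Mem.arr_set, hi]
    by_cases h : (i : ℕ) = t
    · simp [h, toNat_mod hw]
    · simpa [h] using hI i (by omega)

/-- Combine the arrays `A` and `B` cell by cell into `C`; the straight-line code `o` computes
register `62` from the registers `60` and `61`. -/
def zipCmd (A B C : ℕ) (o : Cmd) : Cmd :=
  forLoop 46 47 0 (.seq (.load 60 A 46) (.seq (.load 61 B 46) (.seq o (.store C 46 62))))

/-- Exclusive or of the bits in registers `60` and `61`. -/
def xorCmd : Cmd := .seq (.op .add 62 60 61) (.op .mod 62 62 4)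

/-- Negated conjunction of the bits in registers `60` and `61`. -/
def nandCmd : Cmd := .seq (.op .mul 62 60 61) (.op .sub 62 3 62)

/-- The straight-line code `o` computes the Boolean function `φ`. -/
def Computes (E : Env) (o : Cmd) (φ : Bool → Bool → Bool) : Prop :=
  o.isSL = true ∧ o.slQueries = 0 ∧ o.slTime E.n = 3 ∧ o.wa = (fun _ => false) ∧
  (∀ r, o.wr r = Nat.beq 62 r) ∧
  ∀ s a b, s.reg 3 = 1 → s.reg 4 = 2 → s.reg 60 = Bool.toNat a → s.reg 61 = Bool.toNat b →
    (o.sl E s).reg 62 = (φ a b).toNat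

lemma xorCmd_computes (hw : 2 < 2 ^ E.w) : Computes E xorCmd xor := by
  refine ⟨rfl, rfl, rfl, rfl, fun r => ?_, fun s a b h3 h4 ha hb => ?_⟩
  · simp [xorCmd, Cmd.wr]
  · have h1 : 1 % 2 ^ E.w = 1 := Nat.mod_eq_of_lt (by omega)
    have h2 : 2 % 2 ^ E.w = 2 := Nat.mod_eq_of_lt (by omega)
    cases a <;> cases b <;> simp [xorCmd, Cmd.sl, Mem.reg_set, Op.apply, ha, hb, h4, h1, h2]

lemma nandCmd_computes (hw : 2 < 2 ^ E.w) : Computes E nandCmd fun a b => !(a && b) := by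
  refine ⟨rfl, rfl, rfl, rfl, fun r => ?_, fun s a b h3 h4 ha hb => ?_⟩
  · simp [nandCmd, Cmd.wr]
  · have h1 : 1 % 2 ^ E.w = 1 := Nat.mod_eq_of_lt (by omega)
    cases a <;> cases b <;> simp [nandCmd, Cmd.sl, Mem.reg_set, Op.apply, ha, hb, h3, h1]

/-- The target `C` may be the same array as `A`, as happens in `evalCmd`. The invariant therefore
keeps only the part of `A` that is still unread, while `B` has to be a different array. -/
lemma zipCmd_spec {s : Mem} {A B C : ℕ} {o : Cmd} {φ : Bool → Bool → Bool} {a b : Cube E.n}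
    (ho : Computes E o φ) (h0 : s.reg 0 = E.n) (h3 : s.reg 3 = 1) (h4 : s.reg 4 = 2)
    (hn : E.n < 2 ^ E.w) (hw : 0 < E.w) (hBC : B ≠ C)
    (ha : HasPoint s A a) (hb : HasPoint s B b) :
    TrD E (zipCmd A B C o) s (E.n * 15 + 5) 0 (fun s' => HasPoint s' C fun i => φ (a i) (b i)) := by
  obtain ⟨ho1, ho2, ho3, ho4, ho5, ho6⟩ := ho
  have := Tr.forD (E := E) (i := 46) (c := 47) (k := 0)
    (body := .seq (.load 60 A 46) (.seq (.load 61 B 46) (.seq o (.store C 46 62))))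
    (m := E.n) (T := 9) (Q := 0) (s := s)
    (by simp only [forOK, Cmd.wr, ho5]; rfl) hn h0 h3 (fun t s' => (∀ i : Fin E.n, (i : ℕ) < t →
      s'.arr C i = (φ (a i) (b i)).toNat) ∧ (∀ i : Fin E.n, t ≤ i → s'.arr A i = (a i).toNat) ∧
      s'.reg 4 = 2)
    (fun t s s' hs h => by
      rw [hs.2, hs.1 4 (by decide) (by decide)]; exact h) ⟨fun i hi => absurd hi (by omega),
      fun i _ => ha i, h4⟩
    ?_
  · exact this.mono le_rfl (by omega) (fun u s' h _ i => h.1 i i.2)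
  · intro t s' ht ⟨hI, hI', hs4⟩ hi hk hs3 hF
    have hB : s'.arr B = s.arr B := by
      refine hF.2 B ?_
      simpa [forLoop, Cmd.wa, ho4] using
        Bool.eq_false_iff.2 fun h => hBC (Nat.eq_of_beq_eq_true h).symm
    refine (Tr.sl (by simp [Cmd.isSL, ho1])).mono (by simp [Cmd.slTime, ho3])
      (by simp [Cmd.slQueries, ho2]) fun _ s₂ hs₂ _ => ?_
    subst hs₂
    have key : ∀ s₁ : Mem, (o.sl E s₁).reg 46 = s₁.reg 46 ∧ (o.sl E s₁).reg 4 = s₁.reg 4 ∧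
        (o.sl E s₁).arr = s₁.arr := by
      intro s₁
      have hfr := Cmd.sl_frame E ho1 s₁
      exact ⟨hfr.1 46 (by rw [ho5]; rfl), hfr.1 4 (by rw [ho5]; rfl),
        funext fun A => hfr.2 A (by rw [ho4])⟩
    set s₁ := (Cmd.load 61 B 46).sl E ((Cmd.load 60 A 46).sl E s') with hs₁
    have e60 : s₁.reg 60 = (a ⟨t, ht⟩).toNat := by
      have := hI' ⟨t, ht⟩ le_rfl
      simp only at this
      simp [hs₁, Cmd.sl, Mem.reg_set, hi, this, toNat_mod hw]
    have e61 : s₁.reg 61 = (b ⟨t, ht⟩).toNat := by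
      have := hb ⟨t, ht⟩
      simp only at this
      simp [hs₁, Cmd.sl, Mem.reg_set, Mem.arr_set, hi, hB, this, toNat_mod hw]
    have e62 := ho6 s₁ _ _ (by simp [hs₁, Cmd.sl, Mem.reg_set, hs3])
      (by simp [hs₁, Cmd.sl, Mem.reg_set, hs4]) e60 e61
    have e46 : s₁.reg 46 = t := by simp [hs₁, Cmd.sl, Mem.reg_set, hi]
    have earr : s₁.arr = s'.arr := rfl
    have e4 : s₁.reg 4 = 2 := by simp [hs₁, Cmd.sl, Mem.reg_set, hs4]
    have hexp : (Cmd.sl E (.seq (.load 60 A 46) (.seq (.load 61 B 46)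
        (.seq o (.store C 46 62)))) s') = (o.sl E s₁).put C t ((φ (a ⟨t, ht⟩) (b ⟨t, ht⟩)).toNat) := by
      show (o.sl E s₁).put C ((o.sl E s₁).reg 46) ((o.sl E s₁).reg 62 % 2 ^ E.w) = _
      rw [(key s₁).1, e46, e62, toNat_mod hw]
    rw [hexp]
    refine ⟨fun i hit => ?_, fun i hit => ?_, ?_⟩
    · rw [Mem.arr_put, (key s₁).2.2, earr]
      by_cases h : (i : ℕ) = t
      · have : i = ⟨t, ht⟩ := Fin.ext h
        simp [this]
      · simpa [h] using hI i (by omega)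
    · rw [Mem.arr_put, (key s₁).2.2, earr, if_neg (by omega)]
      exact hI' i (by omega)
    · rw [Mem.reg_put, (key s₁).2.1, e4]

end DTTest
end

/-! ### Evaluation of a derivative by the program -/

noncomputable section

namespace DTTest

variable {E : Env}

/-- Digits are consumed from the least significant one, so the last label receives the top digit.
This drives the loop of `digitsCmd` and, in `dfun_append`, the recursion for derivatives. -/
lemma assign_append (ρ : ℕ → Option Bool) (M : List ℕ) (j c : ℕ) :
    assign ρ (M ++ [j]) c =
      Function.update (assign ρ M c) j (some (decide (c / 2 ^ M.length % 2 = 1))) := by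
  induction M generalizing ρ c with
  | nil => simp [assign]
  | cons i M ih =>
    simp only [List.cons_append, assign, ih, List.length_cons]
    rw [Nat.div_div_eq_div_mul, ← pow_succ']

lemma assign_isSome (ρ : ℕ → Option Bool) (M : List ℕ) (c l : ℕ) :
    (assign ρ M c l).isSome ↔ (ρ l).isSome ∨ l ∈ M := by
  induction M generalizing ρ c with
  | nil => simp [assign]
  | cons i M ih =>
    simp only [assign, ih, List.mem_cons, Function.update_apply]
    by_cases h : l = i <;> simp [h]

/-- The constants of the test and the labels are in place. -/
structure Ready (E : Env) (s : Mem) (lab : Fin E.n → Fin E.n) : Prop where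
  r0 : s.reg 0 = E.n
  r3 : s.reg 3 = 1
  r4 : s.reg 4 = 2
  lab : ∀ i : Fin E.n, s.arr 0 i = lab i

lemma Ready.congr {s s' : Mem} {lab : Fin E.n → Fin E.n} (h : Ready E s lab)
    (h0 : s'.reg 0 = s.reg 0) (h3 : s'.reg 3 = s.reg 3) (h4 : s'.reg 4 = s.reg 4)
    (ha : s'.arr 0 = s.arr 0) : Ready E s' lab :=
  ⟨h0.trans h.r0, h3.trans h.r3, h4.trans h.r4, fun i => by rw [ha]; exact h.lab i⟩

lemma Ready.frame {c : Cmd} {s s' : Mem} {lab : Fin E.n → Fin E.n} (h : Ready E s lab)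
    (hF : Frame c s s') (h0 : c.wr 0 = false := by rfl) (h3 : c.wr 3 = false := by rfl)
    (h4 : c.wr 4 = false := by rfl) (ha : c.wa 0 = false := by rfl) : Ready E s' lab :=
  h.congr (hF.1 _ h0) (hF.1 _ h3) (hF.1 _ h4) (hF.2 _ ha)

/-- The memory holds the partial assignment `ρ` and the monomial `M`. -/
structure Holds (E : Env) (s : Mem) (ρ : ℕ → Option Bool) (M : List ℕ) : Prop where
  len : s.reg 14 = M.length
  mono : ∀ (q : ℕ) (h : q < M.length), s.arr 7 q = M[q]
  lt : ∀ j ∈ M, j < E.n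
  -- The labels of `M` are already marked as assigned, because they receive values during the
  -- evaluation of a derivative. Their cells in array `3` are scratch space of `digitsCmd`, so `val`
  -- leaves them out.
  dom : ∀ l < E.n, s.arr 2 l = if (ρ l).isSome ∨ l ∈ M then 1 else 0
  val : ∀ l < E.n, l ∉ M → ∀ v, ρ l = some v → s.arr 3 l = v.toNat

lemma Holds.congr {s s' : Mem} {ρ : ℕ → Option Bool} {M : List ℕ} (h : Holds E s ρ M)
    (h14 : s'.reg 14 = s.reg 14) (h7 : s'.arr 7 = s.arr 7) (h2 : s'.arr 2 = s.arr 2)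
    (h3 : s'.arr 3 = s.arr 3) : Holds E s' ρ M :=
  ⟨h14.trans h.len, by rw [h7]; exact h.mono, h.lt, by rw [h2]; exact h.dom,
    by rw [h3]; exact h.val⟩

/-- The memory holds the description of a hybrid point. -/
structure Ends (E : Env) (s : Mem) (lab : Fin E.n → Fin E.n) (U Z : Cube E.n) (t j : ℕ)
    (Y : Cube E.n) : Prop where
  thr : s.reg 17 = t
  lbl : s.reg 18 = j
  left : HasPoint s 4 U
  right : ∀ i : Fin E.n, (i : ℕ) < t → s.arr 5 i = (Z i).toNat
  block : ∀ i : Fin E.n, (lab i : ℕ) = j → s.arr 6 i = (Y i).toNat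

lemma Ends.congr {s s' : Mem} {lab : Fin E.n → Fin E.n} {U Z : Cube E.n} {t j : ℕ} {Y : Cube E.n}
    (h : Ends E s lab U Z t j Y) (h17 : s'.reg 17 = s.reg 17) (h18 : s'.reg 18 = s.reg 18)
    (h4 : s'.arr 4 = s.arr 4) (h5 : s'.arr 5 = s.arr 5) (h6 : s'.arr 6 = s.arr 6) :
    Ends E s' lab U Z t j Y :=
  ⟨h17.trans h.thr, h18.trans h.lbl, h.left.congr h4, by rw [h5]; exact h.right,
    by rw [h6]; exact h.block⟩

/-- One bit of the query point. -/
def pointBody : Cmd :=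
  .seq (.load 60 0 46) (.seq (.op .eq 61 60 18) (.seq
    (.ite 61 (.load 62 6 46) (.seq (.load 63 2 60) (.ite 63 (.load 62 3 60)
      (.seq (.op .lt 64 60 17) (.ite 64 (.load 62 5 60) (.load 62 4 60))))))
    (.store 9 46 62)))

/-- Prepare the query point in array `9`. -/
def pointCmd : Cmd := forLoop 46 47 0 pointBody

lemma pointCmd_spec {s : Mem} {lab : Fin E.n → Fin E.n} {ρ : ℕ → Option Bool} {U Z Y : Cube E.n}
    {t j : ℕ} (hn : E.n < 2 ^ E.w) (hw : 0 < E.w) (hR : Ready E s lab)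
    (hE : Ends E s lab U Z t j Y)
    (hdom : ∀ l < E.n, s.arr 2 l = (ρ l).isSome.toNat)
    (hval : ∀ l < E.n, ∀ v, ρ l = some v → s.arr 3 l = v.toNat) :
    TrD E pointCmd s (E.n * 20 + 5) 0 (fun s' => s'.point E.n 9 = hybrid lab ρ U Z t j Y) := by
  have := Tr.forD (E := E) (i := 46) (c := 47) (k := 0) (body := pointBody)
    (m := E.n) (T := 14) (Q := 0) (s := s) rfl hn hR.r0 hR.r3
    (fun q s' => ∀ i : Fin E.n, (i : ℕ) < q →
      s'.arr 9 i = (hybrid lab ρ U Z t j Y i).toNat)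
    (fun t s s' hs h => by rw [hs.2]; exact h) (fun i hi => absurd hi (by omega)) ?_
  · refine this.mono le_rfl (by omega) fun _ s' h _ => funext fun i => ?_
    rw [Mem.point, h i i.2]
    cases hybrid lab ρ U Z t j Y i <;> simp
  · intro q s' hq hI hi hk h3 hF
    refine (Tr.sl rfl).mono (by simp [Cmd.slTime, pointBody])
      (by decide) fun _ s₂ hs₂ _ => ?_
    subst hs₂
    set i : Fin E.n := ⟨q, hq⟩ with hidef
    have hiq : (i : ℕ) = q := rfl
    have hlab : s'.arr 0 q = lab i := by rw [hF.2 0 rfl]; exact hR.lab i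
    have elt : (lab i : ℕ) % 2 ^ E.w = lab i := Nat.mod_eq_of_lt ((lab i).2.trans hn)
    have m1 : 1 % 2 ^ E.w = 1 := Nat.mod_eq_of_lt (Nat.one_lt_two_pow hw.ne')
    have e18 : s'.reg 18 = j := by rw [hF.1 18 rfl]; exact hE.lbl
    have e17 : s'.reg 17 = t := by rw [hF.1 17 rfl]; exact hE.thr
    have e2 : s'.arr 2 (lab i) = (ρ (lab i)).isSome.toNat := by
      rw [hF.2 2 rfl]; exact hdom _ (lab i).2
    have hbit : ∀ q', (pointBody.sl E s').arr 9 q' =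
        if q' = q then (hybrid lab ρ U Z t j Y i).toNat else s'.arr 9 q' := by
      intro q'
      unfold hybrid
      by_cases hj : (lab i : ℕ) = j
      · have e6 : s'.arr 6 q = (Y i).toNat := by rw [hF.2 6 rfl]; exact hE.block i hj
        rw [if_pos hj]
        rw [← hj] at e18
        simp only [pointBody, Cmd.sl, Mem.reg_set, Mem.arr_set, Op.apply, hi, hlab, elt, e18]
        simp [m1, e6, toNat_mod hw, hi, Mem.arr_put, Mem.reg_set, Mem.arr_set]
      · cases hρ : ρ (lab i) with
        | some v =>
          have e3 : s'.arr 3 (lab i) = v.toNat := by rw [hF.2 3 rfl]; exact hval _ (lab i).2 v hρ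
          simp only [pointBody, Cmd.sl, Mem.reg_set, Mem.arr_set, Op.apply, hi, hlab, elt, e18]
          simp [m1, e3, toNat_mod hw, hi, hj, e2, hρ, Mem.arr_put, Mem.reg_set,
            Mem.arr_set]
        | none =>
          by_cases ht : (lab i : ℕ) < t
          · have e5 : s'.arr 5 (lab i) = (Z (lab i)).toNat := by
              rw [hF.2 5 rfl]; exact hE.right _ ht
            simp only [pointBody, Cmd.sl, Mem.reg_set, Mem.arr_set, Op.apply, hi, hlab, elt, e18]
            simp [m1, e5, toNat_mod hw, hi, hj, e2, hρ, e17, ht, Mem.arr_put,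
              Mem.reg_set, Mem.arr_set]
          · have e4 : s'.arr 4 (lab i) = (U (lab i)).toNat := by
              rw [hF.2 4 rfl]; exact hE.left _
            simp only [pointBody, Cmd.sl, Mem.reg_set, Mem.arr_set, Op.apply, hi, hlab, elt, e18]
            simp [e4, toNat_mod hw, hi, hj, e2, hρ, e17, ht, Mem.arr_put,
              Mem.reg_set, Mem.arr_set]
    intro i' hi'
    rw [hbit]
    by_cases h : (i' : ℕ) = q
    · have : i' = i := Fin.ext h
      simp [this, hiq]
    · simpa [h] using hI i' (by omega)

/-- Write the digits of register `65` to the labels in the monomial. -/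
def digitsCmd : Cmd :=
  forLoop 50 51 14 (.seq (.load 66 7 50) (.seq (.op .mod 67 65 4)
    (.seq (.store 3 66 67) (.op .div 65 65 4))))

/-- After `q` iterations register `65` holds `c / 2 ^ q` and the first `q` labels of `M` carry their
digits. Cells of labels in `M` not treated so far are left unspecified, since they still hold digits
of an earlier evaluation. -/
lemma digitsCmd_spec {s : Mem} {lab : Fin E.n → Fin E.n} {ρ : ℕ → Option Bool} {M : List ℕ}
    {c : ℕ} (hn : E.n < 2 ^ E.w) (hM : M.length < 2 ^ E.w) (hc : c < 2 ^ E.w) (hw : 2 < 2 ^ E.w)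
    (hR : Ready E s lab) (hH : Holds E s ρ M) (h65 : s.reg 65 = c) :
    TrD E digitsCmd s (M.length * 13 + 5) 0 (fun s' =>
      ∀ l < E.n, ∀ v, assign ρ M c l = some v → s'.arr 3 l = v.toNat) := by
  have := Tr.forD (E := E) (i := 50) (c := 51) (k := 14)
    (body := .seq (.load 66 7 50) (.seq (.op .mod 67 65 4)
      (.seq (.store 3 66 67) (.op .div 65 65 4))))
    (m := M.length) (T := 7) (Q := 0) (s := s) rfl hM hH.len hR.r3
    (fun q s' => s'.reg 65 = c / 2 ^ q ∧ ∀ l < E.n, (l ∉ M ∨ l ∈ M.take q) →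
      ∀ v, assign ρ (M.take q) c l = some v → s'.arr 3 l = v.toNat)
    (fun t s s' hs h => by rw [hs.2, hs.1 65 (by decide) (by decide)]; exact h) ?_ ?_
  · refine this.mono le_rfl (by omega) fun _ s' h _ l hl v hv => h.2 l hl ?_ v ?_
    · simpa using (em (l ∈ M)).symm
    · simpa using hv
  · refine ⟨by simpa using h65, fun l hl h v hv => ?_⟩
    simp only [List.take_zero, List.not_mem_nil, or_false] at h
    exact hH.val l hl h v (by simpa [assign] using hv)
  · intro q s' hq ⟨hI1, hI2⟩ hi hk h3 hF
    refine (Tr.sl rfl).mono (by simp [Cmd.slTime]) (by decide) fun _ s₂ hs₂ _ => ?_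
    subst hs₂
    have e7 : s'.arr 7 q = M[q] := by rw [hF.2 7 rfl]; exact hH.mono q hq
    have e4 : s'.reg 4 = 2 := by rw [hF.1 4 rfl]; exact hR.r4
    have hj : M[q] < E.n := hH.lt _ (List.getElem_mem hq)
    have m1 : M[q] % 2 ^ E.w = M[q] := Nat.mod_eq_of_lt (hj.trans hn)
    have m3 : c / 2 ^ (q + 1) % 2 ^ E.w = c / 2 ^ (q + 1) :=
      Nat.mod_eq_of_lt (lt_of_le_of_lt (Nat.div_le_self _ _) hc)
    have htake : M.take (q + 1) = M.take q ++ [M[q]] := by simp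
    constructor
    · simp [Cmd.sl, Mem.reg_set, Mem.reg_put, Op.apply, hI1, e4, Nat.div_div_eq_div_mul,
        ← pow_succ, m3]
    · intro l hl hmem v hv
      rw [htake, assign_append] at hv
      simp only [Cmd.sl, Mem.reg_set, Mem.reg_put, Mem.arr_set, Mem.arr_put, Op.apply, hI1, e4, hi,
        e7, m1]
      by_cases h : l = M[q]
      · subst h
        have hlen : (M.take q).length = q := by simp [hq.le]
        simp only [Function.update_self, Option.some.injEq, hlen] at hv
        subst hv
        have mm1 : 1 % 2 ^ E.w = 1 := Nat.mod_eq_of_lt (by omega)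
        rcases Nat.mod_two_eq_zero_or_one (c / 2 ^ q) with h' | h' <;> simp [h', mm1]
      · rw [Function.update_of_ne h] at hv
        rw [if_neg (fun hh => h hh.2)]
        refine hI2 l hl ?_ v hv
        rw [htake, List.mem_append, List.mem_singleton] at hmem
        exact hmem.imp_right fun h' => h'.resolve_right h

/-- Evaluate the derivative; the result is in register `19`. -/
def derivCmd : Cmd :=
  .seq (.const 52 1) (.seq (forLoop 50 51 14 (.op .mul 52 52 4)) (.seq (.const 19 0)
    (forLoop 48 49 52 (.seq (.seq (.const 65 0) (.op .add 65 48 65)) (.seq digitsCmd (.seq pointCmd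
      (.seq (.query 68 9) (.seq (.op .add 19 19 68) (.op .mod 19 19 4)))))))))

/-- The counter `c` runs through all values of the labels in `M`, and the answers are added modulo
2. `Holds` survives because only cells of labels in `M` are overwritten. -/
lemma derivCmd_spec {s : Mem} {lab : Fin E.n → Fin E.n} {ρ : ℕ → Option Bool} {M : List ℕ}
    {U Z Y : Cube E.n} {t j d : ℕ} (hn : E.n < 2 ^ E.w) (hd : d < E.w) (hM : M.length ≤ d)
    (hw : 2 < 2 ^ E.w) (hR : Ready E s lab) (hH : Holds E s ρ M) (hE : Ends E s lab U Z t j Y) :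
    TrD E derivCmd s (2 ^ d * (50 * (E.n + d + 1))) (2 ^ d) (fun s' =>
      s'.reg 19 = (deriv E.f lab ρ M U Z t j Y).toNat ∧ Holds E s' ρ M) := by
  have hw0 : 0 < E.w := by omega
  have m1 : 1 % 2 ^ E.w = 1 := Nat.mod_eq_of_lt (by omega)
  have hMw : M.length < 2 ^ E.w := (by omega : M.length < E.w).trans Nat.lt_two_pow_self
  have hpow : 2 ^ M.length < 2 ^ E.w := Nat.pow_lt_pow_right (by norm_num) (by omega)
  refine Tr.mono (T := 1 + ((M.length * (1 + 6) + 5) + (1 + (2 ^ M.length *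
      ((3 + ((M.length * 13 + 5) + ((E.n * 20 + 5) + (E.n + 5) + 1) + 1) + 1) + 6) + 5) + 1) + 1) + 1)
    (Q := 0 + (M.length * 0 + (0 + 2 ^ M.length * (0 + (0 + (0 + 1)))))) ?_ ?_ ?_
    (fun _ _ h _ => h)
  · refine Tr.seqD (Tr.sl rfl) fun s₁ hs₁ hF₁ => ?_
    have hL := Tr.forD (E := E) (i := 50) (c := 51) (k := 14) (body := .op .mul 52 52 4)
      (m := M.length) (T := 1) (Q := 0) (s := s₁) rfl hMw
      (by rw [hF₁.1 14 rfl]; exact hH.len) (by rw [hF₁.1 3 rfl]; exact hR.r3)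
      (fun q s' => s'.reg 52 = 2 ^ q)
      (fun t s s' hs h => by rw [hs.1 52 (by decide) (by decide)]; exact h)
      (by subst hs₁; simp [Cmd.sl, Mem.reg_set, m1]) (by
        intro q s' hq hI hi hk h3 hF
        refine (Tr.sl rfl).mono le_rfl le_rfl fun _ s₂ hs₂ _ => ?_
        subst hs₂
        have e4 : s'.reg 4 = 2 := by rw [hF.1 4 rfl, hF₁.1 4 rfl]; exact hR.r4
        have : 2 ^ (q + 1) % 2 ^ E.w = 2 ^ (q + 1) :=
          Nat.mod_eq_of_lt (Nat.pow_lt_pow_right (by norm_num) (by omega))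
        simp only [Cmd.sl, Mem.reg_set, if_true, Op.apply, hI, e4, ← pow_succ, this])
    refine Tr.seqD hL fun s₂ hs₂ hF₂ => Tr.seqD (Tr.sl rfl) fun s₃ hs₃ hF₃ => ?_
    have h3 : s₃.reg 3 = 1 := by rw [hF₃.1 3 rfl, hF₂.1 3 rfl, hF₁.1 3 rfl]; exact hR.r3
    have h52 : s₃.reg 52 = 2 ^ M.length := by rw [hF₃.1 52 rfl]; exact hs₂
    have hR₃ : Ready E s₃ lab := ((hR.frame hF₁).frame hF₂).frame hF₃
    have hE₃ : Ends E s₃ lab U Z t j Y := by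
      refine hE.congr ?_ ?_ ?_ ?_ ?_
      · rw [hF₃.1 _ rfl, hF₂.1 _ rfl, hF₁.1 _ rfl]
      · rw [hF₃.1 _ rfl, hF₂.1 _ rfl, hF₁.1 _ rfl]
      · rw [hF₃.2 _ rfl, hF₂.2 _ rfl, hF₁.2 _ rfl]
      · rw [hF₃.2 _ rfl, hF₂.2 _ rfl, hF₁.2 _ rfl]
      · rw [hF₃.2 _ rfl, hF₂.2 _ rfl, hF₁.2 _ rfl]
    have hH₃ : Holds E s₃ ρ M := by
      refine hH.congr ?_ ?_ ?_ ?_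
      · rw [hF₃.1 _ rfl, hF₂.1 _ rfl, hF₁.1 _ rfl]
      · rw [hF₃.2 _ rfl, hF₂.2 _ rfl, hF₁.2 _ rfl]
      · rw [hF₃.2 _ rfl, hF₂.2 _ rfl, hF₁.2 _ rfl]
      · rw [hF₃.2 _ rfl, hF₂.2 _ rfl, hF₁.2 _ rfl]
    refine Tr.forD (E := E) (s := s₃) rfl hpow h52 h3
      (fun c s' => s'.reg 19 = (xorBelow (fun c => E.f (hybrid lab (assign ρ M c) U Z t j Y))
        c).toNat ∧ Holds E s' ρ M)
      (fun t s s' hs h => ⟨by rw [hs.1 19 (by decide) (by decide)]; exact h.1,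
        h.2.congr (hs.1 _ (by decide) (by decide)) (by rw [hs.2]) (by rw [hs.2]) (by rw [hs.2])⟩)
      ⟨by subst hs₃; simp [Cmd.sl, Mem.reg_set, xorBelow], hH₃⟩ ?_
    intro c s' hc ⟨hI, hI'⟩ hi hk h3 hF
    have hcw : c < 2 ^ E.w := hc.trans hpow
    have hR' : Ready E s' lab := hR₃.frame hF
    have hE' : Ends E s' lab U Z t j Y := hE₃.congr (hF.1 _ rfl) (hF.1 _ rfl) (hF.2 _ rfl)
      (hF.2 _ rfl) (hF.2 _ rfl)
    -- The loop counter is copied to register `65` first, because `digitsCmd` destroys the number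
    -- that it reads.
    refine Tr.seqD (Tr.sl rfl) fun s₄ hs₄ hF₄ => ?_
    have e65 : s₄.reg 65 = c := by
      subst hs₄
      simp [Cmd.sl, Mem.reg_set, Op.apply, hi, Nat.mod_eq_of_lt hcw]
    have hH₄ : Holds E s₄ ρ M := hI'.congr (hF₄.1 _ rfl) (hF₄.2 _ rfl) (hF₄.2 _ rfl) (hF₄.2 _ rfl)
    refine Tr.seqD (digitsCmd_spec (c := c) hn hMw hcw hw (hR'.frame hF₄) hH₄ e65)
      fun s₅ hs₅ hF₅ => ?_
    have hE₅ : Ends E s₅ lab U Z t j Y := by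
      refine hE'.congr ?_ ?_ ?_ ?_ ?_
      · rw [hF₅.1 _ rfl, hF₄.1 _ rfl]
      · rw [hF₅.1 _ rfl, hF₄.1 _ rfl]
      · rw [hF₅.2 _ rfl, hF₄.2 _ rfl]
      · rw [hF₅.2 _ rfl, hF₄.2 _ rfl]
      · rw [hF₅.2 _ rfl, hF₄.2 _ rfl]
    refine Tr.seqD (pointCmd_spec (ρ := assign ρ M c) hn hw0 ((hR'.frame hF₄).frame hF₅) hE₅
      (fun l hl => ?_) hs₅) fun s₆ hs₆ hF₆ => ?_
    · have := assign_isSome ρ M c l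
      rw [hF₅.2 2 rfl, hH₄.dom l hl]
      by_cases h : (assign ρ M c l).isSome
      · rw [if_pos (this.1 h), h]; rfl
      · rw [if_neg (mt this.2 h), Bool.eq_false_iff.2 h]; rfl
    refine (Tr.sl rfl).mono (by simp [Cmd.slTime]) (by decide) fun _ s₇ hs₇ hF₇ => ?_
    have e19 : s₆.reg 19 = s'.reg 19 := by rw [hF₆.1 19 rfl, hF₅.1 19 rfl, hF₄.1 19 rfl]
    have e4 : s₆.reg 4 = 2 := by rw [hF₆.1 4 rfl, hF₅.1 4 rfl, hF₄.1 4 rfl]; exact hR'.r4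
    constructor
    · have m2 : 2 % 2 ^ E.w = 2 := Nat.mod_eq_of_lt (by omega)
      subst hs₇
      simp only [Cmd.sl, Mem.reg_set, Op.apply, e19, hI, hs₆, e4, xorBelow, toNat_mod hw0]
      cases xorBelow (fun c => E.f (hybrid lab (assign ρ M c) U Z t j Y)) c <;>
        cases E.f (hybrid lab (assign ρ M c) U Z t j Y) <;> simp [m1, m2]
    · refine ⟨?_, ?_, hH₄.lt, ?_, ?_⟩
      · rw [hF₇.1 _ rfl, hF₆.1 _ rfl, hF₅.1 _ rfl]; exact hH₄.len
      · rw [hF₇.2 _ rfl, hF₆.2 _ rfl, hF₅.2 _ rfl]; exact hH₄.mono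
      · rw [hF₇.2 _ rfl, hF₆.2 _ rfl, hF₅.2 _ rfl]; exact hH₄.dom
      · intro l hl hlM v hv
        rw [hF₇.2 3 rfl, hF₆.2 3 rfl]
        refine hs₅ l hl v ?_
        rw [← hv]
        clear * - hlM
        induction M generalizing ρ c with
        | nil => rfl
        | cons i M ih =>
          simp only [List.mem_cons, not_or] at hlM
          rw [assign, ih _ hlM.2, Function.update_of_ne hlM.1]
  · have h1 : 2 ^ M.length ≤ 2 ^ d := Nat.pow_le_pow_right (by norm_num) hM
    have h2 : 1 ≤ 2 ^ d := Nat.one_le_two_pow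
    have h3 : 2 ^ M.length * (3 + (M.length * 13 + 5 + (E.n * 20 + 5 + (E.n + 5) + 1) + 1) + 1 + 6)
        ≤ 2 ^ d * (13 * d + 21 * E.n + 27) := Nat.mul_le_mul h1 (by omega)
    have h4 : 7 * M.length + 15 ≤ 2 ^ d * (7 * d + 15) := by nlinarith
    calc _ ≤ 2 ^ d * (13 * d + 21 * E.n + 27) + 2 ^ d * (7 * d + 15) := by omega
      _ = 2 ^ d * (20 * d + 21 * E.n + 42) := by ring
      _ ≤ _ := Nat.mul_le_mul le_rfl (by omega)
  · have h1 : 2 ^ M.length ≤ 2 ^ d := Nat.pow_le_pow_right (by norm_num) hM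
    simpa using h1

end DTTest
end

/-! ### Evaluation of the linear function close to a derivative -/

noncomputable section

namespace DTTest

variable {E : Env}

/-- Bounds for the numbers that have to fit into a word. -/
structure Bounds (E : Env) (d : ℕ) : Prop where
  -- Binary search adds the two ends of an interval of labels, and this sum must not overflow.
  two_mul : 2 * E.n < 2 ^ E.w
  d : d < E.w
  two : 2 < 2 ^ E.w

lemma Bounds.n {d : ℕ} (h : Bounds E d) : E.n < 2 ^ E.w := by
  have := h.two_mul
  omega

lemma Bounds.pos {d : ℕ} (h : Bounds E d) : 0 < E.w := Nat.pos_of_ne_zero fun h' => by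
  have := h.two
  simp [h'] at this

/-- The time for one evaluation of the derivative. -/
def derivTime (n d : ℕ) : ℕ := 2 ^ d * (50 * (n + d + 1))

lemma le_derivTime (n d : ℕ) : 50 * (n + d + 1) ≤ derivTime n d :=
  Nat.le_mul_of_pos_left _ (by positivity)

/-- The memory while derivatives at hybrids of `U` and `Z` are evaluated. -/
structure Ctx (E : Env) (s : Mem) (lab : Fin E.n → Fin E.n) (ρ : ℕ → Option Bool) (M : List ℕ)
    (U Z : Cube E.n) (t j : ℕ) : Prop where
  ready : Ready E s lab
  holds : Holds E s ρ M
  thr : s.reg 17 = t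
  lbl : s.reg 18 = j
  left : HasPoint s 4 U
  right : ∀ i : Fin E.n, (i : ℕ) < t → s.arr 5 i = (Z i).toNat

variable {lab : Fin E.n → Fin E.n} {ρ : ℕ → Option Bool} {M : List ℕ} {U Z : Cube E.n} {t j : ℕ}

lemma Ctx.ends {s : Mem} (h : Ctx E s lab ρ M U Z t j) {Y : Cube E.n}
    (hY : ∀ i : Fin E.n, (lab i : ℕ) = j → s.arr 6 i = (Y i).toNat) :
    Ends E s lab U Z t j Y := ⟨h.thr, h.lbl, h.left, h.right, hY⟩

lemma Ctx.frame' {c : Cmd} {s s' : Mem} (h : Ctx E s lab ρ M U Z t j) (hF : Frame c s s')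
    (hH : Holds E s' ρ M)
    (h0 : c.wr 0 = false := by rfl) (h3 : c.wr 3 = false := by rfl)
    (h4 : c.wr 4 = false := by rfl) (h17 : c.wr 17 = false := by rfl)
    (h18 : c.wr 18 = false := by rfl) (ha0 : c.wa 0 = false := by rfl)
    (ha4 : c.wa 4 = false := by rfl) (ha5 : c.wa 5 = false := by rfl) :
    Ctx E s' lab ρ M U Z t j :=
  ⟨h.ready.frame hF h0 h3 h4 ha0, hH, (hF.1 _ h17).trans h.thr, (hF.1 _ h18).trans h.lbl,
    h.left.congr (hF.2 _ ha4), by rw [hF.2 _ ha5]; exact h.right⟩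

lemma Holds.frame {c : Cmd} {s s' : Mem} (h : Holds E s ρ M) (hF : Frame c s s')
    (h14 : c.wr 14 = false := by rfl) (ha7 : c.wa 7 = false := by rfl)
    (ha2 : c.wa 2 = false := by rfl) (ha3 : c.wa 3 = false := by rfl) : Holds E s' ρ M :=
  h.congr (hF.1 _ h14) (hF.2 _ ha7) (hF.2 _ ha2) (hF.2 _ ha3)

lemma Ctx.frame {c : Cmd} {s s' : Mem} (h : Ctx E s lab ρ M U Z t j) (hF : Frame c s s')
    (h0 : c.wr 0 = false := by rfl) (h3 : c.wr 3 = false := by rfl)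
    (h4 : c.wr 4 = false := by rfl) (h17 : c.wr 17 = false := by rfl)
    (h18 : c.wr 18 = false := by rfl) (ha0 : c.wa 0 = false := by rfl)
    (ha4 : c.wa 4 = false := by rfl) (ha5 : c.wa 5 = false := by rfl)
    (h14 : c.wr 14 = false := by rfl) (ha7 : c.wa 7 = false := by rfl)
    (ha2 : c.wa 2 = false := by rfl) (ha3 : c.wa 3 = false := by rfl) :
    Ctx E s' lab ρ M U Z t j :=
  h.frame' hF (h.holds.frame hF h14 ha7 ha2 ha3) h0 h3 h4 h17 h18 ha0 ha4 ha5

lemma Ctx.deriv {s : Mem} {d : ℕ} {Y : Cube E.n} (hB : Bounds E d) (hM : M.length ≤ d)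
    (h : Ctx E s lab ρ M U Z t j)
    (hY : ∀ i : Fin E.n, (lab i : ℕ) = j → s.arr 6 i = (Y i).toNat) :
    TrD E derivCmd s (derivTime E.n d) (2 ^ d) (fun s' =>
      s'.reg 19 = (deriv E.f lab ρ M U Z t j Y).toNat ∧ Ctx E s' lab ρ M U Z t j) :=
  (derivCmd_spec hB.n hB.d hM hB.two h.ready h.holds (h.ends hY)).mono le_rfl le_rfl
    fun _ _ hs hF => ⟨hs.1, h.frame' hF hs.2⟩

/-- Copy register `a` to register `r`. -/
def copyCmd (r a : ℕ) : Cmd := .seq (.const r 0) (.op .add r a r)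

lemma copyCmd_sl {s : Mem} {r a : ℕ} (h : a ≠ r) (ha : s.reg a < 2 ^ E.w) :
    (copyCmd r a).sl E s = (s.set r 0).set r (s.reg a) := by
  simp [copyCmd, Cmd.sl, Mem.reg_set, Op.apply, h, Nat.mod_eq_of_lt ha]

/-- Evaluate at the point in array `A` the linear function close to the derivative. -/
def evalCmd (A : ℕ) : Cmd :=
  .seq (fillCmd 6) (.seq derivCmd (.seq (copyCmd 24 19) (.seq (zipCmd 6 A 6 xorCmd)
    (.seq derivCmd (.seq (.op .add 24 24 19) (.op .mod 24 24 4))))))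

/-- The derivative is evaluated at a uniform `z` and at its translate by `y`, whence twice the
queries. The conditions on `A` keep `y` intact until the translate is formed. -/
lemma evalCmd_spec {s : Mem} {A d : ℕ} {y : Cube E.n} (hB : Bounds E d) (hM : M.length ≤ d)
    (h : Ctx E s lab ρ M U Z t j) (hA : HasPoint s A y) (hA6 : A ≠ 6)
    (hA1 : (fillCmd 6).wa A = false) (hA2 : derivCmd.wa A = false) :
    Tr E (evalCmd A) s (3 * derivTime E.n d) (2 * 2 ^ d)
      (evalLin (DTTest.deriv E.f lab ρ M U Z t j) y) (fun a s' => s'.reg 24 = a.toNat ∧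
        Ctx E s' lab ρ M U Z t j) := by
  have hw := hB.pos
  have hw2 := hB.two
  refine Tr.mono (T := (E.n * 9 + 5) + (derivTime E.n d + (3 + ((E.n * 15 + 5) +
      (derivTime E.n d + 3 + 1) + 1) + 1) + 1) + 1)
    (Q := 0 + (2 ^ d + (0 + (0 + (2 ^ d + 0))))) ?_
    (by have := le_derivTime E.n d; omega) (by omega) (fun _ _ h _ => h)
  refine Tr.seqMap _ (fillCmd_spec 6 h.ready.r0 h.ready.r3 hB.n hw) fun z s₁ hs₁ hF₁ => ?_
  have h₁ := h.frame hF₁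
  refine Tr.seqD (h₁.deriv hB hM (Y := z) fun i _ => hs₁ i) fun s₂ hs₂ hF₂ => ?_
  refine Tr.seqD (Tr.sl rfl) fun s₃ hs₃ hF₃ => ?_
  have h₃ := hs₂.2.frame hF₃
  have e24 : s₃.reg 24 = (DTTest.deriv E.f lab ρ M U Z t j z).toNat := by
    rw [hs₃, copyCmd_sl (by decide), Mem.reg_set, if_pos rfl, hs₂.1]
    rw [hs₂.1]
    exact lt_of_le_of_lt (Bool.toNat_le _) (by omega)
  refine Tr.seqD (zipCmd_spec (a := z) (b := y) (xorCmd_computes hw2) h₃.ready.r0 h₃.ready.r3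
    h₃.ready.r4 hB.n hw hA6 ?_ ?_) fun s₄ hs₄ hF₄ => ?_
  · exact hs₁.congr (by rw [hF₃.2 6 rfl, hF₂.2 6 rfl])
  · exact hA.congr (by rw [hF₃.2 A rfl, hF₂.2 A hA2, hF₁.2 A hA1])
  have h₄ := h₃.frame hF₄
  refine Tr.seqD (h₄.deriv hB hM fun i _ => hs₄ i) fun s₅ hs₅ hF₅ => ?_
  refine (Tr.sl rfl).mono le_rfl le_rfl fun _ s₆ hs₆ hF₆ => ⟨?_, hs₅.2.frame hF₆⟩
  have e : s₅.reg 24 = _ := (hF₅.1 24 rfl).trans ((hF₄.1 24 rfl).trans e24)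
  have m1 : 1 % 2 ^ E.w = 1 := Nat.mod_eq_of_lt (by omega)
  have m2 : 2 % 2 ^ E.w = 2 := Nat.mod_eq_of_lt (by omega)
  subst hs₆
  simp only [Cmd.sl, Mem.reg_set, Op.apply, hs₅.1, e, hs₅.2.ready.r4]
  cases DTTest.deriv E.f lab ρ M U Z t j z <;>
    cases DTTest.deriv E.f lab ρ M U Z t j fun i => xor (z i) (y i) <;> simp [m1, m2]

end DTTest
end

/-! ### The literal test as a program -/

noncomputable section

namespace DTTest

variable {E : Env} {lab : Fin E.n → Fin E.n} {ρ : ℕ → Option Bool} {M : List ℕ} {U Z : Cube E.n}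
  {t j : ℕ}

/-- One round of the literal test; register `26` tells whether all tests were passed. -/
def testCmd : Cmd :=
  .seq (evalCmd 1) (.seq (.seq (.op .eq 25 24 23) (.op .mul 26 26 25)) (.seq (fillCmd 10)
    (.seq (fillCmd 11) (.seq (evalCmd 10) (.seq (copyCmd 27 24) (.seq (evalCmd 10)
    (.seq (.seq (.op .eq 25 24 27) (.op .mul 26 26 25)) (.seq (evalCmd 11)
    (.seq (.op .mul 28 27 24) (.seq (zipCmd 10 11 12 nandCmd) (.seq (evalCmd 12)
    (.seq (.op .add 29 24 28) (.seq (.op .eq 25 29 3) (.op .mul 26 26 25))))))))))))))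

/-- Five calls of `evalCmd`, with `2 * 2 ^ d` queries each. The verdicts are accumulated in register
`26` by multiplication. -/
lemma testCmd_spec {s : Mem} {d : ℕ} {x : Cube E.n} {v ok : Bool} (hB : Bounds E d)
    (hM : M.length ≤ d) (h : Ctx E s lab ρ M U Z t j) (hx : HasPoint s 1 x)
    (hv : s.reg 23 = v.toNat) (hok : s.reg 26 = ok.toNat) :
    Tr E testCmd s (17 * derivTime E.n d) (10 * 2 ^ d)
      ((litTest (deriv E.f lab ρ M U Z t j) x v).map fun p => ok && p)
      (fun o s' => s'.reg 26 = o.toNat ∧ Ctx E s' lab ρ M U Z t j) := by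
  have hw := hB.pos
  have hw2 := hB.two
  have m1 : 1 % 2 ^ E.w = 1 := Nat.mod_eq_of_lt (by omega)
  have hb : ∀ b : Bool, b.toNat < 2 ^ E.w := fun b => lt_of_le_of_lt b.toNat_le (by omega)
  set τ := derivTime E.n d with hτ
  have hτn := le_derivTime E.n d
  set g := deriv E.f lab ρ M U Z t j with hg
  -- The conjunction with `ok` is moved into the innermost `map`, so that the chain of binds follows
  -- the order of the commands.
  have hμ : ((litTest g x v).map fun p => ok && p) =
      (evalLin g x).bind fun a₀ => (unif E.n).bind fun y₁ => (unif E.n).bind fun y₂ =>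
      (evalLin g y₁).bind fun a₁ => (evalLin g y₁).bind fun a₂ => (evalLin g y₂).bind fun a₃ =>
      (evalLin g fun i => !(y₁ i && y₂ i)).map fun a₄ =>
        ok && (a₀ == v && a₁ == a₂ && a₄ == !(a₁ && a₃)) := by
    simp only [litTest, PMF.map_bind, PMF.map_comp, Function.comp_def]
  rw [hμ]
  refine Tr.mono (T := 3 * τ + (3 + ((E.n * 9 + 5) + ((E.n * 9 + 5) + (3 * τ + (3 + (3 * τ +
      (3 + (3 * τ + (1 + ((E.n * 15 + 5) + (3 * τ + 5 + 1) + 1) + 1) + 1) + 1) + 1) + 1) + 1)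
      + 1) + 1) + 1) + 1)
    (Q := 2 * 2 ^ d + (0 + (0 + (0 + (2 * 2 ^ d + (0 + (2 * 2 ^ d + (0 + (2 * 2 ^ d +
      (0 + (0 + (2 * 2 ^ d + 0)))))))))))) ?_ (by omega) (by omega) (fun _ _ h _ => h)
  refine Tr.seq (evalCmd_spec hB hM h hx (by decide) rfl rfl) fun a₀ s₁ ⟨ha₀, h₁⟩ hF₁ => ?_
  refine Tr.seqD (Tr.sl rfl) fun s₂ hs₂ hF₂ => ?_
  have h₂ := h₁.frame hF₂
  have e26 : s₂.reg 26 = (ok && (a₀ == v)).toNat := by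
    have e1 : s₁.reg 26 = ok.toNat := (hF₁.1 26 rfl).trans hok
    have e2 : s₁.reg 23 = v.toNat := (hF₁.1 23 rfl).trans hv
    subst hs₂
    simp only [Cmd.sl, Mem.reg_set, Op.apply, e1, e2, ha₀]
    cases a₀ <;> cases v <;> cases ok <;> simp [m1]
  refine Tr.seq (fillCmd_spec 10 h₂.ready.r0 h₂.ready.r3 hB.n hw) fun y₁ s₃ hy₁ hF₃ => ?_
  have h₃ := h₂.frame hF₃
  refine Tr.seq (fillCmd_spec 11 h₃.ready.r0 h₃.ready.r3 hB.n hw) fun y₂ s₄ hy₂ hF₄ => ?_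
  have h₄ := h₃.frame hF₄
  have hy₁' := hy₁.congr (hF₄.2 10 rfl)
  refine Tr.seq (evalCmd_spec hB hM h₄ hy₁' (by decide) rfl rfl) fun a₁ s₅ ⟨ha₁, h₅⟩ hF₅ => ?_
  refine Tr.seqD (Tr.sl rfl) fun s₆ hs₆ hF₆ => ?_
  have h₆ := h₅.frame hF₆
  have e27 : s₆.reg 27 = a₁.toNat := by
    rw [hs₆, copyCmd_sl (by decide) (by rw [ha₁]; exact hb _), Mem.reg_set, if_pos rfl, ha₁]
  have hy₁'' := (hy₁'.congr (hF₅.2 10 rfl)).congr (hF₆.2 10 rfl)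
  refine Tr.seq (evalCmd_spec hB hM h₆ hy₁'' (by decide) rfl rfl) fun a₂ s₇ ⟨ha₂, h₇⟩ hF₇ => ?_
  refine Tr.seqD (Tr.sl rfl) fun s₈ hs₈ hF₈ => ?_
  have h₈ := h₇.frame hF₈
  have e27' : s₇.reg 27 = a₁.toNat := (hF₇.1 27 rfl).trans e27
  have e26' : s₈.reg 26 = (ok && (a₀ == v && a₁ == a₂)).toNat := by
    have e1 : s₇.reg 26 = (ok && (a₀ == v)).toNat := by
      rw [hF₇.1 26 rfl, hF₆.1 26 rfl, hF₅.1 26 rfl, hF₄.1 26 rfl, hF₃.1 26 rfl, e26]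
    subst hs₈
    simp only [Cmd.sl, Mem.reg_set, Op.apply, e1, ha₂, e27']
    rw [← Bool.and_assoc]
    cases a₁ <;> cases a₂ <;> cases (ok && (a₀ == v)) <;> simp [m1]
  have hy₂' : HasPoint s₈ 11 y₂ := hy₂.congr (by
    rw [hF₈.2 11 rfl, hF₇.2 11 rfl, hF₆.2 11 rfl, hF₅.2 11 rfl])
  refine Tr.seq (evalCmd_spec hB hM h₈ hy₂' (by decide) rfl rfl) fun a₃ s₉ ⟨ha₃, h₉⟩ hF₉ => ?_
  refine Tr.seqD (Tr.sl rfl) fun s₁₀ hs₁₀ hF₁₀ => ?_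
  have h₁₀ := h₉.frame hF₁₀
  have e28 : s₁₀.reg 28 = (a₁ && a₃).toNat := by
    have e1 : s₉.reg 27 = a₁.toNat := by rw [hF₉.1 27 rfl, hF₈.1 27 rfl, e27']
    subst hs₁₀
    simp only [Cmd.sl, Mem.reg_set, Op.apply, e1, ha₃]
    cases a₁ <;> cases a₃ <;> simp [m1]
  refine Tr.seqD (zipCmd_spec (a := y₁) (b := y₂) (nandCmd_computes hw2) h₁₀.ready.r0 h₁₀.ready.r3
    h₁₀.ready.r4 hB.n hw (by decide) ?_ ?_) fun s₁₁ hs₁₁ hF₁₁ => ?_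
  · exact hy₁''.congr (by rw [hF₁₀.2 10 rfl, hF₉.2 10 rfl, hF₈.2 10 rfl, hF₇.2 10 rfl])
  · exact hy₂'.congr (by rw [hF₁₀.2 11 rfl, hF₉.2 11 rfl])
  have h₁₁ := h₁₀.frame hF₁₁
  refine Tr.seqMap _ (evalCmd_spec hB hM h₁₁ hs₁₁ (by decide) rfl rfl)
    fun a₄ s₁₂ ⟨ha₄, h₁₂⟩ hF₁₂ => ?_
  refine (Tr.sl rfl).mono le_rfl le_rfl fun _ s₁₃ hs₁₃ hF₁₃ => ⟨?_, h₁₂.frame hF₁₃⟩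
  have e1 : s₁₂.reg 26 = (ok && (a₀ == v && a₁ == a₂)).toNat := by
    rw [hF₁₂.1 26 rfl, hF₁₁.1 26 rfl, hF₁₀.1 26 rfl, hF₉.1 26 rfl, e26']
  have e2 : s₁₂.reg 28 = (a₁ && a₃).toNat := by rw [hF₁₂.1 28 rfl, hF₁₁.1 28 rfl, e28]
  have m2 : 2 % 2 ^ E.w = 2 := Nat.mod_eq_of_lt (by omega)
  subst hs₁₃
  simp only [Cmd.sl, Mem.reg_set, Op.apply, e1, e2, ha₄, h₁₂.ready.r3]
  generalize (a₀ == v && a₁ == a₂) = p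
  generalize (a₁ && a₃) = q
  cases a₄ <;> cases q <;> cases ok <;> cases p <;> simp [m1, m2]

/-- Evaluate a literal, with tests. -/
def litCmd : Cmd :=
  .seq (evalCmd 1) (.seq (copyCmd 23 24) (.seq (.const 26 1) (forLoop 44 45 9 testCmd)))

lemma litCmd_spec {s : Mem} {d reps : ℕ} {x : Cube E.n} (hB : Bounds E d)
    (hM : M.length ≤ d) (h : Ctx E s lab ρ M U Z t j) (hx : HasPoint s 1 x)
    (h9 : s.reg 9 = reps) (hreps : reps < 2 ^ E.w) :
    Tr E litCmd s ((reps + 1) * (18 * derivTime E.n d)) ((reps + 1) * (10 * 2 ^ d))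
      (litEval (deriv E.f lab ρ M U Z t j) x reps)
      (fun p s' => s'.reg 23 = p.1.toNat ∧ s'.reg 26 = p.2.toNat ∧
        Ctx E s' lab ρ M U Z t j) := by
  have hw := hB.pos
  have hw2 := hB.two
  have m1 : 1 % 2 ^ E.w = 1 := Nat.mod_eq_of_lt (by omega)
  have hb : ∀ b : Bool, b.toNat < 2 ^ E.w := fun b => lt_of_le_of_lt b.toNat_le (by omega)
  set τ := derivTime E.n d with hτ
  have hτn := le_derivTime E.n d
  refine Tr.mono (T := 3 * τ + (3 + (1 + (reps * (17 * τ + 6) + 5) + 1) + 1) + 1)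
    (Q := 2 * 2 ^ d + (0 + (0 + reps * (10 * 2 ^ d)))) ?_ ?_ ?_ (fun _ _ h _ => h)
  · refine Tr.seq (evalCmd_spec hB hM h hx (by decide) rfl rfl) fun v s₁ ⟨hv, h₁⟩ hF₁ => ?_
    refine Tr.seqD (Tr.sl rfl) fun s₂ hs₂ hF₂ => Tr.seqD (Tr.sl rfl) fun s₃ hs₃ hF₃ => ?_
    have h₃ := (h₁.frame hF₂).frame hF₃
    have e23 : s₃.reg 23 = v.toNat := by
      rw [hF₃.1 23 rfl, hs₂, copyCmd_sl (by decide) (by rw [hv]; exact hb _), Mem.reg_set,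
        if_pos rfl, hv]
    have e26 : s₃.reg 26 = true.toNat := by subst hs₃; simp [Cmd.sl, Mem.reg_set, m1]
    have e9 : s₃.reg 9 = reps := by rw [hF₃.1 9 rfl, hF₂.1 9 rfl, hF₁.1 9 rfl, h9]
    have hx₃ : HasPoint s₃ 1 x := hx.congr (by rw [hF₃.2 1 rfl, hF₂.2 1 rfl, hF₁.2 1 rfl])
    refine Tr.map (T := reps * (17 * τ + 6) + 5) (Q := reps * (10 * 2 ^ d)) _
      (Tr.forLoop (E := E) (s := s₃) rfl hreps e9 h₃.ready.r3
      (fun _ ok s' => s'.reg 26 = ok.toNat ∧ Ctx E s' lab ρ M U Z t j) _ true ?_ ⟨e26, h₃⟩ ?_)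
      le_rfl le_rfl (fun ok s' hR hF => ⟨(hF.1 23 rfl).trans e23, hR.1, hR.2⟩)
    · intro _ ok s s' hs hI
      refine ⟨(hs.1 26 (by decide) (by decide)).trans hI.1, ?_⟩
      exact hI.2.frame (c := forLoop 44 45 9 .skip)
        ⟨fun r hr => hs.1 r (by rintro rfl; simp [forLoop, Cmd.wr] at hr)
          (by rintro rfl; simp [forLoop, Cmd.wr] at hr), fun A _ => by rw [hs.2]⟩
    · intro _ ok s' _ hI _ _ _ hF
      exact testCmd_spec hB hM hI.2 (hx₃.congr (hF.2 1 rfl)) ((hF.1 23 rfl).trans e23) hI.1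
  · have : (reps + 1) * (18 * τ) = reps * (18 * τ) + 18 * τ := by ring
    have h2 : reps * (17 * τ + 6) ≤ reps * (18 * τ) := Nat.mul_le_mul le_rfl (by omega)
    omega
  · have : (reps + 1) * (10 * 2 ^ d) = reps * (10 * 2 ^ d) + 10 * 2 ^ d := by ring
    omega

end DTTest
end

/-! ### Random search and binary search as programs -/

noncomputable section

namespace DTTest

variable {E : Env} {lab : Fin E.n → Fin E.n} {ρ : ℕ → Option Bool} {M : List ℕ} {U Z : Cube E.n}
  {t j : ℕ}

lemma toNat_injective {a b : Bool} (h : a.toNat = b.toNat) : a = b := by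
  revert h
  cases a <;> cases b <;> simp

lemma Tr.ofD {α : Type} {c : Cmd} {s : Mem} {T Q : ℕ} {R : Mem → Prop} {R' : α → Mem → Prop}
    {a : α} (h : TrD E c s T Q R) (hR : ∀ s', R s' → Frame c s s' → R' a s') :
    Tr E c s T Q (PMF.pure a) R' := by
  have := h.map (R' := R') (fun _ => a) le_rfl le_rfl (fun _ s' h hF => hR s' h hF)
  rwa [PMF.pure_map] at this

/-- The part of `Ctx` that does not mention `Z`. -/
structure Pre (E : Env) (s : Mem) (lab : Fin E.n → Fin E.n) (ρ : ℕ → Option Bool) (M : List ℕ)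
    (U : Cube E.n) (t j : ℕ) : Prop where
  ready : Ready E s lab
  holds : Holds E s ρ M
  thr : s.reg 17 = t
  lbl : s.reg 18 = j
  left : HasPoint s 4 U

lemma Pre.ctx {s : Mem} (h : Pre E s lab ρ M U t j)
    (hZ : ∀ i : Fin E.n, (i : ℕ) < t → s.arr 5 i = (Z i).toNat) : Ctx E s lab ρ M U Z t j :=
  ⟨h.ready, h.holds, h.thr, h.lbl, h.left, hZ⟩

lemma Ctx.pre {s : Mem} (h : Ctx E s lab ρ M U Z t j) : Pre E s lab ρ M U t j :=
  ⟨h.ready, h.holds, h.thr, h.lbl, h.left⟩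

lemma Pre.frame {c : Cmd} {s s' : Mem} (h : Pre E s lab ρ M U t j) (hF : Frame c s s')
    (h0 : c.wr 0 = false := by rfl) (h3 : c.wr 3 = false := by rfl)
    (h4 : c.wr 4 = false := by rfl) (h17 : c.wr 17 = false := by rfl)
    (h18 : c.wr 18 = false := by rfl) (ha0 : c.wa 0 = false := by rfl)
    (ha4 : c.wa 4 = false := by rfl)
    (h14 : c.wr 14 = false := by rfl) (ha7 : c.wa 7 = false := by rfl)
    (ha2 : c.wa 2 = false := by rfl) (ha3 : c.wa 3 = false := by rfl) :
    Pre E s' lab ρ M U t j :=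
  ⟨h.ready.frame hF h0 h3 h4 ha0, h.holds.frame hF h14 ha7 ha2 ha3, (hF.1 _ h17).trans h.thr,
    (hF.1 _ h18).trans h.lbl, h.left.congr (hF.2 _ ha4)⟩

lemma SameBut.frame {i c : ℕ} {s s' : Mem} (h : SameBut i c s s') :
    Frame (forLoop i c 0 .skip) s s' :=
  ⟨fun r hr => h.1 r (by rintro rfl; simp [forLoop, Cmd.wr] at hr)
    (by rintro rfl; simp [forLoop, Cmd.wr] at hr), fun A _ => by rw [h.2]⟩

/-- The body of the search loop. -/
def tryCmd : Cmd :=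
  .ite 20 .skip (.seq (fillCmd 5) (.seq derivCmd (.seq (.op .eq 60 19 13) (.op .sub 20 3 60))))

/-- Search for a point where the derivative differs from the bit in register `13`. -/
def searchCmd : Cmd := .seq (.const 20 0) (forLoop 44 45 8 tryCmd)

lemma lab_ne (lab : Fin E.n → Fin E.n) (i : Fin E.n) : (lab i : ℕ) ≠ E.n := (lab i).2.ne

/-- Register `20` remembers success. From then on the body of the loop does nothing, so the point
that was found stays in array `5`. -/
lemma searchCmd_spec {s : Mem} {d L tries : ℕ} {b : Bool} (hB : Bounds E d)
    (hM : M.length ≤ d) (h : Pre E s lab ρ M U L E.n) (hb : s.reg 13 = b.toNat)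
    (h8 : s.reg 8 = tries) (htries : tries < 2 ^ E.w) :
    Tr E searchCmd s ((tries + 1) * (3 * derivTime E.n d)) (tries * 2 ^ d)
      (search (fun Z => deriv E.f lab ρ M U Z L E.n U) b tries)
      (fun o s' => Pre E s' lab ρ M U L E.n ∧ s'.reg 20 = o.isSome.toNat ∧
        ∀ z, o = some z → HasPoint s' 5 z) := by
  have hw := hB.pos
  have hw2 := hB.two
  have m1 : 1 % 2 ^ E.w = 1 := Nat.mod_eq_of_lt (by omega)
  set τ := derivTime E.n d with hτ
  have hτn := le_derivTime E.n d
  refine Tr.mono (T := 1 + (tries * (2 * τ + 6) + 5) + 1)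
    (Q := 0 + tries * 2 ^ d) ?_ ?_ (by omega) (fun _ _ h _ => h)
  · refine Tr.seqD (Tr.sl rfl) fun s₁ hs₁ hF₁ => ?_
    have h₁ := h.frame hF₁
    refine Tr.forLoop (E := E) (s := s₁) rfl htries ((hF₁.1 8 rfl).trans h8) h₁.ready.r3
      (fun _ (o : Option (Cube E.n)) s' => Pre E s' lab ρ M U L E.n ∧
        s'.reg 20 = o.isSome.toNat ∧ ∀ z, o = some z → HasPoint s' 5 z) _ none ?_ ?_ ?_
    · intro _ o s s' hs ⟨hI1, hI2, hI3⟩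
      exact ⟨hI1.frame hs.frame, (hs.1 20 (by decide) (by decide)).trans hI2,
        fun z hz => (hI3 z hz).congr (by rw [hs.2])⟩
    · refine ⟨h₁, ?_, by simp⟩
      subst hs₁
      simp [Cmd.sl, Mem.reg_set]
    · intro _ o s' _ ⟨hI1, hI2, hI3⟩ _ _ _ hF
      -- The time is split in this way because the branching itself costs 1.
      refine Tr.mono (T := (2 * τ - 1) + 1) (Q := 2 ^ d) (Tr.ite (fun h20 => ?_) (fun h20 => ?_))
        (by omega) le_rfl (fun _ _ h _ => h)
      · cases o with
        | none => simp [hI2] at h20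
        | some z =>
          refine Tr.mono (T := 1) (Q := 0) (Tr.ofD (Tr.sl rfl) (R' := fun o s' =>
            Pre E s' lab ρ M U L E.n ∧ s'.reg 20 = o.isSome.toNat ∧
            ∀ z, o = some z → HasPoint s' 5 z) fun s'' hs'' _ => ?_) (by omega) (Nat.zero_le _)
            (fun _ _ h _ => h)
          have : s'' = s' := hs''
          rw [this]
          exact ⟨hI1, hI2, hI3⟩
      · cases o with
        | some z => simp [hI2] at h20
        | none =>
          refine Tr.mono (T := (E.n * 9 + 5) + (τ + 3 + 1) + 1) (Q := 0 + (2 ^ d + 0)) ?_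
            (by omega) (by omega) (fun _ _ h _ => h)
          refine Tr.seqMap _ (fillCmd_spec 5 hI1.ready.r0 hI1.ready.r3 hB.n hw)
            fun z s₂ hz hF₂ => ?_
          have h₂ := hI1.frame hF₂
          refine Tr.seqD ((h₂.ctx fun i _ => hz i).deriv hB hM (Y := U)
            fun i hi => absurd hi (lab_ne lab i)) fun s₃ ⟨hs₃, h₃⟩ hF₃ => ?_
          refine (Tr.sl rfl).mono le_rfl le_rfl fun _ s₄ hs₄ hF₄ => ?_
          refine ⟨(h₃.frame hF₄).pre, ?_, ?_⟩
          · have e13 : s₃.reg 13 = b.toNat := by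
              rw [hF₃.1 13 rfl, hF₂.1 13 rfl, hF.1 13 rfl, hF₁.1 13 rfl, hb]
            subst hs₄
            simp only [Cmd.sl, Mem.reg_set, Op.apply, hs₃, e13, h₃.ready.r3]
            by_cases hc : deriv E.f lab ρ M U z L E.n U = b
            · simp [hc, m1]
            · simp [hc, mt toNat_injective hc, m1]
          · intro z' hz'
            split_ifs at hz' with hc
            obtain rfl : z = z' := by simpa using hz'
            exact hz.congr (by rw [hF₄.2 5 rfl, hF₃.2 5 rfl])
  · have : (tries + 1) * (3 * τ) = tries * (3 * τ) + 3 * τ := by ring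
    have h2 : tries * (2 * τ + 6) ≤ tries * (3 * τ) := Nat.mul_le_mul le_rfl (by omega)
    omega

/-- The left end stays strictly below `L` whatever `φ` is. So the pivot is a legal label even if `f`
is not a decision tree, as the program logic requires. -/
lemma bisect_bounds (φ : ℕ → Bool) (b : Bool) {L : ℕ} {p : ℕ × ℕ} (h : p.1 < L ∧ p.2 ≤ L) :
    (bisect φ b p).1 < L ∧ (bisect φ b p).2 ≤ L := by
  unfold bisect
  split_ifs <;> constructor <;> simp only <;> omega

lemma bisect_iterate_bounds (φ : ℕ → Bool) (b : Bool) {L : ℕ} (hL : 0 < L) (r : ℕ) :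
    ((bisect φ b)^[r] (0, L)).1 < L ∧ ((bisect φ b)^[r] (0, L)).2 ≤ L := by
  induction r with
  | zero => exact ⟨hL, le_rfl⟩
  | succ r ih => rw [Function.iterate_succ_apply']; exact bisect_bounds φ b ih

/-- Binary search for a label where the derivative changes. -/
def bisectCmd : Cmd :=
  .seq (.const 21 0) (.seq (copyCmd 22 5) (forLoop 44 45 6 (.seq
    (.seq (.op .add 17 21 22) (.op .div 17 17 4)) (.seq derivCmd (.seq (.op .eq 60 19 13)
      (.ite 60 (copyCmd 21 17) (copyCmd 22 17)))))))

/-- The threshold register is overwritten by each midpoint, so its final value is left existential;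
`foundCmd` sets it again. -/
lemma bisectCmd_spec {s : Mem} {d L halvings : ℕ} {b : Bool} (hB : Bounds E d)
    (hM : M.length ≤ d) (h : Pre E s lab ρ M U t E.n) (hZ : HasPoint s 5 Z)
    (hb : s.reg 13 = b.toNat) (h5 : s.reg 5 = L) (hL : L ≤ E.n) (hL0 : 0 < L)
    (h6 : s.reg 6 = halvings) (hhalv : halvings < 2 ^ E.w) :
    TrD E bisectCmd s ((halvings + 1) * (2 * derivTime E.n d)) (halvings * 2 ^ d)
      (fun s' => (∃ t', Pre E s' lab ρ M U t' E.n) ∧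
        s'.reg 21 = ((bisect (fun t => deriv E.f lab ρ M U Z t E.n U) b)^[halvings] (0, L)).1) := by
  have hw := hB.pos
  have hw2 := hB.two
  have hn2 := hB.two_mul
  have m1 : 1 % 2 ^ E.w = 1 := Nat.mod_eq_of_lt (by omega)
  set τ := derivTime E.n d with hτ
  have hτn := le_derivTime E.n d
  refine Tr.mono (T := 1 + (3 + (halvings * ((3 + (τ + 6 + 1) + 1) + 6) + 5) + 1) + 1)
    (Q := 0 + (0 + halvings * (0 + (2 ^ d + 0)))) ?_ ?_ (by simp) (fun _ _ h _ => h)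
  · refine Tr.seqD (Tr.sl rfl) fun s₁ hs₁ hF₁ => Tr.seqD (Tr.sl rfl) fun s₂ hs₂ hF₂ => ?_
    have h₂ := (h.frame hF₁).frame hF₂
    have e5 : s₁.reg 5 = L := (hF₁.1 5 rfl).trans h5
    have e22 : s₂.reg 22 = L := by
      rw [hs₂, copyCmd_sl (by decide) (by rw [e5]; omega), Mem.reg_set, if_pos rfl, e5]
    have e21 : s₂.reg 21 = 0 := by
      rw [hF₂.1 21 rfl, hs₁]
      simp [Cmd.sl, Mem.reg_set]
    set φ := fun t => deriv E.f lab ρ M U Z t E.n U with hφ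
    refine Tr.mono (Tr.forD (E := E) (s := s₂) rfl hhalv
      (by rw [hF₂.1 6 rfl, hF₁.1 6 rfl, h6]) h₂.ready.r3
      (fun q s' => (∃ t', Pre E s' lab ρ M U t' E.n) ∧
        s'.reg 21 = ((bisect φ b)^[q] (0, L)).1 ∧ s'.reg 22 = ((bisect φ b)^[q] (0, L)).2)
      ?_ ⟨⟨_, h₂⟩, e21, e22⟩ ?_) le_rfl le_rfl (fun _ _ h _ => ⟨h.1, h.2.1⟩)
    · intro q s s' hs ⟨⟨t', hI1⟩, hI2, hI3⟩
      exact ⟨⟨t', hI1.frame hs.frame⟩, (hs.1 21 (by decide) (by decide)).trans hI2,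
        (hs.1 22 (by decide) (by decide)).trans hI3⟩
    · intro q s' _ ⟨⟨t', hI1⟩, hI2, hI3⟩ _ _ _ hF
      have hbd := bisect_iterate_bounds φ b hL0 q
      rw [Function.iterate_succ_apply']
      set p := (bisect φ b)^[q] (0, L) with hp
      have hmid : (p.1 + p.2) / 2 < 2 ^ E.w := by omega
      refine Tr.seqD (Tr.sl rfl) fun s₃ hs₃ hF₃ => ?_
      have e17 : s₃.reg 17 = (p.1 + p.2) / 2 := by
        subst hs₃
        simp [Cmd.sl, Mem.reg_set, Op.apply, hI2, hI3, hI1.ready.r4,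
          Nat.mod_eq_of_lt (show p.1 + p.2 < 2 ^ E.w by omega), Nat.mod_eq_of_lt hmid]
      have h₃ : Pre E s₃ lab ρ M U ((p.1 + p.2) / 2) E.n :=
        ⟨hI1.ready.frame hF₃, hI1.holds.frame hF₃, e17, (hF₃.1 18 rfl).trans hI1.lbl,
          hI1.left.congr (hF₃.2 4 rfl)⟩
      have hZ₃ : HasPoint s₃ 5 Z := hZ.congr (by
        rw [hF₃.2 5 rfl, hF.2 5 rfl, hF₂.2 5 rfl, hF₁.2 5 rfl])
      refine Tr.seqD ((h₃.ctx fun i _ => hZ₃ i).deriv hB hM (Y := U)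
        fun i hi => absurd hi (lab_ne lab i)) fun s₄ ⟨hs₄, h₄⟩ hF₄ => ?_
      refine (Tr.sl rfl).mono le_rfl le_rfl fun _ s₅ hs₅ hF₅ => ?_
      refine ⟨⟨_, (h₄.frame hF₅).pre⟩, ?_⟩
      have f13 : s₄.reg 13 = b.toNat := by
        rw [hF₄.1 13 rfl, hF₃.1 13 rfl, hF.1 13 rfl, hF₂.1 13 rfl, hF₁.1 13 rfl, hb]
      have f21 : s₄.reg 21 = p.1 := by rw [hF₄.1 21 rfl, hF₃.1 21 rfl, hI2]
      have f22 : s₄.reg 22 = p.2 := by rw [hF₄.1 22 rfl, hF₃.1 22 rfl, hI3]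
      have f17 : s₄.reg 17 = (p.1 + p.2) / 2 := by rw [hF₄.1 17 rfl, e17]
      change s₄.reg 19 = (φ ((p.1 + p.2) / 2)).toNat at hs₄
      unfold bisect
      subst hs₅
      simp only [Cmd.sl, Mem.reg_set, Op.apply, hs₄, f13, copyCmd]
      by_cases hc : φ ((p.1 + p.2) / 2) = b
      · simp [hc, m1, Mem.reg_set, f17, f22, Nat.mod_eq_of_lt hmid]
      · simp [hc, mt toNat_injective hc, Mem.reg_set, f17, f21, Nat.mod_eq_of_lt hmid]
  · have : (halvings + 1) * (2 * τ) = halvings * (2 * τ) + 2 * τ := by ring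
    have h2 : halvings * ((3 + (τ + 6 + 1) + 1) + 6) ≤ halvings * (2 * τ) :=
      Nat.mul_le_mul le_rfl (by omega)
    omega

end DTTest
end

/-! ### Updates of the state of an evaluation -/

noncomputable section

namespace DTTest

variable {E : Env} {lab : Fin E.n → Fin E.n} {P : Params}

lemma commit_append (ρ : ℕ → Option Bool) (M : List (ℕ × Bool)) (p : ℕ × Bool) :
    commit ρ (M ++ [p]) = Function.update (commit ρ M) p.1 (some p.2) := by
  induction M generalizing ρ with
  | nil => simp [commit]
  | cons i M ih => simp only [List.cons_append, commit, ih]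

lemma commit_isSome (ρ : ℕ → Option Bool) (M : List (ℕ × Bool)) (l : ℕ) :
    (commit ρ M l).isSome ↔ (ρ l).isSome ∨ l ∈ M.map Prod.fst := by
  induction M generalizing ρ with
  | nil => simp [commit]
  | cons i M ih =>
    simp only [commit, ih, List.map_cons, List.mem_cons, Function.update_apply]
    by_cases h : l = i.1 <;> simp [h]

/-- The parameters of the test are in place. -/
structure Consts (E : Env) (P : Params) (s : Mem) (lab : Fin E.n → Fin E.n) : Prop where
  ready : Ready E s lab
  r1 : s.reg 1 = P.d
  r5 : s.reg 5 = P.L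
  r6 : s.reg 6 = P.halvings
  r7 : s.reg 7 = P.d * P.d
  r8 : s.reg 8 = P.tries
  r9 : s.reg 9 = P.reps
  r10 : s.reg 10 = P.rounds

lemma Consts.frame {c : Cmd} {s s' : Mem} (h : Consts E P s lab) (hF : Frame c s s')
    (h0 : c.wr 0 = false := by rfl) (h3 : c.wr 3 = false := by rfl)
    (h4 : c.wr 4 = false := by rfl) (ha0 : c.wa 0 = false := by rfl)
    (h1 : c.wr 1 = false := by rfl) (h5 : c.wr 5 = false := by rfl)
    (h6 : c.wr 6 = false := by rfl) (h7 : c.wr 7 = false := by rfl)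
    (h8 : c.wr 8 = false := by rfl) (h9 : c.wr 9 = false := by rfl)
    (h10 : c.wr 10 = false := by rfl) : Consts E P s' lab :=
  ⟨h.ready.frame hF h0 h3 h4 ha0, (hF.1 _ h1).trans h.r1, (hF.1 _ h5).trans h.r5,
    (hF.1 _ h6).trans h.r6, (hF.1 _ h7).trans h.r7, (hF.1 _ h8).trans h.r8, (hF.1 _ h9).trans h.r9,
    (hF.1 _ h10).trans h.r10⟩

/-- The parameters of the test fit into words. -/
structure Fits (E : Env) (P : Params) : Prop where
  bounds : Bounds E P.d
  L_le : P.L ≤ E.n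
  L_pos : 0 < P.L
  halvings : P.halvings < 2 ^ E.w
  tries : P.tries < 2 ^ E.w
  reps : P.reps < 2 ^ E.w
  rounds : P.rounds < 2 ^ E.w
  sq : P.d * P.d < 2 ^ E.w

/-- The memory represents the state `st`. -/
structure Rep (E : Env) (P : Params) (s : Mem) (st : TState) : Prop where
  holds : Holds E s st.ρ st.labels
  vals : ∀ (q : ℕ) (h : q < st.M.length), s.arr 8 q = st.M[q].2.toNat
  b : s.reg 13 = st.b.toNat
  cnt : s.reg 15 = st.cnt
  flag : s.reg 12 = st.flag.toNat
  len : st.M.length ≤ P.d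
  cnt_le : st.cnt ≤ P.d * P.d

lemma Rep.frame {c : Cmd} {s s' : Mem} {st : TState} (h : Rep E P s st) (hF : Frame c s s')
    (h14 : c.wr 14 = false := by rfl) (ha7 : c.wa 7 = false := by rfl)
    (ha2 : c.wa 2 = false := by rfl) (ha3 : c.wa 3 = false := by rfl)
    (ha8 : c.wa 8 = false := by rfl) (h13 : c.wr 13 = false := by rfl)
    (h15 : c.wr 15 = false := by rfl) (h12 : c.wr 12 = false := by rfl) : Rep E P s' st :=
  ⟨h.holds.frame hF h14 ha7 ha2 ha3, by rw [hF.2 _ ha8]; exact h.vals, (hF.1 _ h13).trans h.b,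
    (hF.1 _ h15).trans h.cnt, (hF.1 _ h12).trans h.flag, h.len, h.cnt_le⟩

/-- Add the variable with label in register `21` and value in register `23` to the monomial. -/
def pushCmd : Cmd :=
  .seq (.op .lt 60 14 1) (.seq (.op .lt 61 15 7) (.seq (.op .mul 60 60 61)
    (.ite 60 (.seq (.store 7 14 21) (.seq (.store 8 14 23) (.seq (.store 2 21 3)
      (.seq (.op .add 14 14 3) (.seq (.op .add 15 15 3) (.ite 26 .skip (.const 12 1)))))))
      (.const 12 1))))

lemma pushCmd_spec {s : Mem} {st : TState} {j : ℕ} {v ok : Bool} (hP : Fits E P)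
    (hC : Consts E P s lab) (hR : Rep E P s st) (hj : j < E.n) (h21 : s.reg 21 = j)
    (h23 : s.reg 23 = v.toNat) (h26 : s.reg 26 = ok.toNat) :
    TrD E pushCmd s 20 0 (fun s' => Rep E P s' (st.push P st.b j v ok)) := by
  have hw := hP.bounds.pos
  have hw2 := hP.bounds.two
  have hn := hP.bounds.n
  have hd : P.d < 2 ^ E.w := hP.bounds.d.trans Nat.lt_two_pow_self
  have hsq := hP.sq
  have hlen := hR.len
  have hcnt := hR.cnt_le
  have m1 : 1 % 2 ^ E.w = 1 := Nat.mod_eq_of_lt (by omega)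
  have e14 : s.reg 14 = st.M.length := by rw [hR.holds.len]; simp
  refine (Tr.sl rfl).mono (by simp [pushCmd, Cmd.slTime]) (by decide) fun _ s' hs' _ => ?_
  have m60 : ∀ p : Prop, [Decidable p] → (if p then 1 else 0) % 2 ^ E.w = if p then 1 else 0 := by
    intro p _
    split_ifs <;> simp [m1]
  unfold TState.push
  split_ifs with hc
  · obtain ⟨hc1, hc2⟩ := hc
    have ma : (st.M.length + 1) % 2 ^ E.w = st.M.length + 1 := Nat.mod_eq_of_lt (by omega)
    have mb : (st.cnt + 1) % 2 ^ E.w = st.cnt + 1 := Nat.mod_eq_of_lt (by omega)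
    have mj : j % 2 ^ E.w = j := Nat.mod_eq_of_lt (by omega)
    -- The effect is first written as an explicit list of writes, from which the content of every
    -- register and every cell can be read off.
    have key : s' = ((if ok then id else fun m => m.set 12 1) (((((((((s.set 60 1).set 61 1).set 60 1).put 7
        st.M.length j).put 8 st.M.length v.toNat).put 2 j 1).set 14 (st.M.length + 1)).set 15
        (st.cnt + 1)))) := by
      subst hs'
      simp only [pushCmd, Cmd.sl, Mem.reg_set, Mem.reg_put, Op.apply, e14, hC.r1, hc1, hR.cnt, hC.r7,
        h21, h23, h26, hC.ready.r3, m1]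
      cases ok <;> simp [m1, ma, mb, mj, toNat_mod hw, hc2]
    have hreg : ∀ r, s'.reg r = if r = 12 ∧ ok = false then 1 else if r = 15 then st.cnt + 1 else
        if r = 14 then st.M.length + 1 else if r = 60 ∨ r = 61 then 1 else s.reg r := by
      intro r
      rw [key]
      cases ok <;> simp [Mem.reg_set, Mem.reg_put] <;> grind
    have harr : ∀ A i, s'.arr A i = if A = 2 ∧ i = j then 1 else if A = 8 ∧ i = st.M.length then
        v.toNat else if A = 7 ∧ i = st.M.length then j else s.arr A i := by
      intro A i
      rw [key]
      cases ok <;> simp [Mem.arr_set, Mem.arr_put]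
    refine ⟨⟨?_, ?_, ?_, ?_, ?_⟩, ?_, ?_, ?_, ?_, ?_, ?_⟩
    · rw [hreg]; simp
    · intro q hq
      rw [harr]
      by_cases h : q = st.M.length
      · subst h; simp
      · have hq' : q < st.M.length := by simp at hq; omega
        have := hR.holds.mono q (by simpa using hq')
        simp [h, this, hq']
    · intro i hi
      simp only [TState.labels, List.map_append, List.map_cons, List.map_nil, List.mem_append,
        List.mem_singleton] at hi
      rcases hi with hi | rfl
      · exact hR.holds.lt i hi
      · exact hj
    · intro l hl
      rw [harr]
      by_cases h : l = j
      · simp [h]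
      · simp only [h, and_false, if_false]
        rw [if_neg (by simp), if_neg (by simp), hR.holds.dom l hl]
        simp [Ne.symm h]
    · intro l hl hlM u hu
      rw [harr, if_neg (by simp), if_neg (by simp), if_neg (by simp)]
      refine hR.holds.val l hl ?_ u hu
      simp only [TState.labels, List.map_append, List.mem_append, not_or] at hlM
      exact hlM.1
    · intro q hq
      rw [harr, if_neg (by simp)]
      by_cases h : q = st.M.length
      · subst h; simp
      · have hq' : q < st.M.length := by simp at hq; omega
        rw [if_neg (by simp [h]), if_neg (by simp), hR.vals q hq']
        simp [hq']
    · rw [hreg]; simpa using hR.b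
    · rw [hreg]; simp
    · rw [hreg]
      cases ok <;> simp [hR.flag]
    · simp; omega
    · simp only; omega
  · have key : ∃ a b c, s' = (((s.set 60 a).set 61 b).set 60 c).set 12 1 := by
      refine ⟨if st.M.length < P.d then 1 else 0, if st.cnt < P.d * P.d then 1 else 0,
        ((if st.M.length < P.d then 1 else 0) * (if st.cnt < P.d * P.d then 1 else 0)) % 2 ^ E.w,
        hs'.trans ?_⟩
      simp only [pushCmd, Cmd.sl, Mem.reg_set, Op.apply, e14, hC.r1, hR.cnt, hC.r7, m60]
      rw [if_neg]
      · rw [m1]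
        rfl
      · have : ¬ (st.M.length < P.d ∧ st.cnt < P.d * P.d) := hc
        by_cases h1 : st.M.length < P.d <;> by_cases h2 : st.cnt < P.d * P.d <;> simp [h1, h2]
        exact absurd ⟨h1, h2⟩ this
    obtain ⟨a, b, c, rfl⟩ := key
    refine ⟨hR.holds.congr ?_ rfl rfl rfl, hR.vals, ?_, ?_, ?_, hR.len, hR.cnt_le⟩
    · simp [Mem.reg_set]
    · simpa [Mem.reg_set] using hR.b
    · simpa [Mem.reg_set] using hR.cnt
    · simp [Mem.reg_set]

/-- Add the monomial to the partial assignment. -/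
def commitCmd : Cmd :=
  .seq (forLoop 50 51 14 (.seq (.load 66 7 50) (.seq (.load 67 8 50) (.store 3 66 67))))
    (.const 14 0)

/-- Only values have to be copied: array `2` marks the labels of the monomial already. If a label
were listed twice, the later value would win, both here and in `commit`. -/
lemma commitCmd_spec {s : Mem} {st : TState} (hP : Fits E P)
    (hC : Consts E P s lab) (hR : Rep E P s st) :
    TrD E commitCmd s (20 * (P.d + 1)) 0
      (fun s' => Rep E P s' ⟨commit st.ρ st.M, [], st.b, st.cnt, st.flag⟩) := by
  have hw := hP.bounds.pos
  have hn := hP.bounds.n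
  have hlen := hR.len
  have hd : P.d < 2 ^ E.w := hP.bounds.d.trans Nat.lt_two_pow_self
  have hlb : ∀ q, (st.M.take q).map Prod.fst = st.labels.take q := fun q => by simp
  refine Tr.mono (T := (st.M.length * (5 + 6) + 5) + 1 + 1) (Q := st.M.length * 0 + 0) ?_ (by omega)
    (by omega) (fun _ _ h _ => h)
  refine Tr.seqD (T₁ := st.M.length * (5 + 6) + 5) (T₂ := 1) (Tr.forD (E := E) (s := s)
    (m := st.M.length) rfl (by omega)
    (by rw [hR.holds.len]; simp) hC.ready.r3
    (fun q s' => ∀ l < E.n, (l ∉ st.labels ∨ l ∈ st.labels.take q) →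
      ∀ v, commit st.ρ (st.M.take q) l = some v → s'.arr 3 l = v.toNat)
    (fun t s s' hs h => by rw [hs.2]; exact h) ?_ ?_) fun s₁ hs₁ hF₁ => ?_
  · intro l hl h v hv
    simp only [List.take_zero, List.not_mem_nil, or_false] at h
    exact hR.holds.val l hl h v (by simpa [commit] using hv)
  · intro q s' hq hI hi hk h3 hF
    refine (Tr.sl rfl).mono le_rfl le_rfl fun _ s₂ hs₂ _ => ?_
    subst hs₂
    have e7 : s'.arr 7 q = st.M[q].1 := by
      rw [hF.2 7 rfl, hR.holds.mono q (by simpa using hq)]; simp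
    have e8 : s'.arr 8 q = st.M[q].2.toNat := by rw [hF.2 8 rfl, hR.vals q hq]
    have hj : st.M[q].1 < E.n := hR.holds.lt _ (List.mem_map_of_mem (List.getElem_mem hq))
    have m1 : st.M[q].1 % 2 ^ E.w = st.M[q].1 := Nat.mod_eq_of_lt (hj.trans hn)
    have htake : st.M.take (q + 1) = st.M.take q ++ [st.M[q]] := by simp
    intro l hl hmem v hv
    rw [htake, commit_append] at hv
    simp only [Cmd.sl, Mem.reg_set, Mem.arr_set, Mem.arr_put, hi, e7, m1]
    by_cases h : l = st.M[q].1
    · subst h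
      simp only [Function.update_self, Option.some.injEq] at hv
      subst hv
      simp [toNat_mod hw, e8]
    · rw [Function.update_of_ne h] at hv
      rw [if_neg (fun hh => h hh.2)]
      refine hI l hl ?_ v hv
      rw [← hlb, htake, List.map_append, List.mem_append, hlb] at hmem
      refine hmem.imp_right fun h' => h'.resolve_right ?_
      simpa using h
  · refine (Tr.sl rfl).mono le_rfl le_rfl fun _ s₂ hs₂ hF₂ => ?_
    refine ⟨⟨?_, by simp, by simp, ?_, ?_⟩, by simp, ?_, ?_, ?_, by simp, hR.cnt_le⟩
    · subst hs₂; simp [Cmd.sl, Mem.reg_set]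
    · intro l hl
      rw [hF₂.2 2 rfl, hF₁.2 2 rfl, hR.holds.dom l hl]
      have := commit_isSome st.ρ st.M l
      by_cases h : (commit st.ρ st.M l).isSome
      · rw [if_pos (this.1 h), if_pos (Or.inl h)]
      · rw [if_neg (mt this.2 h), if_neg (by simpa using h)]
    · intro l hl _ v hv
      rw [hF₂.2 3 rfl]
      refine hs₁ l hl ?_ v (by simpa using hv)
      rw [List.take_of_length_le (by simp)]
      exact (em _).symm
    · rw [hF₂.1 13 rfl, hF₁.1 13 rfl]; exact hR.b
    · rw [hF₂.1 15 rfl, hF₁.1 15 rfl]; exact hR.cnt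
    · rw [hF₂.1 12 rfl, hF₁.1 12 rfl]; exact hR.flag

end DTTest
end

/-! ### One round and one sample as programs -/

noncomputable section

namespace DTTest

variable {E : Env} {lab : Fin E.n → Fin E.n} {P : Params}

/-- Find a variable of the derivative, evaluate it, and add it to the monomial. -/
def foundCmd : Cmd :=
  .seq bisectCmd (.seq (copyCmd 17 21) (.seq (copyCmd 18 21) (.seq litCmd pushCmd)))

/-- One round of the evaluation of the decision tree. -/
def roundCmd : Cmd :=
  .seq (fillCmd 4) (.seq (.const 17 0) (.seq (copyCmd 18 0) (.seq derivCmd (.seq (copyCmd 13 19)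
    (.seq (copyCmd 17 5) (.seq searchCmd (.ite 20 foundCmd commitCmd)))))))

/-- The number of evaluations of the derivative in one round. -/
def roundEvals (P : Params) : ℕ := P.tries + P.halvings + P.reps + 3

lemma foundCmd_spec {s : Mem} {st : TState} {x U Z : Cube E.n} {t : ℕ} (hP : Fits E P)
    (hC : Consts E P s lab) (hR : Rep E P s st) (hx : HasPoint s 1 x)
    (h : Pre E s lab st.ρ st.labels U t E.n) (hZ : HasPoint s 5 Z) :
    Tr E foundCmd s ((P.halvings + P.reps + 2) * (20 * derivTime E.n P.d))
      ((P.halvings + P.reps + 1) * (10 * 2 ^ P.d))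
      ((litEval (deriv E.f lab st.ρ st.labels U Z (st.pivot P E.f lab U Z st.b)
        (st.pivot P E.f lab U Z st.b)) x P.reps).map fun p =>
          st.push P st.b (st.pivot P E.f lab U Z st.b) p.1 p.2)
      (fun st' s' => Rep E P s' st') := by
  have hM : st.labels.length ≤ P.d := by simpa using hR.len
  have hn := hP.bounds.n
  set τ := derivTime E.n P.d with hτ
  have hτn := le_derivTime E.n P.d
  set j := st.pivot P E.f lab U Z st.b with hj
  have hjL : j < P.L := (bisect_iterate_bounds _ _ hP.L_pos _).1
  have hjn : j < E.n := hjL.trans_le hP.L_le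
  refine Tr.mono (T := (P.halvings + 1) * (2 * τ) + (3 + (3 + ((P.reps + 1) * (18 * τ) + 20 + 1)
      + 1) + 1) + 1) (Q := P.halvings * 2 ^ P.d + (0 + (0 + ((P.reps + 1) * (10 * 2 ^ P.d) + 0))))
    ?_ ?_ ?_ (fun _ _ h _ => h)
  · refine Tr.seqD (bisectCmd_spec hP.bounds hM h hZ hR.b hC.r5 hP.L_le hP.L_pos hC.r6 hP.halvings)
      fun s₁ ⟨⟨t', h₁⟩, e21⟩ hF₁ => ?_
    change s₁.reg 21 = j at e21
    refine Tr.seqD (Tr.sl rfl) fun s₂ hs₂ hF₂ => Tr.seqD (Tr.sl rfl) fun s₃ hs₃ hF₃ => ?_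
    have e21' : s₂.reg 21 = j := (hF₂.1 21 rfl).trans e21
    have e17 : s₃.reg 17 = j := by
      rw [hF₃.1 17 rfl, hs₂, copyCmd_sl (by decide) (by rw [e21]; omega), Mem.reg_set, if_pos rfl,
        e21]
    have e18 : s₃.reg 18 = j := by
      rw [hs₃, copyCmd_sl (by decide) (by rw [e21']; omega), Mem.reg_set, if_pos rfl, e21']
    have hc : Ctx E s₃ lab st.ρ st.labels U Z j j := by
      refine ⟨(h₁.ready.frame hF₂).frame hF₃, (h₁.holds.frame hF₂).frame hF₃, e17, e18,
        h₁.left.congr (by rw [hF₃.2 4 rfl, hF₂.2 4 rfl]), fun i _ => ?_⟩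
      rw [hF₃.2 5 rfl, hF₂.2 5 rfl, hF₁.2 5 rfl]
      exact hZ i
    have hC₃ := ((hC.frame hF₁).frame hF₂).frame hF₃
    refine Tr.seqMap _ (litCmd_spec hP.bounds hM hc
      (hx.congr (by rw [hF₃.2 1 rfl, hF₂.2 1 rfl, hF₁.2 1 rfl])) hC₃.r9 hP.reps)
      fun p s₄ ⟨hp1, hp2, h₄⟩ hF₄ => ?_
    refine pushCmd_spec hP (hC₃.frame hF₄) ⟨h₄.holds, ?_, ?_, ?_, ?_, hR.len, hR.cnt_le⟩ hjn ?_ hp1 hp2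
    · rw [hF₄.2 8 rfl, hF₃.2 8 rfl, hF₂.2 8 rfl, hF₁.2 8 rfl]; exact hR.vals
    · rw [hF₄.1 13 rfl, hF₃.1 13 rfl, hF₂.1 13 rfl, hF₁.1 13 rfl]; exact hR.b
    · rw [hF₄.1 15 rfl, hF₃.1 15 rfl, hF₂.1 15 rfl, hF₁.1 15 rfl]; exact hR.cnt
    · rw [hF₄.1 12 rfl, hF₃.1 12 rfl, hF₂.1 12 rfl, hF₁.1 12 rfl]; exact hR.flag
    · rw [hF₄.1 21 rfl, hF₃.1 21 rfl, e21']
  · nlinarith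
  · nlinarith [Nat.zero_le (P.halvings * 2 ^ P.d)]

/-- The program stores the new bit before it searches, so the memory then represents a state whose
field `b` is already replaced. Neither the pivot nor `push` reads this field. -/
lemma TState.pivot_congr (st : TState) (b b' flag : Bool) (cnt : ℕ) (U Z : Cube E.n) :
    (TState.mk st.ρ st.M b' cnt flag).pivot P E.f lab U Z b = st.pivot P E.f lab U Z b := by
  unfold TState.pivot TState.val
  rfl

lemma TState.push_congr (st : TState) (b b' v ok : Bool) (j : ℕ) :
    (TState.mk st.ρ st.M b' st.cnt st.flag).push P b j v ok = st.push P b j v ok := by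
  unfold TState.push
  rfl

lemma roundCmd_spec {s : Mem} {st : TState} {x : Cube E.n} (hP : Fits E P)
    (hC : Consts E P s lab) (hR : Rep E P s st) (hx : HasPoint s 1 x) :
    Tr E roundCmd s (roundEvals P * (20 * derivTime E.n P.d)) (roundEvals P * (10 * 2 ^ P.d))
      (round P E.f lab x st) (fun st' s' => Rep E P s' st') := by
  have hM : st.labels.length ≤ P.d := by simpa using hR.len
  have hn := hP.bounds.n
  have hw := hP.bounds.pos
  set τ := derivTime E.n P.d with hτ
  have hτn := le_derivTime E.n P.d
  refine Tr.mono (T := (E.n * 9 + 5) + (1 + (3 + (τ + (3 + (3 + ((P.tries + 1) * (3 * τ) +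
      ((P.halvings + P.reps + 2) * (20 * τ) + 1) + 1) + 1) + 1) + 1) + 1) + 1) + 1)
    (Q := 0 + (0 + (0 + (2 ^ P.d + (0 + (0 + (P.tries * 2 ^ P.d + (P.halvings + P.reps + 1) *
      (10 * 2 ^ P.d)))))))) ?_ ?_ ?_ (fun _ _ h _ => h)
  · refine Tr.seq (fillCmd_spec 4 hC.ready.r0 hC.ready.r3 hn hw) fun U s₁ hU hF₁ => ?_
    refine Tr.seqD (Tr.sl rfl) fun s₂ hs₂ hF₂ => Tr.seqD (Tr.sl rfl) fun s₃ hs₃ hF₃ => ?_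
    have hC₃ := ((hC.frame hF₁).frame hF₂).frame hF₃
    have hR₃ := ((hR.frame hF₁).frame hF₂).frame hF₃
    have hc : Ctx E s₃ lab st.ρ st.labels U U 0 E.n := by
      have e0 : s₂.reg 0 = E.n := ((hC.ready.frame hF₁).frame hF₂).r0
      refine ⟨hC₃.ready, hR₃.holds, ?_, ?_, hU.congr (by rw [hF₃.2 4 rfl, hF₂.2 4 rfl]),
        fun i hi => absurd hi (by omega)⟩
      · rw [hF₃.1 17 rfl, hs₂]; simp [Cmd.sl, Mem.reg_set]
      · rw [hs₃, copyCmd_sl (by decide) (by rw [e0]; omega), Mem.reg_set, if_pos rfl, e0]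
    refine Tr.seqD (hc.deriv hP.bounds hM (Y := U) fun i hi => absurd hi (lab_ne lab i))
      fun s₄ ⟨e19, h₄⟩ hF₄ => ?_
    change s₄.reg 19 = (st.val E.f lab U U 0).toNat at e19
    refine Tr.seqD (Tr.sl rfl) fun s₅ hs₅ hF₅ => Tr.seqD (Tr.sl rfl) fun s₆ hs₆ hF₆ => ?_
    have hC₅ := (hC₃.frame hF₄).frame hF₅
    have hC₆ := hC₅.frame hF₆
    set b := st.val E.f lab U U 0 with hb
    have e13 : s₆.reg 13 = b.toNat := by
      rw [hF₆.1 13 rfl, hs₅, copyCmd_sl (by decide), Mem.reg_set, if_pos rfl, e19]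
      rw [e19]
      exact lt_of_le_of_lt (Bool.toNat_le _) (Nat.one_lt_two_pow hw.ne')
    have h₆ : Pre E s₆ lab st.ρ st.labels U P.L E.n := by
      refine ⟨hC₆.ready, (h₄.holds.frame hF₅).frame hF₆, ?_, ?_, ?_⟩
      · have := hP.L_le
        rw [hs₆, copyCmd_sl (by decide) (by rw [hC₅.r5]; omega), Mem.reg_set, if_pos rfl, hC₅.r5]
      · rw [hF₆.1 18 rfl, hF₅.1 18 rfl]; exact h₄.lbl
      · exact h₄.left.congr (by rw [hF₆.2 4 rfl, hF₅.2 4 rfl])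
    refine Tr.seq (searchCmd_spec hP.bounds hM h₆ e13 hC₆.r8 hP.tries)
      fun o s₇ ⟨h₇, e20, ho⟩ hF₇ => ?_
    have hC₇ := hC₆.frame hF₇
    have hR₇ : Rep E P s₇ ⟨st.ρ, st.M, b, st.cnt, st.flag⟩ := by
      refine ⟨h₇.holds, ?_, ?_, ?_, ?_, hR.len, hR.cnt_le⟩
      · rw [hF₇.2 8 rfl, hF₆.2 8 rfl, hF₅.2 8 rfl, hF₄.2 8 rfl]; exact hR₃.vals
      · rw [hF₇.1 13 rfl, e13]
      · rw [hF₇.1 15 rfl, hF₆.1 15 rfl, hF₅.1 15 rfl, hF₄.1 15 rfl]; exact hR₃.cnt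
      · rw [hF₇.1 12 rfl, hF₆.1 12 rfl, hF₅.1 12 rfl, hF₄.1 12 rfl]; exact hR₃.flag
    refine Tr.ite (fun h20 => ?_) (fun h20 => ?_)
    · cases o with
      | none => simp [e20] at h20
      | some Z =>
        have key := foundCmd_spec hP hC₇ hR₇ (x := x) (hx.congr ?_) h₇ (ho Z rfl)
        · simp only [TState.pivot_congr, TState.push_congr] at key
          exact key
        rw [hF₇.2 1 rfl, hF₆.2 1 rfl, hF₅.2 1 rfl, hF₄.2 1 rfl, hF₃.2 1 rfl, hF₂.2 1 rfl,
          hF₁.2 1 rfl]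
    · cases o with
      | some Z => simp [e20] at h20
      | none =>
        refine Tr.mono (Tr.ofD (commitCmd_spec hP hC₇ hR₇) (R' := fun st' s' => Rep E P s' st')
          fun s' h' _ => h') ?_ (Nat.zero_le _) (fun _ _ h _ => h)
        nlinarith
  · unfold roundEvals; nlinarith
  · unfold roundEvals; nlinarith [Nat.zero_le (P.tries * 2 ^ P.d), Nat.zero_le (2 ^ P.d)]

/-- Test of one sample. -/
def sampleCmd : Cmd :=
  .seq (.sample 16 1) (.seq (.const 13 0) (.seq (forLoop 46 47 0 (.store 2 46 13))
    (.seq (.seq (.const 14 0) (.const 15 0)) (.seq (forLoop 42 43 10 roundCmd)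
      (.seq (.op .eq 60 13 16) (.ite 60 .skip (.const 12 1)))))))

/-- The number of evaluations of the derivative for one sample. -/
def sampleEvals (P : Params) : ℕ := P.rounds * (roundEvals P + 1) + 1

lemma sampleCmd_spec {s : Mem} {flag : Bool} (hP : Fits E P)
    (hC : Consts E P s lab) (h12 : s.reg 12 = flag.toNat) :
    Tr E sampleCmd s (sampleEvals P * (20 * derivTime E.n P.d)) (sampleEvals P * (10 * 2 ^ P.d))
      (sampleTest P E.f lab E.D flag) (fun b s' => s'.reg 12 = b.toNat) := by
  have hn := hP.bounds.n
  have hw := hP.bounds.pos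
  have hw2 := hP.bounds.two
  have m1 : 1 % 2 ^ E.w = 1 := Nat.mod_eq_of_lt (by omega)
  set τ := derivTime E.n P.d with hτ
  have hτn := le_derivTime E.n P.d
  have h2d : 1 ≤ 2 ^ P.d := Nat.one_le_two_pow
  refine Tr.mono (T := (E.n + 1) + (1 + ((E.n * (1 + 6) + 5) + (3 + ((P.rounds *
      (roundEvals P * (20 * τ) + 6) + 5) + 4 + 1) + 1) + 1) + 1) + 1)
    (Q := 1 + (0 + (E.n * 0 + (0 + (P.rounds * (roundEvals P * (10 * 2 ^ P.d)) + 0)))))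
    ?_ ?_ ?_ (fun _ _ h _ => h)
  · refine Tr.seq (Tr.sample 16 1 hw) fun x s₁ ⟨hx, h16⟩ hF₁ => ?_
    refine Tr.seqD (Tr.sl rfl) fun s₂ hs₂ hF₂ => ?_
    have hC₂ := (hC.frame hF₁).frame hF₂
    have e13 : s₂.reg 13 = 0 := by subst hs₂; simp [Cmd.sl, Mem.reg_set]
    -- Register `13` has just been set to `0` and also serves as the source of zeros that clear the
    -- domain of the partial assignment.
    refine Tr.seqD (Tr.forD (E := E) (s := s₂) rfl hn hC₂.ready.r0 hC₂.ready.r3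
      (fun q s' => ∀ l < q, s'.arr 2 l = 0) (fun t s s' hs h => by rw [hs.2]; exact h)
      (fun l hl => absurd hl (by omega)) ?_) fun s₃ hs₃ hF₃ => ?_
    · intro q s' _ hI hi _ _ hF
      refine (Tr.sl rfl).mono le_rfl le_rfl fun _ s'' hs'' _ l hl => ?_
      subst hs''
      have : s'.reg 13 = 0 := (hF.1 13 rfl).trans e13
      simp only [Cmd.sl, Mem.arr_put, this, hi, Nat.zero_mod]
      split_ifs with h
      · rfl
      · exact hI l (by simp at h; omega)
    refine Tr.seqD (Tr.sl rfl) fun s₄ hs₄ hF₄ => ?_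
    have hC₄ := (hC₂.frame hF₃).frame hF₄
    have hR₄ : Rep E P s₄ (TState.init flag) := by
      refine ⟨⟨?_, by simp [TState.init], by simp [TState.init], ?_, by simp [TState.init]⟩,
        by simp [TState.init], ?_, ?_, ?_, by simp [TState.init], by simp [TState.init]⟩
      · subst hs₄; simp [Cmd.sl, Mem.reg_set, TState.init]
      · intro l hl
        rw [hF₄.2 2 rfl, hs₃ l hl]
        simp [TState.init]
      · rw [hF₄.1 13 rfl, hF₃.1 13 rfl, e13]; rfl
      · subst hs₄; simp [Cmd.sl, Mem.reg_set, TState.init]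
      · rw [hF₄.1 12 rfl, hF₃.1 12 rfl, hF₂.1 12 rfl, hF₁.1 12 rfl, h12]; rfl
    have hx₄ : HasPoint s₄ 1 x := HasPoint.congr (s := s₁) hx
      (by rw [hF₄.2 1 rfl, hF₃.2 1 rfl, hF₂.2 1 rfl])
    refine Tr.seqMap (T₁ := P.rounds * (roundEvals P * (20 * τ) + 6) + 5) (T₂ := 4) _ (Tr.forLoop (E := E) (s := s₄) (i := 42) (c := 43) (k := 10)
      (body := roundCmd) rfl hP.rounds hC₄.r10 hC₄.ready.r3
      (fun _ st s' => Rep E P s' st) _ _ (fun _ _ _ _ hs h => h.frame hs.frame) hR₄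
      (fun _ st s' _ hI _ _ _ hF => roundCmd_spec hP (hC₄.frame hF) hI
        (hx₄.congr (hF.2 1 rfl)))) fun st s₅ hR₅ hF₅ => ?_
    refine (Tr.sl rfl).mono le_rfl le_rfl fun _ s₆ hs₆ _ => ?_
    have f16 : s₅.reg 16 = (E.f x).toNat := by
      rw [hF₅.1 16 rfl, hF₄.1 16 rfl, hF₃.1 16 rfl, hF₂.1 16 rfl, h16]
    subst hs₆
    simp only [Cmd.sl, Mem.reg_set, Op.apply, hR₅.b, f16]
    by_cases hc : st.b = E.f x
    · simp [hc, m1, Mem.reg_set, hR₅.flag]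
    · rw [beq_false_of_ne hc]
      simp [mt toNat_injective hc, m1, Mem.reg_set]
  · unfold sampleEvals
    have h1 : P.rounds * (roundEvals P * (20 * τ) + 6) ≤ P.rounds * (roundEvals P * (20 * τ) +
      20 * τ) := Nat.mul_le_mul le_rfl (by omega)
    have h2 : (P.rounds * (roundEvals P + 1) + 1) * (20 * τ) = P.rounds * (roundEvals P * (20 * τ) +
      20 * τ) + 20 * τ := by ring
    omega
  · unfold sampleEvals
    have h2 : (P.rounds * (roundEvals P + 1) + 1) * (10 * 2 ^ P.d) =
      P.rounds * (roundEvals P * (10 * 2 ^ P.d)) + P.rounds * (10 * 2 ^ P.d) + 10 * 2 ^ P.d := by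
      ring
    have h3 := Nat.zero_le (P.rounds * (10 * 2 ^ P.d))
    omega

end DTTest
end

/-! ### Random labels as a program -/

noncomputable section

namespace DTTest

variable {E : Env} {lab : Fin E.n → Fin E.n}

lemma encode_congr {K : ℕ} {u u' : Cube K} {t : ℕ} (h : ∀ i : Fin K, (i : ℕ) < t → u i = u' i) :
    encode u t = encode u' t := by
  induction t with
  | zero => rfl
  | succ t ih =>
    rw [encode, encode, ih fun i hi => h i (by omega)]
    split_ifs with hK
    · rw [h ⟨t, hK⟩ (by simp)]
    · rfl

/-- The word `77` gets `reg 75` random binary digits. -/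
def randomCmd : Cmd :=
  .seq (.const 77 0) (forLoop 48 49 75 (.seq (.coin 60)
    (.seq (.op .add 77 77 77) (.op .add 77 77 60))))

/-- Doubling and adding a coin gives the recursion of `encode`. The partial numbers stay below `2 ^
(t + 1)`, so nothing is lost to the word length as `K < E.w`. -/
lemma randomCmd_spec {s : Mem} {K : ℕ} (h3 : s.reg 3 = 1) (hK : s.reg 75 = K)
    (hw : K < E.w) :
    Tr E randomCmd s (11 * K + 7) 0 (unif K) (fun u s' => s'.reg 77 = encode u K) := by
  have hKw : K < 2 ^ E.w := hw.trans Nat.lt_two_pow_self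
  have hloop : ∀ s₁ : Mem, s₁.reg 77 = 0 → s₁.reg 3 = 1 → s₁.reg 75 = K → Tr E (forLoop 48 49 75
      (.seq (.coin 60) (.seq (.op .add 77 77 77) (.op .add 77 77 60)))) s₁ (K * 11 + 5) 0 (unif K)
      (fun u s' => s'.reg 77 = encode u K) := by
    intro s₁ h77 h3 h75
    have := Tr.forLoop (E := E) (i := 48) (c := 49) (k := 75)
      (body := .seq (.coin 60) (.seq (.op .add 77 77 77) (.op .add 77 77 60)))
      (m := K) (T := 5) (Q := 0) (s := s₁)
      rfl hKw h75 h3 (fun t (a : Cube K) s => s.reg 77 = encode a t)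
      (fun t a => (PMF.uniformOfFintype Bool).map fun b =>
        (fun i : Fin K => if (i : ℕ) = t then b else a i)) (fun _ => false)
      (fun t a s s' hs h => by rw [hs.1 77 (by decide) (by decide)]; exact h) h77
      ?_
    · rw [iterK_fill_zero] at this
      exact this.mono (by omega) (by omega) (fun u s' h _ => h)
    · intro t a s' ht hI hi hk h3 hF
      refine Tr.seqMap (T₁ := 1) (T₂ := 3) (Q₁ := 0) (Q₂ := 0) _ (Tr.coin 60 (by omega))
        fun b s₁ hs₁ _ => (Tr.sl rfl).mono le_rfl le_rfl fun _ s₂ hs₂ _ => ?_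
      have hlt : 2 * encode a t + b.toNat < 2 ^ E.w := by
        have h1 := encode_lt a t
        have h2 : 2 ^ (t + 1) ≤ 2 ^ E.w := Nat.pow_le_pow_right (by norm_num) (by omega)
        have h3 := b.toNat_le
        rw [pow_succ] at h2
        omega
      subst hs₂ hs₁
      rw [encode, dif_pos ht, encode_congr (u' := a) fun i hi => by simp [hi.ne]]
      simp only [Cmd.sl, Mem.reg_set, Op.apply, hI]
      simp only [if_true, Nat.reduceEqDiff, if_false]
      rw [Nat.mod_eq_of_lt (a := encode a t + encode a t) (by omega), Nat.mod_eq_of_lt (by omega)]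
      omega
  refine (Tr.seqD (T₁ := 1) (T₂ := K * 11 + 5) (Q₁ := 0) (Q₂ := 0) (Tr.sl rfl) fun s₁ hs₁ hF₁ =>
    hloop s₁ ?_ ?_ ?_).mono (by omega) le_rfl (fun _ _ h _ => h)
  · subst hs₁; simp [Cmd.sl, Mem.reg_set]
  · rw [hF₁.1 3 rfl, h3]
  · rw [hF₁.1 75 rfl, hK]

/-- Choose the labels; the number of binary digits is in register `75`, and `reg 76 = 2 ^ reg 75`. -/
def labelCmd : Cmd :=
  .seq (.op .lt 60 76 0)
    (.ite 60 (.seq (copyCmd 5 76) (forLoop 46 47 0 (.seq randomCmd (.store 0 46 77))))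
      (.seq (copyCmd 5 0) (forLoop 46 47 0 (.store 0 46 46))))

lemma labelCmd_spec {s : Mem} {K : ℕ} (h0 : s.reg 0 = E.n) (h3 : s.reg 3 = 1) (h75 : s.reg 75 = K)
    (h76 : s.reg 76 = 2 ^ K) (hK : K < E.w) (hn : E.n < 2 ^ E.w) :
    Tr E labelCmd s ((E.n + 1) * (11 * K + 30)) 0 (randomLabels E.n K)
      (fun lab s' => (∀ i : Fin E.n, s'.arr 0 i = lab i) ∧ s'.reg 5 = min E.n (2 ^ K)) := by
  have hw : 0 < E.w := by omega
  have hKw : 2 ^ K < 2 ^ E.w := Nat.pow_lt_pow_right (by norm_num) hK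
  have m1 : 1 % 2 ^ E.w = 1 := Nat.mod_eq_of_lt (Nat.one_lt_two_pow hw.ne')
  refine (Tr.seqD (T₁ := 1) (T₂ := 3 + (E.n * (11 * K + 20) + 8) + 1 + 1) (Q₁ := 0) (Q₂ := 0 + 0) (Tr.sl rfl)
    fun s₁ hs₁ hF₁ => ?_).mono (by nlinarith) le_rfl (fun _ _ h _ => h)
  have e0 : s₁.reg 0 = E.n := (hF₁.1 0 rfl).trans h0
  have e3 : s₁.reg 3 = 1 := (hF₁.1 3 rfl).trans h3
  have e75 : s₁.reg 75 = K := (hF₁.1 75 rfl).trans h75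
  have e76 : s₁.reg 76 = 2 ^ K := (hF₁.1 76 rfl).trans h76
  have e60 : s₁.reg 60 = if 2 ^ K < E.n then 1 else 0 := by
    subst hs₁
    simp only [Cmd.sl, Mem.reg_set, Op.apply, h76, h0, if_true]
    split_ifs <;> simp [m1]
  refine Tr.ite (T := 3 + (E.n * (11 * K + 20) + 8) + 1) (fun h => ?_) (fun h => ?_)
  · have hlt : 2 ^ K < E.n := by by_contra h'; simp [e60, h'] at h
    refine Tr.seqD (E := E) (c₁ := copyCmd 5 76) (T₁ := 3) (T₂ := E.n * (11 * K + 20) + 8)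
      (Q₁ := 0) (Q₂ := 0) (Tr.sl rfl) fun s₂ hs₂ hF₂ => ?_
    have e5 : s₂.reg 5 = 2 ^ K := by
      rw [hs₂, copyCmd_sl (by decide) (by rw [e76]; omega), Mem.reg_set, if_pos rfl, e76]
    have := Tr.forLoop (E := E) (i := 46) (c := 47) (k := 0)
      (body := .seq randomCmd (.store 0 46 77)) (m := E.n) (T := 11 * K + 9) (Q := 0) (s := s₂)
      rfl hn ((hF₂.1 0 rfl).trans e0) ((hF₂.1 3 rfl).trans e3)
      (fun t (a : Fin E.n → Cube K) s => ∀ i : Fin E.n, (i : ℕ) < t → s.arr 0 i = encode (a i) K)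
      (fun t a => (unif K).map fun b =>
        (fun i : Fin E.n => if (i : ℕ) = t then b else a i)) (fun _ _ => false)
      (fun t a s s' hs h i hi => by rw [hs.2]; exact h i hi) (fun i hi => absurd hi (by omega))
      ?_
    · rw [iterK_fill_zero] at this
      rw [randomLabels, dif_pos hlt]
      refine this.map _ (by nlinarith) (by omega) fun u s' h hF => ⟨fun i => h i i.2, ?_⟩
      rw [hF.1 5 rfl, e5, min_eq_right hlt.le]
    · intro t a s' ht hI hi hk h3 hF
      refine (Tr.seqMap (T₁ := 11 * K + 7) (T₂ := 1) (Q₁ := 0) (Q₂ := 0) _ (randomCmd_spec h3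
        ((hF.1 75 rfl).trans ((hF₂.1 75 rfl).trans e75)) hK)
        fun b s₃ hs₃ hF₃ => (Tr.sl rfl).mono le_rfl le_rfl fun _ s₄ hs₄ _ => ?_)
      intro i hit
      have e46 : s₃.reg 46 = t := (hF₃.1 46 rfl).trans hi
      subst hs₄
      simp only [Cmd.sl, Mem.arr_put, e46, hs₃, Nat.mod_eq_of_lt ((encode_lt b K).trans hKw)]
      by_cases h : (i : ℕ) = t
      · simp [h]
      · simpa [h, hF₃.2 0 rfl] using hI i (by omega)
  · have hlt : ¬ 2 ^ K < E.n := by intro h'; simp [e60, h'] at h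
    refine Tr.seqD (E := E) (c₁ := copyCmd 5 0) (T₁ := 3) (T₂ := E.n * (11 * K + 20) + 8)
      (Q₁ := 0) (Q₂ := 0) (Tr.sl rfl) fun s₂ hs₂ hF₂ => ?_
    have e5 : s₂.reg 5 = E.n := by
      rw [hs₂, copyCmd_sl (by decide) (by rw [e0]; omega), Mem.reg_set, if_pos rfl, e0]
    rw [randomLabels, dif_neg hlt]
    refine Tr.ofD (Tr.mono (Tr.forD (E := E) (i := 46) (c := 47) (k := 0)
      (body := .store 0 46 46) (m := E.n) (T := 1) (Q := 0) (s := s₂)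
      rfl hn ((hF₂.1 0 rfl).trans e0) ((hF₂.1 3 rfl).trans e3)
      (fun t s => ∀ i < t, s.arr 0 i = i)
      (fun t s s' hs h i hi => by rw [hs.2]; exact h i hi) (fun i hi => absurd hi (by omega))
      ?_) ?_ ?_ (R' := fun _ s' => (∀ i : Fin E.n, s'.arr 0 i = i) ∧ s'.reg 5 = min E.n (2 ^ K))
      (fun _ s' h hF => ⟨fun i => h i i.2, ?_⟩)) (fun s' h _ => h)
    · intro t s' ht hI hi hk h3 hF
      refine (Tr.sl rfl).mono le_rfl le_rfl fun _ s₄ hs₄ _ i hit => ?_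
      subst hs₄
      simp only [Cmd.sl, Mem.arr_put, hi, Nat.mod_eq_of_lt (ht.trans hn)]
      by_cases h : i = t
      · simp [h]
      · simpa [h] using hI i (by omega)
    · nlinarith
    · omega
    · rw [hF.1 5 rfl, e5, min_eq_left (by omega)]

end DTTest
end

/-! ### Computation of the parameters, and the whole program -/

noncomputable section

namespace DTTest

variable {E : Env}

/-- The logarithmic factor in the numbers of repetitions. -/
def kappa (d m : ℕ) : ℕ := Nat.clog 2 m + 2 * d + 5

/-- The parameters of the test for depth `d` and `m = ⌈1/ε⌉`. -/
def params (n d m : ℕ) : Params :=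
  -- With `κ = kappa d m`, `2 ^ d * κ` tries miss a set of measure `2⁻ᵈ` with probability at most `2
  -- ^ (-κ)`, and `32 * κ` tests, each passed by a wrong value with probability at most 31/32, are
  -- all passed with probability at most `2 ^ (-κ)`. The rounds are `d * d` pushes, `d` commits of
  -- nonempty monomials, and one to read off the value. The number of halvings exceeds the logarithm
  -- of the number of labels.
  ⟨d, min n (2 ^ (2 * d + 3)), 2 * d + 4, 2 ^ d * kappa d m, 32 * kappa d m, d * d + d + 1⟩

/-- The numbers `n`, `m`, `2 ^ d` are below `X`, and words can hold the number `X ^ 15`. -/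
structure Roomy (E : Env) (d m X : ℕ) : Prop where
  pos : 0 < E.n
  n : E.n < X
  m : m < X
  d : 2 ^ d < X
  X : X ^ 16 ≤ 2 ^ E.w

lemma clog_le_self (m : ℕ) : Nat.clog 2 m ≤ m := by
  rcases Nat.eq_zero_or_pos m with rfl | hm
  · simp
  · exact (Nat.clog_le_iff_le_pow (by norm_num)).2 Nat.lt_two_pow_self.le

lemma Roomy.two_le {d m X : ℕ} (h : Roomy E d m X) : 2 ≤ X := by
  have := h.pos
  have := h.n
  omega

/-- A common bound for the quantities computed during the setup; the factor `128 = 2 ^ 7` is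
absorbed by `X ^ 7`. -/
lemma Roomy.lt {d m X : ℕ} (h : Roomy E d m X) {v : ℕ} (hv : v ≤ 128 * (X * X)) :
    v < 2 ^ E.w := by
  refine lt_of_lt_of_le ?_ h.X
  calc v ≤ 2 ^ 7 * X ^ 2 := by rw [pow_two]; exact hv
    _ ≤ X ^ 7 * X ^ 2 := Nat.mul_le_mul_right _ (Nat.pow_le_pow_left h.two_le _)
    _ = X ^ 9 := by ring
    _ < X ^ 16 := Nat.pow_lt_pow_right h.two_le (by norm_num)

lemma Roomy.d_lt {d m X : ℕ} (h : Roomy E d m X) : d + 1 < X :=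
  lt_of_le_of_lt Nat.lt_two_pow_self h.d

lemma Roomy.kappa_le {d m X : ℕ} (h : Roomy E d m X) : kappa d m + 8 ≤ 7 * X := by
  have h1 := clog_le_self m
  have h2 := h.m
  have h3 := h.d_lt
  unfold kappa
  omega

lemma Roomy.fits {d m X : ℕ} (h : Roomy E d m X) : Fits E (params E.n d m) := by
  have h1 := h.n
  have h2 := h.two_le
  have h3 := h.d_lt
  have h4 := h.kappa_le
  have h5 := h.d
  have hd : d < E.w := by
    rw [← Nat.pow_lt_pow_iff_right (a := 2) (by norm_num)]
    exact h.lt (by nlinarith)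
  refine ⟨⟨h.lt ?_, hd, h.lt ?_⟩, ?_, ?_, h.lt ?_, h.lt ?_, h.lt ?_, h.lt ?_, h.lt ?_⟩ <;>
    try simp only [params]
  · nlinarith
  · nlinarith
  · exact min_le_left _ _
  · exact lt_min h.pos (by positivity)
  · nlinarith
  · calc 2 ^ d * kappa d m ≤ X * (7 * X) := Nat.mul_le_mul h5.le (by omega)
      _ ≤ _ := by nlinarith
  · nlinarith
  · nlinarith
  · nlinarith

/-- Compute the parameters of the test from `d` and `m`. -/
def constCmd : Cmd :=
  .seq (.const 73 5) (.seq (.op .add 74 1 1) (.seq (.op .add 71 71 74) (.seq (.op .add 71 71 73)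
  (.seq (.op .mul 8 72 71) (.seq (.const 73 32) (.seq (.op .mul 9 73 71) (.seq (.op .mul 7 1 1)
  (.seq (.op .add 10 7 1) (.seq (.op .add 10 10 3) (.seq (.const 73 4) (.seq (.op .mul 11 73 2)
  (.seq (.op .add 6 74 73) (.seq (.const 73 3) (.seq (.op .add 75 74 73) (.seq (.const 73 8)
  (.seq (.op .mul 76 72 72) (.op .mul 76 76 73)))))))))))))))))

lemma Tr.opD {s : Mem} {o : Op} {r a b v : ℕ} (h : o.apply (s.reg a) (s.reg b) = v)
    (hv : v < 2 ^ E.w) : TrD E (.op o r a b) s 1 0 (fun s' => s' = s.set r v) :=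
  (Tr.sl rfl).mono le_rfl le_rfl fun _ s' hs' _ => by
    rw [hs', Cmd.sl, h, Nat.mod_eq_of_lt hv]

lemma Tr.constD {s : Mem} {r v : ℕ} (hv : v < 2 ^ E.w) :
    TrD E (.const r v) s 1 0 (fun s' => s' = s.set r v) :=
  (Tr.sl rfl).mono le_rfl le_rfl fun _ s' hs' _ => by
    rw [hs', Cmd.sl, Nat.mod_eq_of_lt hv]

lemma Tr.opSeq {s : Mem} {o : Op} {r a b v T : ℕ} {c : Cmd} {R : Mem → Prop}
    (h : o.apply (s.reg a) (s.reg b) = v) (hv : v < 2 ^ E.w) (hc : TrD E c (s.set r v) T 0 R) :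
    TrD E (.seq (.op o r a b) c) s (T + 2) 0 R :=
  (Tr.seqD (Tr.opD h hv) fun s' hs' _ => by rw [hs']; exact hc).mono (by omega) le_rfl
    (fun _ _ h _ => h)

lemma Tr.constSeq {s : Mem} {r v T : ℕ} {c : Cmd} {R : Mem → Prop}
    (hv : v < 2 ^ E.w) (hc : TrD E c (s.set r v) T 0 R) :
    TrD E (.seq (.const r v) c) s (T + 2) 0 R :=
  (Tr.seqD (Tr.constD hv) fun s' hs' _ => by rw [hs']; exact hc).mono (by omega) le_rfl
    (fun _ _ h _ => h)

lemma constCmd_spec {s : Mem} {d m X : ℕ} (h : Roomy E d m X) (h1 : s.reg 1 = d)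
    (h2 : s.reg 2 = m) (h3 : s.reg 3 = 1) (h71 : s.reg 71 = Nat.clog 2 m)
    (h72 : s.reg 72 = 2 ^ d) :
    TrD E constCmd s 35 0 (fun s' => s'.reg 8 = 2 ^ d * kappa d m ∧ s'.reg 9 = 32 * kappa d m ∧
      s'.reg 7 = d * d ∧ s'.reg 10 = d * d + d + 1 ∧ s'.reg 11 = 4 * m ∧ s'.reg 6 = 2 * d + 4 ∧
      s'.reg 75 = 2 * d + 3 ∧ s'.reg 76 = 2 ^ (2 * d + 3)) := by
  have g1 := h.two_le
  have g2 := h.d_lt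
  have g3 := h.kappa_le
  have g4 := h.d
  have g5 := h.m
  have hk : kappa d m = Nat.clog 2 m + 2 * d + 5 := rfl
  have hXX : 2 * X ≤ X * X := Nat.mul_le_mul_right _ g1
  have hw : 128 * (X * X) < 2 ^ E.w := h.lt le_rfl
  have n4 : 2 ^ d * kappa d m < 2 ^ E.w := h.fits.tries
  have n7 : d * d + d + 1 < 2 ^ E.w := h.fits.rounds
  have n12 : 2 ^ d * 2 ^ d ≤ X * X := Nat.mul_le_mul g4.le g4.le
  unfold constCmd
  refine Tr.constSeq (E := E) (v := 5) (by omega) ?_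
  refine Tr.opSeq (E := E) (v := d + d)
    (by simp [Mem.reg_set, Op.apply, h1]) (by omega) ?_
  refine Tr.opSeq (E := E) (v := Nat.clog 2 m + (d + d))
    (by simp [Mem.reg_set, Op.apply, h71]) (by omega) ?_
  refine Tr.opSeq (E := E) (v := kappa d m)
    (by simp [Mem.reg_set, Op.apply, hk, two_mul]) (by omega) ?_
  refine Tr.opSeq (E := E) (v := 2 ^ d * kappa d m)
    (by simp [Mem.reg_set, Op.apply, h72]) (by omega) ?_
  refine Tr.constSeq (E := E) (v := 32) (by omega) ?_
  refine Tr.opSeq (E := E) (v := 32 * kappa d m)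
    (by simp [Mem.reg_set, Op.apply]) (by omega) ?_
  refine Tr.opSeq (E := E) (v := d * d)
    (by simp [Mem.reg_set, Op.apply, h1]) (by omega) ?_
  refine Tr.opSeq (E := E) (v := d * d + d)
    (by simp [Mem.reg_set, Op.apply, h1]) (by omega) ?_
  refine Tr.opSeq (E := E) (v := d * d + d + 1)
    (by simp [Mem.reg_set, Op.apply, h3]) (by omega) ?_
  refine Tr.constSeq (E := E) (v := 4) (by omega) ?_
  refine Tr.opSeq (E := E) (v := 4 * m)
    (by simp [Mem.reg_set, Op.apply, h2]) (by omega) ?_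
  refine Tr.opSeq (E := E) (v := d + d + 4)
    (by simp [Mem.reg_set, Op.apply]) (by omega) ?_
  refine Tr.constSeq (E := E) (v := 3) (by omega) ?_
  refine Tr.opSeq (E := E) (v := d + d + 3)
    (by simp [Mem.reg_set, Op.apply]) (by omega) ?_
  refine Tr.constSeq (E := E) (v := 8) (by omega) ?_
  refine Tr.opSeq (E := E) (v := 2 ^ d * 2 ^ d)
    (by simp [Mem.reg_set, Op.apply, h72]) (by omega) ?_
  refine (Tr.opD (E := E) (v := 2 ^ d * 2 ^ d * 8)
    (by simp [Mem.reg_set, Op.apply]) (by omega)).mono le_rfl le_rfl ?_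
  rintro _ _ rfl -
  simp only [Mem.reg_set, if_true, Nat.reduceEqDiff, if_false, true_and]
  refine ⟨by omega, by omega, ?_⟩
  rw [pow_add, two_mul, pow_add]
  rfl

/-- Set up the constants of the test. -/
def setupCmd : Cmd :=
  .seq (.seq (.const 3 1) (.seq (.const 4 2) (.seq (.const 70 1) (.seq (.const 71 0)
    (.const 72 1)))))
  (.seq (forLoop 46 47 2 (.seq (.op .lt 60 70 2)
    (.ite 60 (.seq (.op .mul 70 70 4) (.op .add 71 71 3)) .skip)))
  (.seq (forLoop 46 47 1 (.op .mul 72 72 4)) constCmd))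

/-- The logarithm of `m` is found by doubling until `m` is reached. The loop runs `m` times, which
is enough by `clog_le_self` and idle after that; linear time in `m` is affordable because `m` is a
factor of the bound for the queries. -/
lemma setupCmd_spec {s : Mem} {d m X : ℕ} (h : Roomy E d m X) (h0 : s.reg 0 = E.n)
    (h1 : s.reg 1 = d) (h2 : s.reg 2 = m) :
    TrD E setupCmd s (12 * m + 7 * d + 65) 0 (fun s' => s'.reg 0 = E.n ∧ s'.reg 1 = d ∧
      s'.reg 3 = 1 ∧ s'.reg 4 = 2 ∧
      s'.reg 8 = 2 ^ d * kappa d m ∧ s'.reg 9 = 32 * kappa d m ∧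
      s'.reg 7 = d * d ∧ s'.reg 10 = d * d + d + 1 ∧ s'.reg 11 = 4 * m ∧ s'.reg 6 = 2 * d + 4 ∧
      s'.reg 75 = 2 * d + 3 ∧ s'.reg 76 = 2 ^ (2 * d + 3)) := by
  have g1 := h.two_le
  have g2 := h.d_lt
  have g4 := h.d
  have g5 := h.m
  have hXX : 2 * X ≤ X * X := Nat.mul_le_mul_right _ g1
  have m1 : 1 % 2 ^ E.w = 1 := Nat.mod_eq_of_lt (h.lt (by omega))
  have m2 : 2 % 2 ^ E.w = 2 := Nat.mod_eq_of_lt (h.lt (by omega))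
  refine Tr.mono (T := 9 + ((m * (6 + 6) + 5) + ((d * (1 + 6) + 5) + 35 + 1) + 1) + 1)
    (Q := 0 + (m * 0 + (d * 0 + 0))) ?_ (by omega) (by omega) (fun _ _ h _ => h)
  refine Tr.seqD (T₁ := 9) (Tr.sl rfl) fun s₁ hs₁ hF₁ => ?_
  have a3 : s₁.reg 3 = 1 := by subst hs₁; simp [Cmd.sl, Mem.reg_set, m1]
  have a4 : s₁.reg 4 = 2 := by subst hs₁; simp [Cmd.sl, Mem.reg_set, m2]
  have a70 : s₁.reg 70 = 1 := by subst hs₁; simp [Cmd.sl, Mem.reg_set, m1]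
  have a71 : s₁.reg 71 = 0 := by subst hs₁; simp [Cmd.sl, Mem.reg_set]
  have a72 : s₁.reg 72 = 1 := by subst hs₁; simp [Cmd.sl, Mem.reg_set, m1]
  have a1 : s₁.reg 1 = d := (hF₁.1 1 rfl).trans h1
  have a2 : s₁.reg 2 = m := (hF₁.1 2 rfl).trans h2
  refine Tr.seqD (T₁ := m * (6 + 6) + 5) (T₂ := (d * (1 + 6) + 5) + 35 + 1)
    (Tr.forD (E := E) (s := s₁) (m := m) rfl (h.lt (by omega)) a2 a3
    (fun t s => s.reg 70 = 2 ^ min t (Nat.clog 2 m) ∧ s.reg 71 = min t (Nat.clog 2 m))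
    (fun t s s' hs h => by
      rw [hs.1 70 (by decide) (by decide), hs.1 71 (by decide) (by decide)]; exact h)
    (by simp [a70, a71]) ?_) fun s₂ ⟨_, b71⟩ hF₂ => ?_
  · intro t s' ht ⟨i70, i71⟩ hi hk i3 hF
    have i4 : s'.reg 4 = 2 := (hF.1 4 rfl).trans a4
    refine (Tr.sl rfl).mono (by simp [Cmd.slTime]) le_rfl fun _ s'' hs'' _ => ?_
    subst hs''
    have hiff := Nat.lt_clog_iff_pow_lt (b := 2) (by norm_num) (x := m) (y := t)
    rcases Nat.lt_or_ge t (Nat.clog 2 m) with hlt | hge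
    · have hp := hiff.1 hlt
      have e1 : (2 ^ t * 2) % 2 ^ E.w = 2 ^ t * 2 := Nat.mod_eq_of_lt (h.lt (by omega))
      have e2 : (t + 1) % 2 ^ E.w = t + 1 := Nat.mod_eq_of_lt (h.lt (by omega))
      rw [min_eq_left hlt.le] at i70 i71
      rw [min_eq_left (by omega : t + 1 ≤ _)]
      simp [Cmd.sl, Op.apply, Mem.reg_set, i70, i71, hk, hp, m1, i4, i3, e1, e2, pow_succ]
    · rw [min_eq_right hge] at i70 i71
      rw [min_eq_right (by omega : _ ≤ t + 1)]
      have : ¬ 2 ^ Nat.clog 2 m < m := not_lt.2 (Nat.le_pow_clog (by norm_num) _)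
      simp [Cmd.sl, Op.apply, Mem.reg_set, i70, i71, hk, this]
  rw [min_eq_right (clog_le_self m)] at b71
  refine Tr.seqD (T₁ := d * (1 + 6) + 5) (T₂ := 35)
    (Tr.forD (E := E) (s := s₂) (m := d) rfl (h.lt (by omega)) ((hF₂.1 1 rfl).trans a1)
    ((hF₂.1 3 rfl).trans a3) (fun t s => s.reg 72 = 2 ^ t)
    (fun t s s' hs h => by rw [hs.1 72 (by decide) (by decide)]; exact h)
    (by rw [hF₂.1 72 rfl, a72, pow_zero]) ?_) fun s₃ c72 hF₃ => ?_
  · intro t s' ht i72 hi hk i3 hF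
    have i4 : s'.reg 4 = 2 := (hF.1 4 rfl).trans ((hF₂.1 4 rfl).trans a4)
    refine (Tr.sl rfl).mono (by simp [Cmd.slTime]) le_rfl fun _ s'' hs'' _ => ?_
    subst hs''
    have e1 : (2 ^ t * 2) % 2 ^ E.w = 2 ^ t * 2 := Nat.mod_eq_of_lt (h.lt (by
      have : 2 ^ t ≤ 2 ^ d := Nat.pow_le_pow_right (by norm_num) ht.le
      omega))
    simp [Cmd.sl, Op.apply, Mem.reg_set, i72, i4, e1, pow_succ]
  refine (constCmd_spec h ?_ ?_ ?_ ?_ c72).mono le_rfl le_rfl fun _ s₄ h₄ hF₄ =>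
    ⟨?_, ?_, ?_, ?_, h₄⟩
  · rw [hF₃.1 1 rfl, hF₂.1 1 rfl, a1]
  · rw [hF₃.1 2 rfl, hF₂.1 2 rfl, a2]
  · rw [hF₃.1 3 rfl, hF₂.1 3 rfl, a3]
  · rw [hF₃.1 71 rfl, b71]
  · rw [hF₄.1 0 rfl, hF₃.1 0 rfl, hF₂.1 0 rfl, hF₁.1 0 rfl, h0]
  · rw [hF₄.1 1 rfl, hF₃.1 1 rfl, hF₂.1 1 rfl, a1]
  · rw [hF₄.1 3 rfl, hF₃.1 3 rfl, hF₂.1 3 rfl, a3]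
  · rw [hF₄.1 4 rfl, hF₃.1 4 rfl, hF₂.1 4 rfl, a4]

/-- The tester as a program. -/
def testerCmd : Cmd :=
  .seq (.seq setupCmd (.seq labelCmd (.seq (.const 12 0) (forLoop 40 41 11 sampleCmd))))
    (.ite 12 (.answer false) (.answer true))

lemma Yields.answer (s : Mem) (rest : List Cmd) (b : Bool) :
    Yields E (.answer b :: rest) s 1 0 (PMF.pure b) := by
  intro time queries t ht
  obtain ⟨t, rfl⟩ : ∃ t', t = t' + 1 := ⟨t - 1, by omega⟩
  have hrun : ∀ (t : ℕ) (c : Config), c.todo = [] → run E.w E.D E.f t c = PMF.pure c := by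
    intro t c hc
    induction t with
    | zero => rfl
    | succ t ih => rw [run, DTTest.step, hc, PMF.pure_bind, ih]
  have : run E.w E.D E.f (t + 1) (s.config (.answer b :: rest) time queries) =
      PMF.pure ⟨[], s.reg, s.arr, some b, time + 1, queries⟩ := by
    rw [run]
    simp only [DTTest.step, Mem.config, Cmd.exec, PMF.pure_bind, Cmd.cost, Cmd.queryCount]
    exact hrun _ _ rfl
  rw [this]
  simp [PMF.pure_map]

/-- The running time of the tester. -/
def testerTime (n d m : ℕ) : ℕ :=
  4 * m * (sampleEvals (params n d m) * (20 * derivTime n d) + 6) +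
    (n + 1) * (11 * (2 * d + 3) + 30) + 12 * m + 7 * d + 80

/-- The number of queries of the tester. -/
def testerQueries (n d m : ℕ) : ℕ := 4 * m * (sampleEvals (params n d m) * (10 * 2 ^ d))

/-- The bridge to probability theory: the answer has exactly the law `tester`, so nothing after this
has to look at the program again, apart from the size of the two cost bounds. -/
lemma testerCmd_yields {s : Mem} {d m X : ℕ} (h : Roomy E d m X) (h0 : s.reg 0 = E.n)
    (h1 : s.reg 1 = d) (h2 : s.reg 2 = m) :
    Yields E [testerCmd] s (testerTime E.n d m) (testerQueries E.n d m)
      (tester (params E.n d m) E.f (2 * d + 3) (4 * m) E.D) := by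
  have hK : 2 * d + 3 < E.w := by
    rw [← Nat.pow_lt_pow_iff_right (a := 2) (by norm_num), pow_add, two_mul, pow_add]
    have := h.d
    have := Nat.mul_le_mul this.le this.le
    exact h.lt (by omega)
  have main : Tr E (.seq setupCmd (.seq labelCmd (.seq (.const 12 0) (forLoop 40 41 11 sampleCmd))))
      s ((12 * m + 7 * d + 65) + (((E.n + 1) * (11 * (2 * d + 3) + 30)) + (1 + (4 * m *
        (sampleEvals (params E.n d m) * (20 * derivTime E.n d) + 6) + 5) + 1) + 1) + 1)
      (0 + (0 + (0 + 4 * m * (sampleEvals (params E.n d m) * (10 * 2 ^ d)))))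
      ((randomLabels E.n (2 * d + 3)).bind fun lab =>
        iterK (fun _ => sampleTest (params E.n d m) E.f lab E.D) 0 (4 * m) false)
      (fun b s' => s'.reg 12 = b.toNat) := by
    refine Tr.seqD (setupCmd_spec h h0 h1 h2) fun s₁ h₁ hF₁ => ?_
    obtain ⟨k0, k1, k3, k4, k8, k9, k7, k10, k11, k6, k75, k76⟩ := h₁
    refine Tr.seq (labelCmd_spec k0 k3 k75 k76 hK h.fits.bounds.n)
      fun lab s₂ ⟨hlab, k5⟩ hF₂ => ?_
    refine Tr.seqD (T₁ := 1) (T₂ := 4 * m *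
        (sampleEvals (params E.n d m) * (20 * derivTime E.n d) + 6) + 5) (Tr.sl rfl)
      fun s₃ hs₃ hF₃ => ?_
    have hC : Consts E (params E.n d m) s₂ lab := by
      refine ⟨⟨(hF₂.1 0 rfl).trans k0, (hF₂.1 3 rfl).trans k3, (hF₂.1 4 rfl).trans k4, hlab⟩,
        (hF₂.1 1 rfl).trans k1, k5, (hF₂.1 6 rfl).trans k6, (hF₂.1 7 rfl).trans k7,
        (hF₂.1 8 rfl).trans k8, (hF₂.1 9 rfl).trans k9, (hF₂.1 10 rfl).trans k10⟩
    have hC₃ := hC.frame hF₃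
    have e12 : s₃.reg 12 = 0 := by subst hs₃; simp [Cmd.sl, Mem.reg_set]
    have e11 : s₃.reg 11 = 4 * m := by rw [hF₃.1 11 rfl, hF₂.1 11 rfl, k11]
    refine Tr.forLoop (E := E) (s := s₃) (i := 40) (c := 41) (k := 11) (body := sampleCmd) rfl
      (h.lt ?_) e11 hC₃.ready.r3 (fun _ b s' => s'.reg 12 = b.toNat)
      (fun _ b => sampleTest (params E.n d m) E.f lab E.D b) false
      (fun _ _ s s' hs h => by rw [hs.1 12 (by decide) (by decide)]; exact h) e12
      (fun _ b s' _ hI _ _ _ hF => sampleCmd_spec h.fits (hC₃.frame hF) hI)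
    have := h.m
    have := h.two_le
    nlinarith
  have last : ∀ (b : Bool) (s' : Mem), s'.reg 12 = b.toNat →
      Yields E [.ite 12 (.answer false) (.answer true)] s' 2 0 (PMF.pure !b) := by
    intro b s' hb
    have key := Yields.step (E := E) (cmd := .ite 12 (.answer false) (.answer true)) (rest := [])
      (todo := [if s'.reg 12 ≠ 0 then .answer false else .answer true])
      (s := s') (U := PMF.pure ()) (σ := fun _ => s') (ν := fun _ => PMF.pure !b) (N := 1) (M := 0)
      (by intros; rw [PMF.pure_bind]; rfl) (fun _ => by
        cases b
        · simpa [hb] using Yields.answer (E := E) s' [] true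
        · simpa [hb] using Yields.answer (E := E) s' [] false)
    rw [PMF.pure_bind] at key
    exact key
  have key := Yields.step (E := E) (cmd := testerCmd) (rest := [])
    (todo := [.seq setupCmd (.seq labelCmd (.seq (.const 12 0) (forLoop 40 41 11 sampleCmd))),
      .ite 12 (.answer false) (.answer true)])
    (s := s) (U := PMF.pure ()) (σ := fun _ => s)
    (ν := fun _ => tester (params E.n d m) E.f (2 * d + 3) (4 * m) E.D)
    (by intros; rw [PMF.pure_bind]; rfl) (fun _ => by
      have := main [.ite 12 (.answer false) (.answer true)] 2 0 (fun b => PMF.pure !b)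
        (fun b s' h _ => last b s' h)
      rw [PMF.bind_bind] at this
      exact this)
  rw [PMF.pure_bind] at key
  refine key.mono ?_ ?_
  · simp only [testerCmd, Cmd.cost, testerTime]
    omega
  · simp only [testerCmd, Cmd.queryCount, testerQueries]
    omega

section Initial

variable {n : ℕ} {w d m N M T : ℕ} {ε : ℝ} {D : PMF (Cube n)} {f : Cube n → Bool} {c : Cmd}
  {ν : PMF Bool}

/-- The memory at the start. -/
def initMem (n w d m : ℕ) : Mem :=
  ⟨fun r => if r = 0 then n % 2 ^ w else if r = 1 then d % 2 ^ w else if r = 2 then m % 2 ^ w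
    else 0, fun _ _ => 0⟩

lemma Yields.answersWithin (h : Yields ⟨n, w, D, f⟩ [c] (initMem n w d ⌈1 / ε⌉₊) N M ν)
    (hN : N ≤ T) : AnswersWithin c w d ε D f T M := by
  intro c' hc'
  obtain ⟨h1, h2⟩ := h 0 0 T hN
  refine ⟨?_, ?_, ?_⟩
  · have h3 : c'.output ∈ ((execution c w d ε D f T).map Config.output).support :=
      (PMF.mem_support_map_iff _ _ _).2 ⟨c', hc', rfl⟩
    have h4 : (execution c w d ε D f T).map Config.output = ν.map some := h1
    rw [h4] at h3
    obtain ⟨b, -, hb⟩ := (PMF.mem_support_map_iff _ _ _).1 h3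
    rw [← hb]
    rfl
  · have := (h2 c' hc').1
    omega
  · have := (h2 c' hc').2
    omega

lemma Yields.answerProb (h : Yields ⟨n, w, D, f⟩ [c] (initMem n w d ⌈1 / ε⌉₊) N M ν)
    (hN : N ≤ T) (b : Bool) : answerProb c w d ε D f T b = ν b := by
  obtain ⟨h1, -⟩ := h 0 0 T hN
  have h4 : (execution c w d ε D f T).map Config.output = ν.map some := h1
  have h5 : ((execution c w d ε D f T).map Config.output).toOuterMeasure {some b} = ν b := by
    rw [h4, PMF.toOuterMeasure_map_apply]
    have : some ⁻¹' {some b} = {b} := by ext; simp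
    rw [this, PMF.toOuterMeasure_apply_singleton]
  rw [PMF.toOuterMeasure_map_apply] at h5
  exact h5

end Initial

end DTTest
end

noncomputable section

namespace DTTest

/-! ### Probabilities -/

section Prob

variable {α β : Type}

/-- The probability of an event. -/
def prob (μ : PMF α) (S : Set α) : ENNReal := μ.toOuterMeasure S

lemma prob_bind (μ : PMF α) (f : α → PMF β) (S : Set β) :
    prob (μ.bind f) S = ∑' a, μ a * prob (f a) S := PMF.toOuterMeasure_bind_apply _ _ _

lemma prob_map (μ : PMF α) (f : α → β) (S : Set β) : prob (μ.map f) S = prob μ (f ⁻¹' S) :=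
  PMF.toOuterMeasure_map_apply _ _ _

lemma prob_singleton (μ : PMF α) (a : α) : prob μ {a} = μ a :=
  PMF.toOuterMeasure_apply_singleton _ _

lemma prob_mono (μ : PMF α) {S S' : Set α} (h : S ⊆ S') : prob μ S ≤ prob μ S' :=
  μ.toOuterMeasure.mono h

lemma prob_union_le (μ : PMF α) (S S' : Set α) : prob μ (S ∪ S') ≤ prob μ S + prob μ S' :=
  MeasureTheory.measure_union_le _ _

lemma prob_add_compl (μ : PMF α) (S : Set α) : prob μ S + prob μ Sᶜ = 1 := by
  rw [prob, prob, PMF.toOuterMeasure_apply, PMF.toOuterMeasure_apply, ← ENNReal.tsum_add,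
    ← μ.tsum_coe]
  exact tsum_congr fun a => Set.indicator_self_add_compl_apply S μ a

lemma prob_le_one (μ : PMF α) (S : Set α) : prob μ S ≤ 1 :=
  (prob_add_compl μ S).le.trans' le_self_add

lemma prob_univ (μ : PMF α) : prob μ Set.univ = 1 :=
  (PMF.toOuterMeasure_apply_eq_one_iff _ _).2 (Set.subset_univ _)

lemma prob_empty (μ : PMF α) : prob μ ∅ = 0 := MeasureTheory.measure_empty

lemma prob_pure_of_mem {a : α} {S : Set α} (h : a ∈ S) : prob (PMF.pure a) S = 1 := by
  rw [prob, PMF.toOuterMeasure_pure_apply, if_pos h]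

lemma prob_pure_of_notMem {a : α} {S : Set α} (h : a ∉ S) : prob (PMF.pure a) S = 0 := by
  rw [prob, PMF.toOuterMeasure_pure_apply, if_neg h]

/-- The union bound for an experiment in two stages, where `A` is the bad event of the first stage.
-/
lemma prob_bind_le_add {μ : PMF α} {f : α → PMF β} {S : Set β} {A : Set α} {c : ENNReal}
    (h : ∀ a ∉ A, prob (f a) S ≤ c) : prob (μ.bind f) S ≤ prob μ A + c := by
  rw [prob_bind]
  calc ∑' a, μ a * prob (f a) S ≤ ∑' a, (A.indicator μ a + μ a * c) := by
        refine ENNReal.tsum_le_tsum fun a => ?_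
        by_cases ha : a ∈ A
        · rw [Set.indicator_of_mem ha]
          exact (mul_le_of_le_one_right' (prob_le_one _ _)).trans le_self_add
        · exact (mul_le_mul_right (h a ha) _).trans le_add_self
    _ = _ := by
        rw [ENNReal.tsum_add, ENNReal.tsum_mul_right, μ.tsum_coe, one_mul, prob,
          PMF.toOuterMeasure_apply]

lemma prob_bind_le {μ : PMF α} {f : α → PMF β} {S : Set β} {c : ENNReal}
    (h : ∀ a, prob (f a) S ≤ c) : prob (μ.bind f) S ≤ c := by
  have := prob_bind_le_add (μ := μ) (A := ∅) (fun a _ => h a)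
  rwa [prob_empty, zero_add] at this

/-- The lower bound for two stages: a good first stage times the guarantee that it provides. Chains
of it give the rejection probability in `exists_litTest_le`. -/
lemma prob_mul_le_bind {μ : PMF α} {f : α → PMF β} {S : Set β} {A : Set α} {c : ENNReal}
    (h : ∀ a ∈ A, c ≤ prob (f a) S) : prob μ A * c ≤ prob (μ.bind f) S := by
  rw [prob_bind, prob, PMF.toOuterMeasure_apply, ← ENNReal.tsum_mul_right]
  refine ENNReal.tsum_le_tsum fun a => ?_
  by_cases ha : a ∈ A
  · rw [Set.indicator_of_mem ha]
    exact mul_le_mul_right (h a ha) _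
  · simp [Set.indicator_of_notMem ha]

lemma le_prob_bind {μ : PMF α} {f : α → PMF β} {S : Set β} {c : ENNReal}
    (h : ∀ a, c ≤ prob (f a) S) : c ≤ prob (μ.bind f) S := by
  have := prob_mul_le_bind (μ := μ) (A := Set.univ) (fun a _ => h a)
  rwa [prob_univ, one_mul] at this

/-- The union bound for an invariant that may get lost in each step of an iteration. -/
lemma prob_iterK_le {step : ℕ → α → PMF α} {I : ℕ → Set α} {δ : ENNReal}
    (h : ∀ t, ∀ a ∈ I t, prob (step t a) (I (t + 1))ᶜ ≤ δ) (t r : ℕ) {a : α} (ha : a ∈ I t) :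
    prob (iterK step t r a) (I (t + r))ᶜ ≤ r * δ := by
  induction r generalizing t a with
  | zero =>
    rw [iterK, prob_pure_of_notMem (by simpa using ha)]
    exact zero_le
  | succ r ih =>
    rw [iterK, Nat.cast_succ, add_mul, one_mul]
    refine (prob_bind_le_add (A := (I (t + 1))ᶜ) fun b hb => ?_).trans
      ((add_le_add_left (h t a ha) _).trans_eq (add_comm _ _))
    have := ih (t + 1) (not_not.1 hb)
    rwa [show t + 1 + r = t + (r + 1) by omega] at this

/-- If an event, once lost, does not come back, and in each step it is kept with probability at
most `c`, then after `r` steps it holds with probability at most `c ^ r`. -/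
lemma prob_iterK_le_pow {step : ℕ → α → PMF α} {S : Set α} {c : ENNReal}
    (h : ∀ t, ∀ a ∈ S, prob (step t a) S ≤ c) (h' : ∀ t, ∀ a ∉ S, prob (step t a) S = 0)
    (t r : ℕ) (a : α) : prob (iterK step t r a) S ≤ c ^ r ∧
      (a ∉ S → prob (iterK step t r a) S = 0) := by
  induction r generalizing t a with
  | zero =>
    refine ⟨by simpa using prob_le_one _ _, fun ha => ?_⟩
    rw [iterK, prob_pure_of_notMem ha]
  | succ r ih =>
    have key : prob (iterK step t (r + 1) a) S ≤ prob (step t a) S * c ^ r := by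
      rw [iterK, prob_bind, prob, PMF.toOuterMeasure_apply, ← ENNReal.tsum_mul_right]
      refine ENNReal.tsum_le_tsum fun b => ?_
      by_cases hb : b ∈ S
      · rw [Set.indicator_of_mem hb]
        exact mul_le_mul_right (ih (t + 1) b).1 _
      · simp [(ih (t + 1) b).2 hb]
    by_cases ha : a ∈ S
    · refine ⟨key.trans ?_, fun h => absurd ha h⟩
      rw [pow_succ, mul_comm]
      exact mul_le_mul_right (h t a ha) _
    · rw [h' t a ha, zero_mul] at key
      exact ⟨key.trans zero_le, fun _ => le_antisymm key zero_le⟩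

lemma prob_uniform_equiv [Fintype α] [Nonempty α] (e : α ≃ α) (S : Set α) :
    prob (PMF.uniformOfFintype α) (e ⁻¹' S) = prob (PMF.uniformOfFintype α) S := by
  rw [← prob_map, uniform_map_equiv]

end Prob

end DTTest
end

noncomputable section

namespace DTTest

variable {n : ℕ}

/-! ### Functions of low degree over the field with two elements -/

/-- The derivative of `g` in direction `j`. -/
def diff (j : Fin n) (g : Cube n → Bool) (y : Cube n) : Bool :=
  xor (g (Function.update y j false)) (g (Function.update y j true))

/-- `g` has degree at most `k` as a polynomial over the field with two elements. -/
def IsDeg : ℕ → (Cube n → Bool) → Prop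
  | 0, g => ∀ y y', g y = g y'
  | k + 1, g => ∀ j, IsDeg k (diff j g)

/-- Change coordinate `j`. -/
def flip (j : Fin n) : Cube n ≃ Cube n where
  toFun y := Function.update y j (!y j)
  invFun y := Function.update y j (!y j)
  left_inv y := by simp
  right_inv y := by simp

lemma update_eq_of_eq {y : Cube n} {j : Fin n} {b : Bool} (h : y j = b) :
    Function.update y j b = y := by
  rw [← h, Function.update_eq_self]

/-- One point is turned into the other by changing one coordinate at a time. -/
lemma diff_eq_false_const {g : Cube n → Bool} (h : ∀ j y, diff j g y = false) (y y' : Cube n) :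
    g y = g y' := by
  classical
  have hup : ∀ (j : Fin n) (y : Cube n) (b : Bool), g (Function.update y j b) = g y := by
    intro j y b
    have h1 := h j y
    simp only [diff, bne_eq_false_iff_eq] at h1
    cases hb : y j <;> rw [update_eq_of_eq hb] at h1 <;> cases b <;>
      simp only [update_eq_of_eq hb, h1]
  have key : ∀ s : Finset (Fin n), g (fun i => if i ∈ s then y i else y' i) = g y' := by
    intro s
    induction s using Finset.induction_on with
    | empty => simp
    | insert j s hj ih =>
      rw [← ih, ← hup j (fun i => if i ∈ s then y i else y' i) (y j)]
      congr 1
      ext i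
      by_cases hi : i = j
      · subst hi; simp
      · simp [hi]
  simpa using key Finset.univ

/-- A nonzero polynomial of degree `k` does not vanish on a fraction of at least `2⁻ᵏ` of the
points of the cube. -/
lemma IsDeg.le_prob {k : ℕ} {g : Cube n → Bool} (hg : IsDeg k g) {b : Bool} {y₀ : Cube n}
    (h₀ : g y₀ ≠ b) : (2 ^ k : ENNReal)⁻¹ ≤ prob (unif n) {y | g y ≠ b} := by
  induction k generalizing g b y₀ with
  | zero =>
    have : {y | g y ≠ b} = Set.univ := Set.eq_univ_of_forall fun y => by
      rw [Set.mem_ofPred_eq, hg y y₀]; exact h₀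
    simp [this, prob_univ]
  | succ k ih =>
    by_cases hd : ∃ j y, diff j g y ≠ false
    · obtain ⟨j, y₁, h₁⟩ := hd
      -- Where the derivative in direction `j` is nonzero, `g` differs from `b` at `y` or at its
      -- neighbour in direction `j`. Moving to the neighbour preserves the measure, so one direction
      -- costs a factor 2.
      have h2 : {y | diff j g y ≠ false} ⊆ {y | g y ≠ b} ∪ flip j ⁻¹' {y | g y ≠ b} := by
        intro y hy
        by_contra hc
        simp only [Set.mem_union, Set.mem_ofPred_eq, not_or, not_not, Set.mem_preimage, flip,
          Equiv.coe_fn_mk] at hc hy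
        apply hy
        unfold diff
        cases hb : y j <;> rw [hb] at hc <;> rw [update_eq_of_eq hb] <;> simp [hc.1, ← hc.2]
      have h3 := (ih (hg j) h₁).trans ((prob_mono _ h2).trans (prob_union_le _ _ _))
      rw [prob_uniform_equiv, ← two_mul] at h3
      rw [pow_succ, ENNReal.mul_inv (by simp) (by simp)]
      calc (2 ^ k : ENNReal)⁻¹ * 2⁻¹ ≤ 2 * prob (unif n) {y | g y ≠ b} * 2⁻¹ := by gcongr
        _ = _ := by
          rw [mul_comm 2, mul_assoc, ENNReal.mul_inv_cancel (by simp) (by simp), mul_one]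
    · push Not at hd
      have : {y | g y ≠ b} = Set.univ := Set.eq_univ_of_forall fun y => by
        rw [Set.mem_ofPred_eq, diff_eq_false_const hd y y₀]; exact h₀
      rw [this, prob_univ]
      exact ENNReal.inv_le_one.2 (one_le_pow₀ (by norm_num))

/-! ### The test for literals -/

/-- Coordinatewise exclusive or. -/
def xorC (y z : Cube n) : Cube n := fun i => xor (y i) (z i)

/-- Translations of the cube. -/
def shift (u : Cube n) : Cube n ≃ Cube n where
  toFun y := xorC y u
  invFun y := xorC y u
  left_inv y := by ext i; simp [xorC]
  right_inv y := by ext i; simp [xorC]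

lemma prob_evalLin (g : Cube n → Bool) (y : Cube n) (b : Bool) :
    prob (evalLin g y) {b} = prob (unif n) {z | xor (g z) (g (xorC z y)) = b} := by
  rw [evalLin, prob_map]
  rfl

lemma prob_false_add_true (μ : PMF Bool) (b : Bool) : prob μ {b} + prob μ {!b} = 1 := by
  rw [← prob_add_compl μ {b}]
  congr 2
  ext c
  cases b <;> cases c <;> simp

lemma le_prob_of_le_prob_not {μ : PMF Bool} {b : Bool} {p q : ENNReal} (h : prob μ {!b} ≤ p)
    (hpq : q + p = 1) (hp : p ≠ ⊤) : q ≤ prob μ {b} := by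
  have := prob_false_add_true μ b
  refine (ENNReal.add_le_add_iff_right hp).1 ?_
  rw [hpq, ← this]
  gcongr

/-- The linear function close to `g` at `y`, if there is one. -/
def Majority (g : Cube n → Bool) (v : Cube n → Bool) : Prop :=
  ∀ y, prob (unif n) {z | xor (g z) (g (xorC z y)) ≠ v y} ≤ 1 / 8

lemma xorC_assoc (x y z : Cube n) : xorC (xorC x y) z = xorC x (xorC y z) := by
  ext i; simp [xorC]

lemma xorC_cancel (y u : Cube n) : xorC u (xorC u y) = y := by
  ext i; simp [xorC]

/-- Three events of probability at most 1/8 do not cover the cube. At a point `z` outside them the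
value for `y` at `z` and the value for `y'` at `z + y` telescope to the value for `y + y'` at `z`.
-/
lemma Majority.linear {g v : Cube n → Bool} (h : Majority g v) (y y' : Cube n) :
    v (xorC y y') = xor (v y) (v y') := by
  by_contra hc
  have hsub : Set.univ ⊆ ({z | xor (g z) (g (xorC z y)) ≠ v y} ∪
      shift y ⁻¹' {z | xor (g z) (g (xorC z y')) ≠ v y'}) ∪
      {z | xor (g z) (g (xorC z (xorC y y'))) ≠ v (xorC y y')} := by
    intro z _
    by_contra hz
    simp only [Set.mem_union, Set.mem_ofPred_eq, not_or, not_not, Set.mem_preimage, shift,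
      Equiv.coe_fn_mk, xorC_assoc] at hz
    obtain ⟨⟨h1, h2⟩, h3⟩ := hz
    apply hc
    rw [← h1, ← h2, ← h3]
    cases g z <;> cases g (xorC z y) <;> cases g (xorC z (xorC y y')) <;> rfl
  have h1 := (prob_mono (unif n) hsub).trans ((prob_union_le _ _ _).trans
    (add_le_add_left (prob_union_le _ _ _) _))
  rw [prob_univ, prob_uniform_equiv] at h1
  have h2 : (1 : ENNReal) ≤ 1 / 8 + 1 / 8 + 1 / 8 :=
    h1.trans (add_le_add (add_le_add (h _) (h _)) (h _))
  rw [ENNReal.div_add_div_same, ENNReal.div_add_div_same,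
    ENNReal.le_div_iff_mul_le (by simp) (by simp)] at h2
  norm_num at h2

/-- If at most half of the points are far from being decided, then all points are decided. -/
lemma exists_majority {g : Cube n → Bool}
    (h : prob (unif n) {y | ∀ b, 1 / 16 ≤ prob (evalLin g y) {b}} < 1 / 2) :
    ∃ v, Majority g v := by
  have key : ∀ y, ∃ b, prob (unif n) {z | xor (g z) (g (xorC z y)) ≠ b} ≤ 1 / 8 := by
    intro y
    set B : Set (Cube n) := {y | ∀ b, 1 / 16 ≤ prob (evalLin g y) {b}} with hB
    -- Both `u` and `u + y` are uniform and `B` has measure less than 1/2, so some `u` splits `y`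
    -- into two decided points.
    obtain ⟨u, hu, hu'⟩ : ∃ u, u ∉ B ∧ xorC u y ∉ B := by
      by_contra hc
      push Not at hc
      have h1 : Bᶜ ⊆ shift y ⁻¹' B := fun u hu => hc u hu
      have h2 := prob_mono (unif n) h1
      rw [prob_uniform_equiv] at h2
      have h3 := prob_add_compl (unif n) B
      have h4 : prob (unif n) B + prob (unif n) Bᶜ < 1 / 2 + 1 / 2 :=
        ENNReal.add_lt_add h (h2.trans_lt h)
      rw [h3, ENNReal.add_halves] at h4
      exact lt_irrefl _ h4
    simp only [hB, Set.mem_ofPred_eq, not_forall, not_le, prob_evalLin] at hu hu'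
    obtain ⟨b, hb⟩ := hu
    obtain ⟨b', hb'⟩ := hu'
    -- Here `b` and `b'` are the rare values at `u` and at `u + y`. Negating both leaves their sum
    -- unchanged, so it is also the sum of the frequent values.
    refine ⟨xor b b', ?_⟩
    have hsub : {z | xor (g z) (g (xorC z y)) ≠ xor b b'} ⊆
        {z | xor (g z) (g (xorC z u)) = b} ∪
          shift u ⁻¹' {z | xor (g z) (g (xorC z (xorC u y))) = b'} := by
      intro z hz
      by_contra hc
      simp only [Set.mem_union, Set.mem_ofPred_eq, not_or, Set.mem_preimage, shift,
        Equiv.coe_fn_mk, xorC_assoc, xorC_cancel] at hz hc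
      obtain ⟨h1, h2⟩ := hc
      clear hb hb'
      apply hz
      clear hz
      revert h1 h2
      generalize g z = a₁
      generalize g (xorC z u) = a₂
      generalize g (xorC z y) = a₃
      revert a₁ a₂ a₃ b b'
      decide
    have h1 := (prob_mono (unif n) hsub).trans (prob_union_le _ _ _)
    rw [prob_uniform_equiv] at h1
    refine (h1.trans (add_le_add hb.le hb'.le)).trans_eq ?_
    rw [ENNReal.div_add_div_same, show (1 + 1 : ENNReal) = 2 * 1 by norm_num,
      show (16 : ENNReal) = 2 * 8 by norm_num, ENNReal.mul_div_mul_left _ _ (by simp) (by simp)]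
  choose v hv using key
  exact ⟨v, hv⟩

/-- Coordinatewise `nand`. -/
def nandC (y z : Cube n) : Cube n := fun i => !(y i && z i)

/-- A linear function that respects `nand` is a coordinate. -/
lemma exists_coordinate {v : Cube n → Bool} (h : ∀ y y', v (xorC y y') = xor (v y) (v y'))
    (h' : ∀ y y', v (nandC y y') = !(v y && v y')) : ∃ i, ∀ y, v y = y i := by
  classical
  have h0 : v (fun _ => false) = false := by
    have := h (fun _ => false) (fun _ => false)
    rwa [Bool.xor_self] at this
  -- This is the reason for testing `nand` and not `and`: the zero function is excluded.
  have h1 : v (fun _ => true) = true := by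
    have := h' (fun _ => false) (fun _ => false)
    rwa [h0] at this
  have hand : ∀ y y', v (fun i => y i && y' i) = (v y && v y') := by
    intro y y'
    have := h (fun _ => true) (nandC y y')
    rw [h1, h', Bool.true_xor, Bool.not_not] at this
    rw [← this]
    congr 1
    ext i
    simp [nandC, xorC]
  -- The all-ones point is the sum of the unit vectors and `v` is 1 there, so `v` cannot vanish on
  -- all unit vectors.
  have hex : ∃ i : Fin n, v (fun j => decide (j = i)) = true := by
    by_contra hc
    push Not at hc
    have key : ∀ s : Finset (Fin n), v (fun j => decide (j ∈ s)) = false := by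
      intro s
      induction s using Finset.induction_on with
      | empty => simpa using h0
      | insert i s hi ih =>
        have : (fun j => decide (j ∈ insert i s)) =
            xorC (fun j => decide (j = i)) (fun j => decide (j ∈ s)) := by
          ext j
          by_cases hj : j = i
          · subst hj; simp [xorC, hi]
          · simp [xorC, hj]
        rw [this, h, ih, Bool.eq_false_of_not_eq_true (hc i)]
        rfl
    have := key Finset.univ
    simp [h1] at this
  obtain ⟨i, hi⟩ := hex
  -- Multiplying `y` by the unit vector `i` does not change `v`, and leaves the unit vector or zero
  -- according to `y i`.
  refine ⟨i, fun y => ?_⟩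
  have e := hand y (fun j => decide (j = i))
  rw [hi, Bool.and_true] at e
  rw [← e]
  cases hy : y i
  · rw [← h0]
    congr 1
    ext j
    by_cases hj : j = i <;> simp [hj, hy]
  · rw [← hi]
    congr 1
    ext j
    by_cases hj : j = i <;> simp [hj, hy]

/-- The violation of the `nand` identity is affine in the first argument. -/
lemma isDeg_nand {v : Cube n → Bool} (h : ∀ y y', v (xorC y y') = xor (v y) (v y')) (y' : Cube n) :
    IsDeg 1 fun y => xor (v (nandC y y')) (!(v y && v y')) := by
  intro j y₁ y₂
  have h1 : ∀ y : Cube n, Function.update y j true =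
      xorC (Function.update y j false) (Function.update (fun _ => false) j true) := by
    intro y
    ext i
    by_cases hi : i = j
    · subst hi; simp [xorC]
    · simp [xorC, hi]
  have h2 : ∀ y : Cube n, nandC (Function.update y j true) y' =
      xorC (nandC (Function.update y j false) y') (Function.update (fun _ => false) j (y' j)) := by
    intro y
    ext i
    by_cases hi : i = j
    · subst hi; simp [xorC, nandC]
    · simp [xorC, nandC, hi]
  -- By additivity the dependence on `y` cancels in the derivative.
  have key : ∀ y, diff j (fun y => xor (v (nandC y y')) (!(v y && v y'))) y =
      xor (v (Function.update (fun _ => false) j (y' j)))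
        (v (Function.update (fun _ => false) j true) && v y') := by
    intro y
    rw [diff, h2, h1 y, h, h]
    cases v (nandC (Function.update y j false) y') <;> cases v (Function.update y j false) <;>
      cases v y' <;> cases v (Function.update (fun _ => false) j (y' j)) <;>
      cases v (Function.update (fun _ => false) j true) <;> rfl
  rw [key, key]

lemma nandC_comm (y z : Cube n) : nandC y z = nandC z y := by
  ext i; simp [nandC, Bool.and_comm]

/-- For each function there is a coordinate such that the test for a wrong value of this
coordinate fails with constant probability. -/
lemma exists_litTest_le (hn : 0 < n) (g : Cube n → Bool) :
    ∃ i, ∀ x v, v ≠ x i → prob (litTest g x v) {true} ≤ 31 / 32 := by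
  suffices ∃ i, ∀ x v, v ≠ x i → 1 / 32 ≤ prob (litTest g x v) {false} by
    obtain ⟨i, hi⟩ := this
    refine ⟨i, fun x v hv => ?_⟩
    have h1 := hi x v hv
    have h2 := prob_false_add_true (litTest g x v) true
    refine (ENNReal.add_le_add_iff_right (a := 1 / 32) (by simp)).1 ?_
    rw [ENNReal.div_add_div_same, show (31 + 1 : ENNReal) = 32 by norm_num,
      ENNReal.div_self (by simp) (by simp)]
    exact (add_le_add_right h1 _).trans h2.le
  -- Either many points are undecided, and then the two evaluations at `y₁` differ often: `1 / 2 *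
  -- (1 / 16)`. Or there is a linear `v` close to `g`, which is a coordinate or violates the `nand`
  -- identity. Unless `v` is a coordinate, the test fails often for every value, so any coordinate
  -- will do.
  rcases le_or_gt (1 / 2) (prob (unif n) {y | ∀ b, 1 / 16 ≤ prob (evalLin g y) {b}}) with hB | hB
  · refine ⟨⟨0, hn⟩, fun x v _ => ?_⟩
    have : (1 / 32 : ENNReal) = 1 / 2 * (1 / 16) := by
      simp only [one_div]
      rw [← ENNReal.mul_inv (by simp) (by simp)]
      norm_num
    rw [this, litTest]
    refine le_prob_bind fun a₀ => (mul_le_mul_left hB _).trans (prob_mul_le_bind fun y₁ hy₁ =>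
      le_prob_bind fun y₂ => le_prob_bind fun a₁ => ?_)
    rw [← mul_one (1 / 16 : ENNReal)]
    refine (mul_le_mul_left (hy₁ (!a₁)) _).trans (prob_mul_le_bind fun a₂ ha₂ =>
      le_prob_bind fun a₃ => ?_)
    rw [Set.mem_singleton_iff.1 ha₂, prob_map]
    refine (prob_univ _).symm.le.trans (prob_mono _ fun a₄ _ => ?_)
    cases a₁ <;> simp
  · obtain ⟨v, hv⟩ := exists_majority hB
    have hlow : ∀ y, 1 / 2 ≤ prob (evalLin g y) {v y} := by
      intro y
      refine le_prob_of_le_prob_not (p := 1 / 2) ?_ (ENNReal.add_halves 1) (by simp)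
      rw [prob_evalLin]
      refine (prob_mono _ fun z hz => ?_).trans ((hv y).trans ?_)
      · rw [Set.mem_ofPred_eq] at hz ⊢
        rw [hz]
        simp
      · exact ENNReal.div_le_div le_rfl (by norm_num)
    by_cases hc : ∀ y y', v (nandC y y') = !(v y && v y')
    · obtain ⟨i, hi⟩ := exists_coordinate hv.linear hc
      refine ⟨i, fun x a ha => ?_⟩
      refine le_trans ?_ (prob_mul_le_bind (A := {v x}) (c := 1) fun a₀ h₀ =>
        le_prob_bind fun y₁ => le_prob_bind fun y₂ => le_prob_bind fun a₁ =>
        le_prob_bind fun a₂ => le_prob_bind fun a₃ => ?_)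
      · rw [mul_one]
        refine le_trans ?_ (hlow x)
        exact ENNReal.div_le_div le_rfl (by norm_num)
      · rw [Set.mem_singleton_iff.1 h₀, prob_map]
        refine (prob_univ _).symm.le.trans (prob_mono _ fun a₄ _ => ?_)
        have : (v x == a) = false := by rw [hi]; simpa using Ne.symm ha
        simp [this]
    · push Not at hc
      obtain ⟨z, z', hz⟩ := hc
      refine ⟨⟨0, hn⟩, fun x a _ => ?_⟩
      have hA : 1 / 2 ≤ prob (unif n) {y | xor (v (nandC y z')) (!(v y && v z')) ≠ false} := by
        have := (isDeg_nand hv.linear z').le_prob (b := false) (y₀ := z) (by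
          simpa using hz)
        simpa using this
      have hA' : ∀ y, xor (v (nandC y z')) (!(v y && v z')) ≠ false →
          1 / 2 ≤ prob (unif n) {y' | xor (v (nandC y y')) (!(v y && v y')) ≠ false} := by
        intro y hy
        have := (isDeg_nand hv.linear y).le_prob (b := false) (y₀ := z') (by
          rwa [nandC_comm, Bool.and_comm])
        simp only [nandC_comm _ y, Bool.and_comm _ (v y)] at this
        simpa using this
      -- The violation is affine in each argument, which gives 1/2 for `y₁` and 1/2 for `y₂`; three
      -- evaluations are right with probability at least 1/2 each.
      have hnum : (1 / 32 : ENNReal) = 1 / 2 * (1 / 2 * (1 / 2 * (1 / 2 * (1 / 2)))) := by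
        simp only [one_div]
        iterate 4 rw [← ENNReal.mul_inv (by simp) (by simp)]
        norm_num
      refine hnum.le.trans (le_prob_bind fun a₀ => (mul_le_mul_left hA _).trans
        (prob_mul_le_bind fun y₁ hy₁ => (mul_le_mul_left (hA' y₁ hy₁) _).trans
        (prob_mul_le_bind fun y₂ hy₂ => (mul_le_mul_left (hlow y₁) _).trans
        (prob_mul_le_bind fun a₁ h₁ => le_prob_bind fun a₂ =>
        (mul_le_mul_left (hlow y₂) _).trans (prob_mul_le_bind fun a₃ h₃ => ?_)))))
      rw [prob_map]
      refine le_trans ?_ (prob_mono _ (S := {v (nandC y₁ y₂)}) fun a₄ h₄ => ?_)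
      · exact hlow _
      · rw [Set.mem_singleton_iff] at h₁ h₃ h₄
        rw [Set.mem_ofPred_eq] at hy₂
        subst h₁ h₃ h₄
        rw [Set.mem_preimage, Set.mem_singleton_iff, Bool.and_eq_false_iff]
        right
        rw [beq_eq_false_iff_ne]
        simpa using hy₂

end DTTest
end

/-! ### Soundness: functions far from all depth-`d ^ 2` trees are rejected -/

noncomputable section

namespace DTTest

variable {n : ℕ} {α β γ : Type}

lemma prob_bind_le_bind {μ : PMF α} {f : α → PMF β} {g : α → PMF γ} {S : Set β} {S' : Set γ}
    {c : ENNReal} (h : ∀ a, prob (f a) S ≤ prob (g a) S' + c) :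
    prob (μ.bind f) S ≤ prob (μ.bind g) S' + c := by
  rw [prob_bind, prob_bind]
  calc ∑' a, μ a * prob (f a) S ≤ ∑' a, (μ a * prob (g a) S' + μ a * c) :=
        ENNReal.tsum_le_tsum fun a => (mul_le_mul_right (h a) _).trans_eq (mul_add _ _ _)
    _ = _ := by rw [ENNReal.tsum_add, ENNReal.tsum_mul_right, μ.tsum_coe, one_mul]

/-- A wrong value of the coordinate passes all tests only with small probability. -/
lemma prob_litEval_le {g : Cube n → Bool} {x : Cube n} {v : Bool} {c : ENNReal}
    (h : prob (litTest g x v) {true} ≤ c) (reps : ℕ) :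
    prob (litEval g x reps) {(v, true)} ≤ c ^ reps := by
  refine prob_bind_le fun a => ?_
  rw [prob_map]
  by_cases ha : a = v
  · subst ha
    refine (prob_mono _ (S' := {true}) fun ok hok => ?_).trans
      (prob_iterK_le_pow (S := {true}) (c := c) (fun _ b hb => ?_) (fun _ b hb => ?_) 0 reps
        true).1
    · simpa using hok
    · rw [Set.mem_singleton_iff.1 hb, prob_map]
      simpa using h
    · have : b = false := by simpa using hb
      rw [this, prob_map]
      simpa using prob_empty _
  · have : (fun ok => (a, ok)) ⁻¹' {(v, true)} = ∅ := by
      ext ok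
      simp [ha]
    rw [this, prob_empty]
    exact zero_le

variable (P : Params) (f : Cube n → Bool) (lab : Fin n → Fin n)

lemma TState.push_flag_of_flag {st : TState} (h : st.flag = true) (b : Bool) (j : ℕ) (v ok : Bool) :
    (st.push P b j v ok).flag = true := by
  unfold TState.push
  split_ifs <;> simp [h]

lemma TState.push_flag_of_not (st : TState) (b : Bool) (j : ℕ) (v : Bool) :
    (st.push P b j v false).flag = true := by
  unfold TState.push
  split_ifs <;> simp

lemma prob_round_of_flag {x : Cube n} {st : TState} (h : st.flag = true) :
    prob (round P f lab x st) {s | s.flag = false} = 0 := by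
  refine le_antisymm (prob_bind_le fun U => prob_bind_le fun o => ?_) zero_le
  cases o with
  | none => rw [prob_pure_of_notMem (by simp [h])]
  | some Z =>
    rw [prob_map]
    refine (prob_mono _ (S' := ∅) fun p hp => ?_).trans (prob_empty _).le
    rw [Set.mem_preimage, Set.mem_ofPred_eq, TState.push_flag_of_flag P h] at hp
    exact absurd hp (by simp)

lemma prob_iterK_round_of_flag {x : Cube n} {st : TState} (h : st.flag = true) (t r : ℕ) (o : Bool) :
    prob (iterK (fun _ => round P f lab x) t r st) {s | s.flag = false ∧ s.b = o} = 0 := by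
  refine le_antisymm ((prob_mono _ fun s hs => hs.1).trans
    ((prob_iterK_le_pow (S := {s : TState | s.flag = false}) (c := 1) (fun _ _ _ => prob_le_one _ _)
      (fun _ s hs => prob_round_of_flag P f lab (by simpa using hs)) t r st).2 ?_).le) zero_le
  simp [h]

/-- The evaluation of the decision tree at a random point behaves like a random decision tree that
does not depend on the point. -/
lemma exists_random_tree (hn : 0 < n) (r : ℕ) : ∀ (t : ℕ) (st : TState),
    ∃ τ : PMF (DecisionTree n), (∀ T ∈ τ.support, T.depth ≤ P.d * P.d - st.cnt) ∧
      ∀ x o, prob (iterK (fun _ => round P f lab x) t r st) {s | s.flag = false ∧ s.b = o} ≤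
        prob τ {T | T.eval x = o} + r * (31 / 32) ^ P.reps := by
  induction r with
  | zero =>
    intro t st
    refine ⟨PMF.pure (.leaf st.b), fun T hT => ?_, fun x o => ?_⟩
    · rw [PMF.support_pure, Set.mem_singleton_iff] at hT
      simp [hT, DecisionTree.depth]
    · rw [iterK]
      by_cases hb : st.b = o
      · rw [prob_pure_of_mem (a := DecisionTree.leaf st.b) (by simpa [DecisionTree.eval] using hb)]
        exact (prob_le_one _ _).trans le_self_add
      · rw [prob_pure_of_notMem (by simp [hb])]
        exact zero_le
  | succ r ih =>
    intro t st
    choose τ hτ hτ' using ih (t + 1)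
    choose I hI using exists_litTest_le hn
    set g : Cube n → Cube n → Cube n → Bool := fun U Z Y => deriv f lab st.ρ st.labels U Z
        (st.pivot P f lab U Z (st.val f lab U U 0)) (st.pivot P f lab U Z (st.val f lab U U 0)) Y
      with hg
    set s' : Cube n → Cube n → Bool → TState := fun U Z v =>
      st.push P (st.val f lab U U 0) (st.pivot P f lab U Z (st.val f lab U U 0)) v true with hs'
    -- The random tree makes the same choices of `U` and `Z` as the round, neither of which involves
    -- `x`. It then queries the coordinate belonging to `g U Z` and draws a subtree for each of the
    -- two answers. If the guard of `push` fails the run is flagged and does not count, so any leaf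
    -- serves.
    refine ⟨(unif n).bind fun U => (search (fun Z => st.val f lab U Z P.L) (st.val f lab U U 0)
      P.tries).bind fun o => match o with
      | none => τ ⟨commit st.ρ st.M, [], st.val f lab U U 0, st.cnt, st.flag⟩
      | some Z => if st.M.length < P.d ∧ st.cnt < P.d * P.d then
          (τ (s' U Z false)).bind fun T₀ => (τ (s' U Z true)).map fun T₁ => .node (I (g U Z)) T₀ T₁
        else PMF.pure (.leaf false), fun T hT => ?_, fun x o => ?_⟩
    · obtain ⟨U, -, hT⟩ := (PMF.mem_support_bind_iff _ _ _).1 hT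
      obtain ⟨q, -, hT⟩ := (PMF.mem_support_bind_iff _ _ _).1 hT
      cases q with
      | none =>
        have h := hτ ⟨commit st.ρ st.M, [], st.val f lab U U 0, st.cnt, st.flag⟩ T hT
        exact h
      | some Z =>
        dsimp only at hT
        split_ifs at hT with hc
        · obtain ⟨T₀, h₀, hT⟩ := (PMF.mem_support_bind_iff _ _ _).1 hT
          obtain ⟨T₁, h₁, rfl⟩ := (PMF.mem_support_map_iff _ _ _).1 hT
          have e₀ := hτ _ T₀ h₀
          have e₁ := hτ _ T₁ h₁
          have hcnt : ∀ v, (s' U Z v).cnt = st.cnt + 1 := fun v => by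
            simp only [hs', TState.push, if_pos hc]
          rw [hcnt] at e₀ e₁
          rw [DecisionTree.depth]
          have := hc.2
          omega
        · rw [PMF.support_pure, Set.mem_singleton_iff] at hT
          simp [hT, DecisionTree.depth]
    · rw [iterK, round, PMF.bind_bind]
      simp only [PMF.bind_bind]
      refine prob_bind_le_bind fun U => prob_bind_le_bind fun q => ?_
      have hr : ((r + 1 : ℕ) : ENNReal) * (31 / 32) ^ P.reps =
          r * (31 / 32) ^ P.reps + (31 / 32) ^ P.reps := by
        rw [Nat.cast_succ, add_mul, one_mul]
      cases q with
      | none =>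
        rw [PMF.pure_bind, hr, ← add_assoc]
        exact (hτ' _ x o).trans le_self_add
      | some Z =>
        rw [PMF.bind_map]
        have hflag : ∀ v, prob (iterK (fun _ => round P f lab x) (t + 1) r
            (st.push P (st.val f lab U U 0) (st.pivot P f lab U Z (st.val f lab U U 0)) v false))
            {s | s.flag = false ∧ s.b = o} = 0 := fun v =>
          prob_iterK_round_of_flag P f lab (TState.push_flag_of_not P st _ _ v) _ _ _
        have hδ : ∀ v, v ≠ x (I (g U Z)) → prob (litEval (g U Z) x P.reps) {(v, true)} ≤
            (31 / 32) ^ P.reps := fun v hv => prob_litEval_le (hI (g U Z) x v hv) P.reps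
        dsimp only
        split_ifs with hc
        · have htree : prob ((τ (s' U Z false)).bind fun T₀ => (τ (s' U Z true)).map fun T₁ =>
              DecisionTree.node (I (g U Z)) T₀ T₁) {T | T.eval x = o} =
              prob (τ (s' U Z (x (I (g U Z))))) {T | T.eval x = o} := by
            cases hx : x (I (g U Z))
            · have : ∀ T₀ : DecisionTree n, (fun T₁ => DecisionTree.node (I (g U Z)) T₀ T₁) ⁻¹'
                  {T | T.eval x = o} = {_T₁ | T₀.eval x = o} := by
                intro T₀
                ext T₁
                simp [DecisionTree.eval, hx]
              rw [prob_bind, prob, PMF.toOuterMeasure_apply]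
              refine tsum_congr fun T₀ => ?_
              rw [prob_map, this]
              by_cases h : T₀.eval x = o
              · simp [h, prob_univ]
              · simp [h, prob_empty]
            · have : ∀ T₀ : DecisionTree n, (fun T₁ => DecisionTree.node (I (g U Z)) T₀ T₁) ⁻¹'
                  {T | T.eval x = o} = {T₁ | T₁.eval x = o} := by
                intro T₀
                ext T₁
                simp [DecisionTree.eval, hx]
              simp only [prob_bind, prob_map, this]
              rw [ENNReal.tsum_mul_right, PMF.tsum_coe, one_mul]
          rw [htree, hr, ← add_assoc, add_comm _ ((31 / 32) ^ P.reps)]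
          -- The only loss in this round is a wrong value that passes all tests. A value that fails
          -- a test raises the flag, and the right value leads to the state for which the subtree
          -- was drawn.
          refine (prob_bind_le_add (A := {(!x (I (g U Z)), true)}) fun p hp => ?_).trans
            (add_le_add_left (hδ _ (by simp)) _)
          obtain ⟨v, ok⟩ := p
          cases ok
          · rw [Function.comp_apply, hflag]
            exact zero_le
          · have hv : v = x (I (g U Z)) := by simpa using hp
            subst hv
            exact hτ' _ x o
        · refine prob_bind_le fun p => ?_
          rw [Function.comp_apply, prob_iterK_round_of_flag]
          · exact zero_le
          · simp only [TState.push, if_neg hc]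

lemma prob_bind_le_of_support {μ : PMF α} {f : α → PMF β} {S : Set β} {c : ENNReal}
    (h : ∀ a ∈ μ.support, prob (f a) S ≤ c) : prob (μ.bind f) S ≤ c := by
  rw [prob_bind]
  calc ∑' a, μ a * prob (f a) S ≤ ∑' a, μ a * c := by
        refine ENNReal.tsum_le_tsum fun a => ?_
        by_cases ha : μ a = 0
        · simp [ha]
        · exact mul_le_mul_right (h a ((PMF.mem_support_iff _ _).2 ha)) _
    _ = c := by rw [ENNReal.tsum_mul_right, μ.tsum_coe, one_mul]

/-- The random tree is independent of the sample, so the order of the two draws can be exchanged;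
for each fixed tree the farness of `f` bounds the probability of agreement. -/
lemma prob_sampleTest_le (hn : 0 < n) {D : PMF (Cube n)} {ε : ℝ} (hε : 0 ≤ ε)
    (hfar : FarFromDepthDT D ε (P.d ^ 2) f) :
    prob (sampleTest P f lab D false) {false} ≤
      ENNReal.ofReal (1 - ε) + P.rounds * (31 / 32) ^ P.reps := by
  obtain ⟨τ, hτ, hτ'⟩ := exists_random_tree P f lab hn P.rounds 0 (TState.init false)
  have h1 : prob (sampleTest P f lab D false) {false} ≤
      prob (D.bind fun x => τ.map fun T => decide (T.eval x = f x)) {true} +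
        P.rounds * (31 / 32) ^ P.reps := by
    refine prob_bind_le_bind fun x => ?_
    rw [prob_map, prob_map]
    refine (prob_mono _ fun st hst => ?_).trans ((hτ' x (f x)).trans_eq ?_)
    · simpa using hst
    · congr 2
      ext T
      simp
  refine h1.trans (add_le_add_left ?_ _)
  have h2 : (D.bind fun x => τ.map fun T => decide (T.eval x = f x)) =
      τ.bind fun T => D.map fun x => decide (T.eval x = f x) := PMF.bind_comm _ _ _
  rw [h2]
  refine prob_bind_le_of_support fun T hT => ?_
  have h3 := hfar T.eval ⟨T, (hτ T hT).trans (by rw [pow_two]; exact Nat.sub_le _ _), fun _ => rfl⟩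
  have h4 := prob_add_compl D {x | T.eval x ≠ f x}
  rw [prob_map]
  have h5 : (fun x => decide (T.eval x = f x)) ⁻¹' {true} = {x | T.eval x ≠ f x}ᶜ := by
    ext x
    simp
  rw [h5, ENNReal.ofReal_sub _ hε, ENNReal.ofReal_one]
  refine ENNReal.le_sub_of_add_le_left (by simp) ?_
  rw [← h4]
  exact add_le_add_left h3.le _

/-- The reject flag is never cleared, and as long as it is down each sample is a fresh trial; hence
the power. No property of the labels is used. -/
lemma prob_tester_le (hn : 0 < n) {D : PMF (Cube n)} {ε : ℝ} (hε : 0 ≤ ε)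
    (hfar : FarFromDepthDT D ε (P.d ^ 2) f) (K samples : ℕ) :
    prob (tester P f K samples D) {true} ≤
      (ENNReal.ofReal (1 - ε) + P.rounds * (31 / 32) ^ P.reps) ^ samples := by
  refine prob_bind_le fun lab => ?_
  rw [prob_map]
  have h1 : (fun b => !b) ⁻¹' {true} = {false} := by ext b; simp
  rw [h1]
  refine (prob_iterK_le_pow (fun _ b hb => ?_) (fun _ b hb => ?_) 0 samples false).1
  · rw [Set.mem_singleton_iff.1 hb]
    exact prob_sampleTest_le P f lab hn hε hfar
  · have : b = true := by simpa using hb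
    subst this
    refine le_antisymm (prob_bind_le fun x => ?_) zero_le
    rw [prob_map]
    refine (prob_mono _ fun st hst => ?_).trans
      (prob_iterK_round_of_flag P f lab (x := x) (st := TState.init true) rfl 0 P.rounds (f x)).le
    simpa using hst

end DTTest
end

/-! ### Degrees and paths of decision trees -/

noncomputable section

namespace DTTest

variable {n : ℕ}

lemma diff_const {j : Fin n} {g : Cube n → Bool} (h : ∀ y y', g y = g y') (y : Cube n) :
    diff j g y = false := by
  rw [diff, h (Function.update y j false) (Function.update y j true), Bool.xor_self]

lemma IsDeg.const (b : Bool) (k : ℕ) : IsDeg k fun _ : Cube n => b := by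
  induction k generalizing b with
  | zero => exact fun _ _ => rfl
  | succ k ih =>
    intro j
    have : diff j (fun _ : Cube n => b) = fun _ => false := by ext y; simp [diff]
    rw [this]
    exact ih false

lemma IsDeg.xor {k : ℕ} {g h : Cube n → Bool} (hg : IsDeg k g) (hh : IsDeg k h) :
    IsDeg k fun y => xor (g y) (h y) := by
  induction k generalizing g h with
  | zero =>
    intro y y'
    simp only [hg y y', hh y y']
  | succ k ih =>
    intro j
    have : diff j (fun y => Bool.xor (g y) (h y)) = fun y => Bool.xor (diff j g y) (diff j h y) := by
      ext y
      simp only [diff]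
      cases g (Function.update y j false) <;> cases g (Function.update y j true) <;>
        cases h (Function.update y j false) <;> cases h (Function.update y j true) <;> rfl
    rw [this]
    exact ih (hg j) (hh j)

lemma IsDeg.update {k : ℕ} {g : Cube n → Bool} (hg : IsDeg k g) (i : Fin n) (b : Bool) :
    IsDeg k fun y => g (Function.update y i b) := by
  induction k generalizing g with
  | zero => exact fun y y' => hg _ _
  | succ k ih =>
    intro j
    by_cases hj : j = i
    · subst hj
      have : diff j (fun y => g (Function.update y j b)) = fun _ => false := by
        ext y; simp [diff]
      rw [this]
      exact IsDeg.const _ _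
    · have : diff j (fun y => g (Function.update y i b)) =
          fun y => diff j g (Function.update y i b) := by
        ext y
        simp only [diff, Function.update_comm hj]
      rw [this]
      exact ih (hg j)

/-- The derivative in direction `i` is a sum of restrictions of the two functions, and in any other
direction it is again a choice by `y i` between derivatives, so induction applies. -/
lemma IsDeg.mux {k : ℕ} {g h : Cube n → Bool} (hg : IsDeg k g) (hh : IsDeg k h) (i : Fin n) :
    IsDeg (k + 1) fun y => if y i then g y else h y := by
  have hi : diff i (fun y => if y i then g y else h y) = fun y =>
      Bool.xor (h (Function.update y i false)) (g (Function.update y i true)) := by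
    ext y
    simp [diff]
  have hj : ∀ j, j ≠ i → diff j (fun y => if y i then g y else h y) = fun y =>
      if y i then diff j g y else diff j h y := by
    intro j hj
    ext y
    simp only [diff, Function.update_of_ne (Ne.symm hj)]
    split_ifs <;> rfl
  induction k generalizing g h with
  | zero =>
    intro j
    by_cases hji : j = i
    · subst hji
      rw [hi]
      exact (hh.update j false).xor (hg.update j true)
    · rw [hj j hji]
      intro y y'
      simp [diff_const hg, diff_const hh]
  | succ k ih =>
    intro j
    by_cases hji : j = i
    · subst hji
      rw [hi]
      exact (hh.update j false).xor (hg.update j true)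
    · rw [hj j hji]
      refine ih (hg j) (hh j) ?_ ?_
      · ext y
        simp [diff]
      · intro j' hj'
        ext y
        simp only [diff, Function.update_of_ne (Ne.symm hj')]
        split_ifs <;> rfl

lemma IsDeg.succ {k : ℕ} {g : Cube n → Bool} (hg : IsDeg k g) : IsDeg (k + 1) g := by
  induction k generalizing g with
  | zero =>
    intro j y y'
    rw [diff_const hg, diff_const hg]
  | succ k ih => exact fun j => ih (hg j)

lemma IsDeg.mono {k k' : ℕ} {g : Cube n → Bool} (hg : IsDeg k g) (h : k ≤ k') : IsDeg k' g := by
  induction h with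
  | refl => exact hg
  | step _ ih => exact ih.succ

namespace DecisionTree

lemma isDeg (T : DecisionTree n) : IsDeg T.depth T.eval := by
  induction T with
  | leaf b => exact fun _ _ => rfl
  | node i l r hl hr =>
    exact IsDeg.mux (hr.mono (le_max_right _ _)) (hl.mono (le_max_left _ _)) i

/-- Rename the variables. -/
def relabel (lab : Fin n → Fin n) : DecisionTree n → DecisionTree n
  | leaf b => leaf b
  | node i l r => node (lab i) (l.relabel lab) (r.relabel lab)

lemma eval_relabel (lab : Fin n → Fin n) (T : DecisionTree n) (y : Cube n) :
    (T.relabel lab).eval y = T.eval fun i => y (lab i) := by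
  induction T with
  | leaf b => rfl
  | node i l r hl hr => simp only [relabel, eval, hl, hr]

lemma depth_relabel (lab : Fin n → Fin n) (T : DecisionTree n) :
    (T.relabel lab).depth = T.depth := by
  induction T with
  | leaf b => rfl
  | node i l r hl hr => simp only [relabel, depth, hl, hr]

/-- The variables that occur in a tree. -/
def vars : DecisionTree n → Finset (Fin n)
  | leaf _ => ∅
  | node i l r => insert i (l.vars ∪ r.vars)

lemma card_vars (T : DecisionTree n) : T.vars.card + 1 ≤ 2 ^ T.depth := by
  induction T with
  | leaf b => simp [vars, depth]
  | node i l r hl hr =>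
    have h1 := Finset.card_insert_le i (l.vars ∪ r.vars)
    have h2 := Finset.card_union_le l.vars r.vars
    have h3 : 2 ^ l.depth ≤ 2 ^ max l.depth r.depth :=
      Nat.pow_le_pow_right (by norm_num) (le_max_left _ _)
    have h4 : 2 ^ r.depth ≤ 2 ^ max l.depth r.depth :=
      Nat.pow_le_pow_right (by norm_num) (le_max_right _ _)
    rw [vars, depth, pow_succ]
    omega

lemma eval_congr (T : DecisionTree n) {y y' : Cube n} (h : ∀ i ∈ T.vars, y i = y' i) :
    T.eval y = T.eval y' := by
  induction T with
  | leaf b => rfl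
  | node i l r hl hr =>
    have h1 := h i (by simp [vars])
    simp only [eval, h1, hl fun i hi => h i (by simp [vars, hi]),
      hr fun i hi => h i (by simp [vars, hi])]

/-- The number of nodes on the path of `y` whose variable is in `S`. -/
def count (S : Fin n → Bool) : DecisionTree n → Cube n → ℕ
  | leaf _, _ => 0
  | node i l r, y => (if S i then 1 else 0) + if y i then r.count S y else l.count S y

lemma count_le_depth (S : Fin n → Bool) (T : DecisionTree n) (y : Cube n) :
    T.count S y ≤ T.depth := by
  induction T with
  | leaf b => simp [count]
  | node i l r hl hr =>
    have := le_max_left l.depth r.depth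
    have := le_max_right l.depth r.depth
    simp only [count, depth]
    split_ifs <;> omega

/-- Used for a commit: the labels of the monomial and those that stay free are disjoint sets of
labels that were free before. -/
lemma count_add_le {S S₁ S₂ : Fin n → Bool} (h₁ : ∀ i, S₁ i = true → S i = true)
    (h₂ : ∀ i, S₂ i = true → S i = true ∧ S₁ i = false) (T : DecisionTree n) (y : Cube n) :
    T.count S₁ y + T.count S₂ y ≤ T.count S y := by
  induction T with
  | leaf b => simp [count]
  | node i l r hl hr =>
    have : (if S₁ i then 1 else 0) + (if S₂ i then 1 else 0) ≤ if S i then 1 else 0 := by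
      have h1 := h₁ i
      have h2 := h₂ i
      cases e₁ : S₁ i <;> cases e₂ : S₂ i <;> simp_all
    simp only [count]
    split_ifs at this ⊢ <;> omega

/-- Changing coordinates that the path does not query leaves the path as it is. -/
lemma eval_eq_of_count {S : Fin n → Bool} (T : DecisionTree n) {y y' : Cube n}
    (h : T.count S y = 0) (hy : ∀ i, S i = false → y' i = y i) : T.eval y' = T.eval y := by
  induction T with
  | leaf b => rfl
  | node i l r hl hr =>
    simp only [count, Nat.add_eq_zero_iff] at h
    have hS : S i = false := by
      by_contra hc
      simp [hc] at h
    simp only [eval, hy i hS]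
    have h2 := h.2
    split_ifs at h2 ⊢
    · exact hr h2
    · exact hl h2

end DecisionTree

end DTTest
end

noncomputable section

namespace DTTest

variable {n : ℕ}

/-! ### Restrictions and derivatives on the labels -/

/-- The point `y` with some coordinates given by `ρ`. -/
def restrict (ρ : ℕ → Option Bool) (y : Cube n) : Cube n := fun l => (ρ l).getD (y l)

/-- The point that agrees with `Z` below `t`, and with `U` from there on. -/
def mix (U Z : Cube n) (t : ℕ) : Cube n := fun l => if (l : ℕ) < t then Z l else U l

/-- The derivative of `F` with respect to the coordinates in `M`, after fixing some coordinates. -/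
def dfun (F : Cube n → Bool) (ρ : ℕ → Option Bool) (M : List ℕ) (y : Cube n) : Bool :=
  xorBelow (fun c => F (restrict (assign ρ M c) y)) (2 ^ M.length)

lemma xorBelow_add (g : ℕ → Bool) (a b : ℕ) :
    xorBelow g (a + b) = xor (xorBelow g a) (xorBelow (fun c => g (a + c)) b) := by
  induction b with
  | zero => simp [xorBelow]
  | succ b ih => rw [← add_assoc, xorBelow, ih, xorBelow, Bool.xor_assoc]

lemma xorBelow_congr {g h : ℕ → Bool} {k : ℕ} (H : ∀ c < k, g c = h c) :
    xorBelow g k = xorBelow h k := by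
  induction k with
  | zero => rfl
  | succ k ih => rw [xorBelow, xorBelow, ih fun c hc => H c (by omega), H k (by omega)]

lemma xorBelow_const (b : Bool) {k : ℕ} (hk : k ≠ 0) : xorBelow (fun _ => b) (2 ^ k) = false := by
  obtain ⟨k, rfl⟩ := Nat.exists_eq_succ_of_ne_zero hk
  rw [pow_succ, mul_two, xorBelow_add, Bool.xor_self]

/-- Only the lowest digits are read, so the upper half of the range of `c` repeats the lower half
except for the label with the top digit. -/
lemma assign_add (ρ : ℕ → Option Bool) (M : List ℕ) (c : ℕ) :
    assign ρ M (2 ^ M.length + c) = assign ρ M c := by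
  induction M generalizing ρ c with
  | nil => rfl
  | cons j M ih =>
    have h1 : (2 ^ (M.length + 1) + c) % 2 = c % 2 := by rw [pow_succ]; omega
    have h2 : (2 ^ (M.length + 1) + c) / 2 = 2 ^ M.length + c / 2 := by rw [pow_succ]; omega
    simp only [assign, List.length_cons, h1, h2, ih]

lemma assign_of_notMem (ρ : ℕ → Option Bool) {M : List ℕ} {l : ℕ} (h : l ∉ M) (c : ℕ) :
    assign ρ M c l = ρ l := by
  induction M generalizing ρ c with
  | nil => rfl
  | cons j M ih =>
    simp only [List.mem_cons, not_or] at h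
    rw [assign, ih _ h.2, Function.update_of_ne h.1]

lemma restrict_update (ρ : ℕ → Option Bool) {j : Fin n} (hj : ρ j = none) (b : Bool) (y : Cube n) :
    restrict (Function.update ρ j (some b)) y = restrict ρ (Function.update y j b) := by
  ext l
  by_cases h : l = j
  · subst h; simp [restrict, hj]
  · simp [restrict, h, Fin.val_ne_of_ne h]

/-- The range of `c` is split by its top digit, which is the value given to the new label `j`. -/
lemma dfun_append (F : Cube n → Bool) {ρ : ℕ → Option Bool} {M : List ℕ} {j : Fin n}
    (hρ : ρ j = none) (hM : (j : ℕ) ∉ M) (y : Cube n) :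
    dfun F ρ (M ++ [(j : ℕ)]) y = diff j (dfun F ρ M) y := by
  have hnone : ∀ c, assign ρ M c j = none := fun c => (assign_of_notMem ρ hM c).trans hρ
  rw [dfun, List.length_append, List.length_singleton, pow_succ, mul_two, xorBelow_add, diff, dfun,
    dfun]
  congr 1
  · refine xorBelow_congr fun c hc => ?_
    rw [assign_append, Nat.div_eq_of_lt hc, restrict_update _ (hnone c)]
    rfl
  · refine xorBelow_congr fun c hc => ?_
    rw [assign_append, Nat.add_div_left _ (by positivity), Nat.div_eq_of_lt hc, assign_add,
      restrict_update _ (hnone c)]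
    rfl

lemma dfun_nil (F : Cube n → Bool) (ρ : ℕ → Option Bool) (y : Cube n) :
    dfun F ρ [] y = F (restrict ρ y) := by
  simp [dfun, xorBelow, assign]

/-- The derivative does not depend on coordinates that are fixed or in `M`. -/
lemma dfun_update (F : Cube n → Bool) {ρ : ℕ → Option Bool} {M : List ℕ} {j : Fin n}
    (h : (ρ j).isSome ∨ (j : ℕ) ∈ M) (y : Cube n) (b : Bool) :
    dfun F ρ M (Function.update y j b) = dfun F ρ M y := by
  refine xorBelow_congr fun c _ => congrArg F ?_
  ext l
  by_cases hl : l = j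
  · subst hl
    obtain ⟨v, hv⟩ := Option.isSome_iff_exists.1 ((assign_isSome ρ M c l).2 h)
    simp [restrict, hv]
  · simp [restrict, hl]

/-- If the restricted function is constant, then so are its derivatives. -/
lemma dfun_eq_of_const {F : Cube n → Bool} {ρ : ℕ → Option Bool} {M : List ℕ}
    (hF : ∀ y y', F (restrict ρ y) = F (restrict ρ y')) (hM : ∀ l ∈ M, ρ l = none)
    (y y₀ : Cube n) : dfun F ρ M y = xorBelow (fun _ => F (restrict ρ y₀)) (2 ^ M.length) := by
  refine xorBelow_congr fun c _ => ?_
  rw [← hF (restrict (assign ρ M c) y)]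
  congr 1
  ext l
  by_cases hl : (l : ℕ) ∈ M
  · simp [restrict, hM l hl]
  · simp only [restrict, assign_of_notMem ρ hl]
    cases ρ l <;> rfl

lemma commit_of_notMem (ρ : ℕ → Option Bool) {M : List (ℕ × Bool)} {l : ℕ}
    (h : l ∉ M.map Prod.fst) : commit ρ M l = ρ l := by
  induction M generalizing ρ with
  | nil => rfl
  | cons p M ih =>
    simp only [List.map_cons, List.mem_cons, not_or] at h
    rw [commit, ih _ h.2, Function.update_of_ne h.1]

lemma commit_eq_some {ρ : ℕ → Option Bool} {M : List (ℕ × Bool)} {l : ℕ} {v : Bool}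
    (h : commit ρ M l = some v) : ρ l = some v ∨ (l, v) ∈ M := by
  induction M generalizing ρ with
  | nil => exact Or.inl h
  | cons p M ih =>
    rcases ih h with h1 | h1
    · by_cases hl : l = p.1
      · subst hl
        simp only [Function.update_self, Option.some.injEq] at h1
        right
        simp [← h1]
      · rw [Function.update_of_ne hl] at h1
        exact Or.inl h1
    · exact Or.inr (List.mem_cons_of_mem _ h1)

/-- The coordinates are fixed one by one with `IsDeg.update`. -/
lemma IsDeg.restrict {k : ℕ} {F : Cube n → Bool} (h : IsDeg k F) (ρ : ℕ → Option Bool) :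
    IsDeg k fun y => F (restrict ρ y) := by
  classical
  have key : ∀ s : Finset (Fin n), IsDeg k fun y => F fun l => if l ∈ s then (ρ l).getD (y l)
      else y l := by
    intro s
    induction s using Finset.induction_on with
    | empty => simpa using h
    | insert j s hj ih =>
      cases hρ : ρ j with
      | none =>
        have : (fun y : Cube n => F fun l => if l ∈ insert j s then (ρ l).getD (y l) else y l) =
            fun y => F fun l => if l ∈ s then (ρ l).getD (y l) else y l := by
          ext y
          congr 1
          ext l
          by_cases hl : l = j
          · subst hl; simp [hρ]
          · simp [hl]
        rw [this]
        exact ih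
      | some b =>
        have : (fun y : Cube n => F fun l => if l ∈ insert j s then (ρ l).getD (y l) else y l) =
            fun y => (fun y => F fun l => if l ∈ s then (ρ l).getD (y l) else y l)
              (Function.update y j b) := by
          ext y
          dsimp only
          congr 1
          ext l
          by_cases hl : l = j
          · subst hl; simp [hρ, hj]
          · simp [hl]
        rw [this]
        exact ih.update j b
  have := key Finset.univ
  simp only [Finset.mem_univ, if_true] at this
  exact this

/-! ### Binary search -/

/-- The value at the left end is `b`, the value at the right end is not, and the length halves,
rounded up. Once the length is 1 further steps do not move the left end, so too many halvings do no
harm. -/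
lemma bisect_spec (φ : ℕ → Bool) (b : Bool) (h : ℕ) (p : ℕ × ℕ) (hp : p.1 < p.2)
    (hh : p.2 - p.1 ≤ 2 ^ h) (h1 : φ p.1 = b) (h2 : φ p.2 ≠ b) :
    φ ((bisect φ b)^[h] p).1 = b ∧ φ (((bisect φ b)^[h] p).1 + 1) ≠ b := by
  induction h generalizing p with
  | zero =>
    have : p.2 = p.1 + 1 := by simp at hh; omega
    rw [this] at h2
    exact ⟨h1, h2⟩
  | succ h ih =>
    rw [Function.iterate_succ_apply]
    have h2h : 1 ≤ 2 ^ h := Nat.one_le_two_pow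
    rw [pow_succ] at hh
    refine ih _ ?_ ?_ ?_ ?_ <;> unfold bisect <;> split_ifs with hc
    · rcases Nat.lt_or_ge ((p.1 + p.2) / 2) p.2 with h' | h'
      · exact h'
      · omega
    · have : (p.1 + p.2) / 2 ≠ p.1 := fun h' => hc (by rw [h']; exact h1)
      dsimp only
      omega
    · dsimp only
      omega
    · dsimp only
      omega
    · exact hc
    · exact h1
    · exact h2
    · exact hc

/-! ### Evaluation of literals -/

/-- A nonconstant function of one bit is the identity or the negation, and the negation cancels in
`g z + g (z + y)`. Thus the value is certain, and neither `i` nor the sign has to be known. -/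
lemma evalLin_of_literal {g : Cube n → Bool} {h : Bool → Bool} {i : Fin n}
    (hg : ∀ Y, g Y = h (Y i)) (hh : h false ≠ h true) (y : Cube n) :
    evalLin g y = PMF.pure (y i) := by
  have : (fun z : Cube n => xor (g z) (g fun i => xor (z i) (y i))) = Function.const _ (y i) := by
    ext z
    rw [hg, hg, Function.const_apply]
    cases h0 : h false <;> cases h1 : h true <;> simp_all <;> cases z i <;> cases y i <;> simp_all
  rw [evalLin, this, PMF.map_const]

lemma litEval_of_literal {g : Cube n → Bool} {h : Bool → Bool} {i : Fin n}
    (hg : ∀ Y, g Y = h (Y i)) (hh : h false ≠ h true) (x : Cube n) (reps : ℕ) :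
    litEval g x reps = PMF.pure (x i, true) := by
  have e := evalLin_of_literal hg hh
  have htest : litTest g x (x i) = PMF.pure true := by
    simp [litTest, e, PMF.pure_bind, PMF.pure_map]
  have hit : ∀ t r, iterK (fun _ ok => (litTest g x (x i)).map fun p => ok && p) t r true =
      PMF.pure true := by
    intro t r
    rw [htest]
    induction r generalizing t with
    | zero => rfl
    | succ r ih => rw [iterK, PMF.pure_map, PMF.pure_bind, Bool.and_true, ih]
  rw [litEval, e, PMF.pure_bind, hit, PMF.pure_map]

/-! ### Search -/

lemma search_of_const {φ : Cube n → Bool} {b : Bool} (h : ∀ z, φ z = b) (tries : ℕ) :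
    search φ b tries = PMF.pure none := by
  have : ∀ t r, iterK (fun _ (o : Option (Cube n)) => match o with
      | some z => PMF.pure (some z)
      | none => (unif n).map fun z => if φ z = b then none else some z) t r none =
      PMF.pure none := by
    intro t r
    induction r generalizing t with
    | zero => rfl
    | succ r ih =>
      rw [iterK]
      have : ((unif n).map fun z => if φ z = b then none else some z) = PMF.pure none := by
        simp only [h, if_true]
        exact PMF.map_const _ _
      exact (congrArg (fun μ => PMF.bind μ _) this).trans ((PMF.pure_bind _ _).trans (ih (t + 1)))
  exact this 0 tries

/-- All tries have to fail; a point that was returned never has the value `b`, which is the union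
bound with error 0. -/
lemma prob_search_le {φ : Cube n → Bool} {b : Bool} {c : ENNReal}
    (h : prob (unif n) {z | φ z = b} ≤ c) (tries : ℕ) :
    prob (search φ b tries) {o | ∀ z, o = some z → φ z = b} ≤ c ^ tries := by
  have h1 : prob (search φ b tries) {none} ≤ c ^ tries := by
    refine (prob_iterK_le_pow (fun _ o ho => ?_) (fun _ o ho => ?_) 0 tries none).1
    · rw [Set.mem_singleton_iff.1 ho, prob_map]
      refine (prob_mono _ fun z hz => ?_).trans h
      by_contra hc
      simp only [Set.mem_ofPred_eq] at hc
      simp [hc] at hz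
    · cases o with
      | none => simp at ho
      | some z => rw [prob_pure_of_notMem (by simp)]
  have h2 : prob (search φ b tries) {o | ∀ z, o = some z → φ z ≠ b}ᶜ ≤ tries * 0 := by
    refine prob_iterK_le (I := fun _ => {o | ∀ z, o = some z → φ z ≠ b}) (fun _ o ho => ?_) 0 tries
      (by simp)
    cases o with
    | none =>
      dsimp only
      rw [prob_map]
      refine (prob_mono _ (S' := ∅) fun z hz => ?_).trans (prob_empty _).le
      refine (hz fun z' hz' => ?_).elim
      dsimp only at hz'
      split_ifs at hz' with hc
      cases hz'
      exact hc
    | some z =>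
      dsimp only
      rw [prob_pure_of_notMem (by simpa using ho)]
  rw [mul_zero] at h2
  refine (prob_mono _ (S' := {none} ∪ {o | ∀ z, o = some z → φ z ≠ b}ᶜ) fun o ho => ?_).trans
    ((prob_union_le _ _ _).trans ((add_le_add h1 h2).trans_eq (add_zero _)))
  cases o with
  | none => exact Or.inl rfl
  | some z => exact Or.inr fun hc => hc z rfl (ho z rfl)

end DTTest
end

/-! ### The invariant of an evaluation -/

noncomputable section

namespace DTTest

variable {n : ℕ}

/-- The coordinates that are not fixed by `ρ`. -/
def free (ρ : ℕ → Option Bool) : Fin n → Bool := fun l => (ρ l).isNone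

/-- What holds after `t` successful rounds of the evaluation at the point `x` of the decision
tree `T` of depth at most `d`. -/
structure Inv (T : DecisionTree n) (x : Cube n) (d t : ℕ) (st : TState) : Prop where
  flag : st.flag = false
  rho : ∀ (l : Fin n) v, st.ρ l = some v → v = x l
  mono : ∀ p ∈ st.M, ∃ l : Fin n, p.1 = l ∧ p.2 = x l
  fresh : ∀ l ∈ st.labels, st.ρ l = none
  len : st.M.length ≤ d
  deg : IsDeg (d - st.M.length) (dfun T.eval st.ρ st.labels)
  nz : st.M ≠ [] → ∃ y, dfun T.eval st.ρ st.labels y = true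
  -- Here `k` counts the commits of nonempty monomials, each of which shortens every path. As long
  -- as `cnt + k = t`, every round was a push or such a commit; otherwise the restricted tree is
  -- already constant and the rounds are idle.
  prog : ∃ k, (∀ y, T.count (free st.ρ) (restrict st.ρ y) + k ≤ d) ∧
    st.cnt ≤ k * d + st.M.length ∧
    (st.cnt + k = t ∨ st.M = [] ∧ ∀ y y', T.eval (restrict st.ρ y) = T.eval (restrict st.ρ y'))

variable {T : DecisionTree n} {x : Cube n} {d t : ℕ} {st : TState}

lemma restrict_const_of_count (ρ : ℕ → Option Bool)
    (h : ∀ y, T.count (free ρ) (restrict ρ y) = 0) (y y' : Cube n) :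
    T.eval (restrict ρ y) = T.eval (restrict ρ y') := by
  refine T.eval_eq_of_count (h y') fun i hi => ?_
  obtain ⟨v, hv⟩ := Option.isSome_iff_exists.1 (by simpa [free] using hi : (ρ i).isSome)
  simp [restrict, hv]

lemma Inv.init (hT : T.depth ≤ d) : Inv T x d 0 (TState.init false) where
  flag := rfl
  rho := by simp [TState.init]
  mono := by simp [TState.init]
  fresh := by simp [TState.init]
  len := Nat.zero_le _
  deg := by
    have : dfun T.eval (TState.init false).ρ (TState.init false).labels =
        fun y => T.eval (restrict (TState.init false).ρ y) := funext fun y => dfun_nil _ _ _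
    rw [this]
    exact (T.isDeg.mono hT).restrict _
  nz := fun h => absurd rfl h
  prog := ⟨0, fun y => (T.count_le_depth _ _).trans hT, Nat.zero_le _, Or.inl rfl⟩

/-- If the restricted function is constant, then the monomial is empty. -/
lemma Inv.nil_of_const (h : Inv T x d t st)
    (hc : ∀ y y', T.eval (restrict st.ρ y) = T.eval (restrict st.ρ y')) : st.M = [] := by
  by_contra hM
  obtain ⟨y, hy⟩ := h.nz hM
  rw [dfun_eq_of_const hc h.fresh y y, xorBelow_const _ (by simpa using hM)] at hy
  exact absurd hy (by simp)

/-- At the end, the restricted function is constant. -/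
lemma Inv.const_of_le (h : Inv T x d t st) (ht : d * d + d ≤ t) (y y' : Cube n) :
    T.eval (restrict st.ρ y) = T.eval (restrict st.ρ y') := by
  obtain ⟨k, hk, hcnt, h' | h'⟩ := h.prog
  · have hkd : k ≤ d := (Nat.le_add_left _ _).trans (hk y)
    -- If `k < d`, then `t = cnt + k ≤ (k + 1) * d + k`, which is less than `d * d + d`. If `k = d`,
    -- no path queries a free label any more.
    rcases hkd.lt_or_eq with hlt | rfl
    · have h1 : (k + 1) * d ≤ d * d := Nat.mul_le_mul_right _ hlt
      have h2 := h.len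
      rw [add_mul, one_mul] at h1
      omega
    · refine restrict_const_of_count _ (fun z => ?_) y y'
      have := hk z
      omega
  · exact h'.2 y y'

lemma Inv.restrict_self (h : Inv T x d t st) : restrict st.ρ x = x := by
  ext l
  cases hl : st.ρ l with
  | none => simp [restrict, hl]
  | some v => simp [restrict, hl, h.rho l v hl]

/-- The state after adding the monomial to the partial assignment. -/
lemma Inv.commit (h : Inv T x d t st) (hT : T.depth ≤ d) (b : Bool)
    (hc : ∀ y y', dfun T.eval st.ρ st.labels y = dfun T.eval st.ρ st.labels y') :
    Inv T x d (t + 1) ⟨commit st.ρ st.M, [], b, st.cnt, st.flag⟩ := by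
  have hdeg : IsDeg d (dfun T.eval (DTTest.commit st.ρ st.M) []) := by
    have : dfun T.eval (DTTest.commit st.ρ st.M) [] =
        fun y => T.eval (restrict (DTTest.commit st.ρ st.M) y) := funext fun y => dfun_nil _ _ _
    rw [this]
    exact (T.isDeg.mono hT).restrict _
  refine ⟨h.flag, fun l v hv => ?_, by simp, by simp, Nat.zero_le _, hdeg, fun h => absurd rfl h, ?_⟩
  · rcases commit_eq_some hv with h1 | h1
    · exact h.rho l v h1
    · obtain ⟨l', h2, h3⟩ := h.mono _ h1
      dsimp only at h2 h3
      rw [h3, Fin.ext h2]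
  obtain ⟨k, hk, hcnt, hprog⟩ := h.prog
  -- With an empty monomial the constant derivative is the restricted function itself, and the round
  -- is idle.
  by_cases hM : st.M = []
  · have hlab : st.labels = [] := by simp [hM]
    rw [hlab] at hc
    simp only [dfun_nil] at hc
    refine ⟨k, ?_, ?_, Or.inr ⟨rfl, ?_⟩⟩
    · simpa [hM, DTTest.commit] using hk
    · simpa [hM] using hcnt
    · simpa [hM, DTTest.commit] using hc
  · obtain ⟨y₀, hy₀⟩ := h.nz hM
    refine ⟨k + 1, fun y => ?_, ?_, ?_⟩
    · dsimp only
      set z := restrict (DTTest.commit st.ρ st.M) y with hz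
      have hdom : ∀ l : Fin n, (DTTest.commit st.ρ st.M l).isNone = true →
          (st.ρ l).isNone = true ∧ (l : ℕ) ∉ st.labels := by
        intro l hl
        have := commit_isSome st.ρ st.M l
        rw [Option.isNone_iff_eq_none] at hl ⊢
        rw [hl] at this
        simpa using this
      have hρ : ∀ l : Fin n, ∀ v, st.ρ l = some v → z l = v := by
        intro l v hv
        have : (l : ℕ) ∉ st.M.map Prod.fst := fun hl => by
          have := h.fresh _ hl
          rw [hv] at this
          cases this
        simp [hz, restrict, commit_of_notMem _ this, hv]
      have hz' : restrict st.ρ z = z := by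
        ext l
        cases hl : st.ρ l with
        | none => simp [restrict, hl]
        | some v => simp [restrict, hl, hρ l v hl]
      have h1 := hk z
      rw [hz'] at h1
      have h2 := T.count_add_le (S := free st.ρ) (S₁ := free (DTTest.commit st.ρ st.M))
        (S₂ := fun l => decide ((l : ℕ) ∈ st.labels)) (fun l hl => (hdom l hl).1)
        (fun l hl => by
          have hl' : (l : ℕ) ∈ st.labels := by simpa using hl
          refine ⟨by simp [free, h.fresh _ hl'], ?_⟩
          by_contra hcon
          exact (hdom l (by simpa [free] using hcon)).2 hl') z
      -- If the path of `z` avoided `M`, all values of the labels in `M` would give the same result,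
      -- and the derivative at `z` would be a sum of an even number of equal terms. But it is
      -- constantly 1.
      have h3 : T.count (fun l => decide ((l : ℕ) ∈ st.labels)) z ≠ 0 := by
        intro h0
        have h4 : dfun T.eval st.ρ st.labels z = xorBelow (fun _ => T.eval z)
            (2 ^ st.labels.length) := by
          refine xorBelow_congr fun c _ => T.eval_eq_of_count h0 fun l hl => ?_
          have hl' : (l : ℕ) ∉ st.labels := by simpa using hl
          rw [restrict, assign_of_notMem _ hl']
          cases hv : st.ρ l with
          | none => rfl
          | some v => simp [hρ l v hv]
        rw [xorBelow_const _ (by simpa using hM), hc z y₀, hy₀] at h4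
        exact absurd h4 (by simp)
      omega
    · have := h.len
      dsimp only
      rw [add_mul, one_mul]
      omega
    · rcases hprog with h1 | h1
      · left
        dsimp only
        omega
      · exact absurd h1.1 hM

/-- The state after adding a variable to the monomial. -/
lemma Inv.push (h : Inv T x d t st) (P : Params) (hP : P.d = d) (b : Bool) (j : Fin n) {y : Cube n}
    {c : Bool} (hj : dfun T.eval st.ρ st.labels (Function.update y j c) ≠
      dfun T.eval st.ρ st.labels y) :
    Inv T x d (t + 1) (st.push P b j (x j) true) := by
  have hρ : st.ρ j = none := by
    by_contra hc
    exact hj (dfun_update _ (Or.inl (Option.isSome_iff_ne_none.2 hc)) _ _)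
  have hM : (j : ℕ) ∉ st.labels := fun hc => hj (dfun_update _ (Or.inr hc) _ _)
  obtain ⟨k, hk, hcnt, hprog⟩ := h.prog
  have hnc : ¬ ∀ y y', T.eval (restrict st.ρ y) = T.eval (restrict st.ρ y') := by
    intro hc
    apply hj
    rw [dfun_eq_of_const hc h.fresh _ y, dfun_eq_of_const hc h.fresh y y]
  have hkd : k < d := by
    by_contra hkd
    refine hnc (restrict_const_of_count _ fun z => ?_)
    have := hk z
    omega
  have hdeg := h.deg
  -- A derivative that is not constant has positive degree, so the monomial still has room. Together
  -- with `k < d` this gives `cnt < (k + 1) * d ≤ d * d` below.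
  obtain ⟨e, he⟩ : ∃ e, d - st.M.length = e + 1 := by
    refine Nat.exists_eq_succ_of_ne_zero fun h0 => ?_
    rw [h0] at hdeg
    exact hj (hdeg _ _)
  have hlen : st.M.length < d := by omega
  have hsq : st.cnt < d * d := by
    have h1 : (k + 1) * d ≤ d * d := Nat.mul_le_mul_right _ hkd
    rw [add_mul, one_mul] at h1
    omega
  have happ : dfun T.eval st.ρ (st.labels ++ [(j : ℕ)]) = diff j (dfun T.eval st.ρ st.labels) :=
    funext fun z => dfun_append _ hρ hM z
  have hst : st.push P b j (x j) true = ⟨st.ρ, st.M ++ [((j : ℕ), x j)], b, st.cnt + 1, false⟩ := by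
    subst hP
    rw [TState.push, if_pos ⟨hlen, hsq⟩, h.flag]
    rfl
  have hlab : (TState.mk st.ρ (st.M ++ [((j : ℕ), x j)]) b (st.cnt + 1) false).labels =
      st.labels ++ [(j : ℕ)] := by simp [TState.labels]
  rw [hst]
  refine ⟨rfl, h.rho, fun p hp => ?_, fun l hl => ?_, by simpa using hlen, ?_, fun _ => ⟨y, ?_⟩,
    k, hk, ?_, ?_⟩
  · rcases List.mem_append.1 hp with h1 | h1
    · exact h.mono p h1
    · rw [List.mem_singleton.1 h1]
      exact ⟨j, rfl, rfl⟩
  · rw [hlab] at hl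
    rcases List.mem_append.1 hl with h1 | h1
    · exact h.fresh l h1
    · rw [List.mem_singleton.1 h1]
      exact hρ
  · rw [hlab]
    dsimp only
    rw [happ]
    rw [he] at hdeg
    have : d - (st.M ++ [((j : ℕ), x j)]).length = e := by simp; omega
    rw [this]
    exact hdeg j
  · rw [hlab]
    dsimp only
    rw [happ, diff]
    have h2 : Function.update y j (y j) = y := Function.update_eq_self j y
    by_cases hcy : c = y j
    · rw [hcy, h2] at hj
      exact absurd rfl hj
    · cases hb : y j <;> rw [hb] at h2 <;> cases c <;> simp [hb] at hcy <;> rw [h2] <;>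
        revert hj <;> generalize dfun T.eval st.ρ st.labels y = a <;>
        generalize dfun T.eval st.ρ st.labels _ = a' <;> revert a a' <;> decide
  · simp only [List.length_append, List.length_singleton]
    omega
  · rcases hprog with h1 | h1
    · left
      dsimp only
      omega
    · exact absurd h1.2 hnc

/-- `sel` chooses for each label the variable with this label on which the tree depends. -/
def Selects (T₀ : DecisionTree n) (lab sel : Fin n → Fin n) : Prop :=
  ∀ i ∈ T₀.vars, sel (lab i) = i

variable {T₀ : DecisionTree n} {lab sel : Fin n → Fin n}

lemma TState.val_eq (st : TState) (U Z : Cube n) (t : ℕ) :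
    st.val T₀.eval lab U Z t = dfun (T₀.relabel lab).eval st.ρ st.labels (mix U Z t) := by
  refine xorBelow_congr fun c _ => ?_
  rw [T₀.eval_relabel]
  congr 1
  ext i
  simp only [hybrid, restrict, mix, if_neg (lab i).2.ne]

lemma mix_zero (U Z : Cube n) : mix U Z 0 = U := by
  ext l; simp [mix]

lemma mix_succ (U Z : Cube n) (j : Fin n) :
    mix U Z (j + 1) = Function.update (mix U Z j) j (Z j) := by
  ext l
  by_cases hl : l = j
  · subst hl; simp [mix]
  · have : (l : ℕ) ≠ j := Fin.val_ne_of_ne hl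
    simp only [mix, Function.update_of_ne hl]
    congr 1
    simp only [eq_iff_iff]
    omega

lemma dfun_mix (st : TState) {L : ℕ} (hL : ∀ i, (lab i : ℕ) < L) (U Z : Cube n) :
    dfun (T₀.relabel lab).eval st.ρ st.labels (mix U Z L) =
      dfun (T₀.relabel lab).eval st.ρ st.labels Z := by
  refine xorBelow_congr fun c _ => ?_
  rw [T₀.eval_relabel, T₀.eval_relabel]
  congr 1
  ext i
  simp [restrict, mix, hL i]

/-- The derivative restricted to a block depends only on the selected variable of this block. -/
lemma deriv_eq (hsel : Selects T₀ lab sel) {ρ : ℕ → Option Bool} {M : List ℕ} {j : Fin n}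
    (hρ : ρ j = none) (hM : (j : ℕ) ∉ M) (U Z Y : Cube n) :
    deriv T₀.eval lab ρ M U Z j j Y = dfun (T₀.relabel lab).eval ρ M
      (Function.update (mix U Z j) j (Y (sel j))) := by
  refine xorBelow_congr fun c _ => ?_
  rw [T₀.eval_relabel]
  refine T₀.eval_congr fun i hi => ?_
  by_cases h : lab i = j
  · have : assign ρ M c j = none := (assign_of_notMem ρ hM c).trans hρ
    have hs := hsel i hi
    rw [h] at hs
    simp [hybrid, restrict, h, this, hs]
  · have : (lab i : ℕ) ≠ j := Fin.val_ne_of_ne h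
    simp [hybrid, restrict, mix, h, this]

/-- A round can go wrong only if the derivative is not constant and all tries of the search miss
this. Everything else is certain, since the literal is an exact one. -/
lemma prob_round_le {P : Params} (hsel : Selects T₀ lab sel) (hT : T₀.depth ≤ P.d)
    (hL : ∀ i, (lab i : ℕ) < P.L) (hL0 : 0 < P.L) (hLn : P.L ≤ n) (hh : P.L ≤ 2 ^ P.halvings)
    (x : Cube n) (h : Inv (T₀.relabel lab) (fun l => x (sel l)) P.d t st) :
    prob (round P T₀.eval lab x st) {s | Inv (T₀.relabel lab) (fun l => x (sel l)) P.d (t + 1) s ∧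
      (P.d * P.d + P.d ≤ t → s.b = T₀.eval x)}ᶜ ≤ (1 - (2 ^ P.d)⁻¹) ^ P.tries := by
  set T := T₀.relabel lab with hTdef
  have hT' : T.depth ≤ P.d := by rwa [hTdef, T₀.depth_relabel]
  set G := dfun T.eval st.ρ st.labels with hG
  have hval : ∀ U Z t, st.val T₀.eval lab U Z t = G (mix U Z t) := fun U Z t => st.val_eq U Z t
  have hval0 : ∀ U, st.val T₀.eval lab U U 0 = G U := fun U => by rw [hval, mix_zero]
  have hvalL : ∀ U, (fun Z => st.val T₀.eval lab U Z P.L) = G := fun U => funext fun Z => by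
    rw [hval, hG, dfun_mix st hL]
  have hx : T.eval (fun l => x (sel l)) = T₀.eval x := by
    rw [hTdef, T₀.eval_relabel]
    exact T₀.eval_congr fun i hi => by rw [hsel i hi]
  refine prob_bind_le fun U => ?_
  rw [hval0, hvalL]
  by_cases hc : ∀ y y', G y = G y'
  · rw [search_of_const (fun z => hc z U), PMF.pure_bind]
    dsimp only
    rw [prob_pure_of_notMem]
    · exact zero_le
    · rw [Set.mem_compl_iff, not_not]
      refine ⟨h.commit hT' _ hc, fun ht => ?_⟩
      -- After `d * d + d` rounds the restricted tree is constant and the monomial is empty, so the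
      -- bit read at `U` is also the value at the sample.
      have h1 := h.const_of_le ht
      have h2 := h.nil_of_const h1
      have h3 : st.labels = [] := by simp [h2]
      dsimp only
      rw [hG, h3, dfun_nil, h1 U fun l => x (sel l), h.restrict_self, hx]
  · have hnt : ¬ P.d * P.d + P.d ≤ t := fun ht => hc fun y y' => by
      have h1 := h.const_of_le ht
      rw [hG, dfun_eq_of_const h1 h.fresh y y, dfun_eq_of_const h1 h.fresh y' y]
    have hsearch : prob (unif n) {z | G z = G U} ≤ 1 - (2 ^ P.d)⁻¹ := by
      obtain ⟨z, hz⟩ : ∃ z, G z ≠ G U := by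
        by_contra hcon
        push Not at hcon
        exact hc fun y y' => (hcon y).trans (hcon y').symm
      have h1 := (h.deg.mono (Nat.sub_le _ _)).le_prob hz
      have h2 := prob_add_compl (unif n) {z | G z = G U}
      refine ENNReal.le_sub_of_add_le_right (by simp) ?_
      rw [← h2]
      exact add_le_add_right h1 _
    refine (prob_bind_le_add (A := {o | ∀ z, o = some z → G z = G U}) (c := 0) fun o ho => ?_).trans
      ((add_zero _).trans_le (prob_search_le hsearch _))
    cases o with
    | none => exact absurd (fun z hz => by cases hz) ho
    | some Z =>
      have hZ : G Z ≠ G U := fun hcon => ho fun z hz => by cases hz; exact hcon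
      dsimp only
      set j := st.pivot P T₀.eval lab U Z (G U) with hj
      -- Setting the coordinate `j` of a hybrid to its value in `Z` changes the derivative. So this
      -- label is neither fixed nor in the monomial, and it is a legitimate new variable.
      have hjL : j < P.L := (bisect_iterate_bounds _ _ hL0 _).1
      obtain ⟨h1, h2⟩ := bisect_spec (st.val T₀.eval lab U Z) (G U) P.halvings (0, P.L) hL0
        (by simpa using hh) (by rw [hval, mix_zero])
        (by
          have := congrFun (hvalL U) Z
          dsimp only at this ⊢
          rwa [this])
      change st.val T₀.eval lab U Z j = G U at h1
      change st.val T₀.eval lab U Z (j + 1) ≠ G U at h2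
      obtain ⟨j', hj'⟩ : ∃ j' : Fin n, (j' : ℕ) = j := ⟨⟨j, hjL.trans_le hLn⟩, rfl⟩
      rw [← hj'] at h1 h2 ⊢
      rw [hval] at h1 h2
      rw [mix_succ, ← h1] at h2
      have hρ : st.ρ j' = none := by
        by_contra hcon
        exact h2 (dfun_update _ (Or.inl (Option.isSome_iff_ne_none.2 hcon)) _ _)
      have hM : (j' : ℕ) ∉ st.labels := fun hcon => h2 (dfun_update _ (Or.inr hcon) _ _)
      -- As a function of the block the derivative only sees the selected variable, and it is not
      -- constant in it by the choice of the pivot.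
      rw [litEval_of_literal (h := fun b => G (Function.update (mix U Z j') j' b)) (i := sel j')
        (fun Y => deriv_eq hsel hρ hM U Z Y), PMF.pure_map, prob_pure_of_notMem]
      · rw [Set.mem_compl_iff, not_not]
        exact ⟨h.push P rfl _ j' h2, fun ht => absurd ht hnt⟩
      · intro hcon
        apply h2
        have e : G (mix U Z j') = G (Function.update (mix U Z j') j' (mix U Z j' j')) := by
          rw [Function.update_eq_self]
        rw [e]
        cases Z j' <;> cases mix U Z j' j' <;> simp_all

end DTTest
end

/-! ### Completeness: depth-`d` trees are accepted -/

noncomputable section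

namespace DTTest

variable {n : ℕ} {T₀ : DecisionTree n} {lab sel : Fin n → Fin n} {P : Params}

lemma prob_sampleTest_true_le (hsel : Selects T₀ lab sel) (hT : T₀.depth ≤ P.d)
    (hL : ∀ i, (lab i : ℕ) < P.L) (hL0 : 0 < P.L) (hLn : P.L ≤ n) (hh : P.L ≤ 2 ^ P.halvings)
    (hR : P.rounds = P.d * P.d + P.d + 1) (D : PMF (Cube n)) :
    prob (sampleTest P T₀.eval lab D false) {true} ≤
      P.rounds * (1 - (2 ^ P.d)⁻¹) ^ P.tries := by
  refine prob_bind_le fun x => ?_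
  rw [prob_map]
  -- The bit is right after the round that starts with `d * d + d` rounds behind it, hence the
  -- strict inequality in the invariant and the one extra round in `hR`.
  refine (prob_mono _ fun st hst => ?_).trans (prob_iterK_le (I := fun t =>
    {s | Inv (T₀.relabel lab) (fun l => x (sel l)) P.d t s ∧
      (P.d * P.d + P.d < t → s.b = T₀.eval x)}) (fun t st hst => ?_) 0 P.rounds ?_)
  · intro ⟨h1, h2⟩
    rw [Set.mem_preimage, h1.flag, h2 (by omega)] at hst
    simp at hst
  · refine (prob_mono _ ?_).trans (prob_round_le hsel hT hL hL0 hLn hh x hst.1)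
    exact fun s hs hcon => hs ⟨hcon.1, fun ht => hcon.2 (by omega)⟩
  · exact ⟨Inv.init (by rwa [T₀.depth_relabel]), fun h => absurd h (by omega)⟩

/-! ### Random labels -/

lemma prob_biUnion_le {α ι : Type} (μ : PMF α) (s : Finset ι) (S : ι → Set α) {c : ENNReal}
    (h : ∀ i ∈ s, prob μ (S i) ≤ c) : prob μ (⋃ i ∈ s, S i) ≤ s.card * c := by
  refine (MeasureTheory.measure_biUnion_finset_le s S).trans ?_
  rw [← nsmul_eq_mul]
  exact Finset.sum_le_card_nsmul _ _ _ h

/-- Resample the coordinate `i` independently: it hits the value at `i'` with the probability of a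
single element. -/
lemma prob_eq_le {ι β : Type} [Fintype ι] [DecidableEq ι] [Fintype β] [Nonempty β] {i i' : ι}
    (h : i ≠ i') : prob (PMF.uniformOfFintype (ι → β)) {u | u i = u i'} ≤
      (Fintype.card β : ENNReal)⁻¹ := by
  have h1 : PMF.uniformOfFintype (ι → β) = (PMF.uniformOfFintype (ι → β)).bind fun u =>
      (PMF.uniformOfFintype β).map fun b => Function.update u i b :=
    (uniform_update i).symm.trans (PMF.bind_comm _ _ _)
  rw [h1]
  refine prob_bind_le fun u => ?_
  rw [prob_map]
  have h2 : (fun b => Function.update u i b) ⁻¹' {u | u i = u i'} = {u i'} := by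
    ext b
    simp [Function.update_of_ne h.symm]
  rw [h2, prob_singleton, PMF.uniformOfFintype_apply]

lemma encode_injective {K : ℕ} {u u' : Cube K} (h : encode u K = encode u' K) : u = u' := by
  have key : ∀ t ≤ K, encode u t = encode u' t → ∀ i : Fin K, (i : ℕ) < t → u i = u' i := by
    intro t
    induction t with
    | zero => exact fun _ _ i hi => absurd hi (by omega)
    | succ t ih =>
      intro ht he i hi
      have ht' : t < K := ht
      rw [encode, encode, dif_pos ht', dif_pos ht'] at he
      have h1 := (u ⟨t, ht⟩).toNat_le
      have h2 := (u' ⟨t, ht⟩).toNat_le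
      rcases Nat.lt_succ_iff_lt_or_eq.1 hi with h3 | h3
      · exact ih (by omega) (by omega) i h3
      · have : i = ⟨t, ht⟩ := Fin.ext h3
        rw [this]
        exact toNat_injective (by omega)
  ext i
  rw [key K le_rfl h i i.2]

/-- Labels that are bounded, and distinct on the variables on which the tree depends. -/
def GoodLabels (T₀ : DecisionTree n) (L : ℕ) : Set (Fin n → Fin n) :=
  {lab | (∃ sel, Selects T₀ lab sel) ∧ ∀ i, (lab i : ℕ) < L}

lemma exists_selects (h : Set.InjOn lab T₀.vars) : ∃ sel, Selects T₀ lab sel := by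
  rcases isEmpty_or_nonempty (Fin n) with h' | h'
  · exact ⟨id, fun i => isEmptyElim i⟩
  · exact ⟨Function.invFunOn lab T₀.vars, fun i hi => h.leftInvOn_invFunOn hi⟩

/-- The birthday bound: at most `4 ^ d` ordered pairs of variables of the tree, each colliding with
probability `1 / (8 * 4 ^ d)`. With few variables the labels are the identity and nothing can fail.
-/
lemma prob_randomLabels_le {d K : ℕ} (hT : T₀.depth ≤ d) (hK : K = 2 * d + 3) :
    prob (randomLabels n K) (GoodLabels T₀ (min n (2 ^ K)))ᶜ ≤ 8⁻¹ := by
  unfold randomLabels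
  split_ifs with h
  · rw [prob_map, min_eq_right h.le]
    have hsub : (fun (u : Fin n → Cube K) (i : Fin n) =>
        (⟨encode (u i) K, (encode_lt _ _).trans h⟩ : Fin n)) ⁻¹' (GoodLabels T₀ (2 ^ K))ᶜ ⊆
        ⋃ p ∈ T₀.vars.offDiag, {u : Fin n → Cube K | u p.1 = u p.2} := by
      intro u hu
      by_contra hc
      refine hu ⟨exists_selects fun i hi i' hi' he => ?_, fun i => encode_lt _ _⟩
      by_contra hne
      refine hc ?_
      simp only [Set.mem_iUnion]
      refine ⟨(i, i'), Finset.mem_offDiag.2 ⟨hi, hi', hne⟩, ?_⟩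
      exact encode_injective (by simpa using he)
    refine (prob_mono _ hsub).trans ((prob_biUnion_le _ _ _ fun p hp => prob_eq_le
      (Finset.mem_offDiag.1 hp).2.2).trans ?_)
    have h1 : T₀.vars.offDiag.card ≤ 2 ^ (2 * d) := by
      rw [Finset.offDiag_card]
      have h2 := T₀.card_vars
      have h3 : 2 ^ T₀.depth ≤ 2 ^ d := Nat.pow_le_pow_right (by norm_num) hT
      have h4 : T₀.vars.card * T₀.vars.card ≤ 2 ^ d * 2 ^ d := Nat.mul_le_mul (by omega) (by omega)
      rw [two_mul, pow_add]
      omega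
    have h2 : Fintype.card (Cube K) = 2 ^ (2 * d) * 8 := by
      simp [hK, pow_add]
    rw [h2, Nat.cast_mul, ENNReal.mul_inv (by simp) (by simp), ← mul_assoc]
    refine mul_le_of_le_one_left' ?_
    rw [← div_eq_mul_inv]
    exact ENNReal.div_le_of_le_mul (by rw [one_mul]; exact_mod_cast h1)
  · rw [prob_pure_of_notMem]
    · exact zero_le
    · rw [Set.mem_compl_iff, not_not]
      exact ⟨⟨id, fun i _ => rfl⟩, fun i => lt_min i.2 (i.2.trans_le (not_lt.1 h))⟩

lemma prob_tester_false_le {d m : ℕ} (hn : 0 < n) (hT : T₀.depth ≤ d) (D : PMF (Cube n)) :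
    prob (tester (params n d m) T₀.eval (2 * d + 3) (4 * m) D) {false} ≤
      8⁻¹ + (4 * m : ℕ) * ((d * d + d + 1 : ℕ) * (1 - (2 ^ d)⁻¹) ^ (2 ^ d * kappa d m)) := by
  refine (prob_bind_le_add (A := (GoodLabels T₀ (min n (2 ^ (2 * d + 3))))ᶜ) fun lab hlab => ?_).trans
    (add_le_add_left (prob_randomLabels_le hT rfl) _)
  obtain ⟨⟨sel, hsel⟩, hL⟩ := not_not.1 hlab
  rw [prob_map]
  have h1 : (fun b => !b) ⁻¹' {false} = {false}ᶜ := by ext b; simp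
  rw [h1]
  refine prob_iterK_le (I := fun _ => {false}) (fun t b hb => ?_) 0 (4 * m) rfl
  rw [Set.mem_singleton_iff.1 hb]
  have h2 : ({false}ᶜ : Set Bool) = {true} := by ext b; simp
  rw [h2]
  refine prob_sampleTest_true_le (P := params n d m) hsel hT hL (lt_min hn (by positivity))
    (min_le_left _ _) ((min_le_right _ _).trans ?_) rfl D
  exact Nat.pow_le_pow_right (by norm_num) (by simp only [params]; omega)

end DTTest
end

/-! ### Numerical estimates -/

noncomputable section

namespace DTTest

/-- `(1 - 1 / N) ^ N` is at most `1 / e`, which is at most 1/2. It is used for the search with `N =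
2 ^ d` and for the literal test with `N = 32`. -/
lemma one_sub_pow_le (N κ : ℕ) (hN : 0 < N) :
    (1 - (N : ENNReal)⁻¹) ^ (N * κ) ≤ (2 ^ κ)⁻¹ := by
  have hN' : (1 : ℝ) ≤ N := by exact_mod_cast hN
  have h0 : (0 : ℝ) ≤ 1 - 1 / N := by
    rw [sub_nonneg, div_le_one (by linarith)]
    exact hN'
  have h1 : (1 - (N : ENNReal)⁻¹) = ENNReal.ofReal (1 - 1 / N) := by
    rw [ENNReal.ofReal_sub _ (by positivity), ENNReal.ofReal_one, one_div,
      ENNReal.ofReal_inv_of_pos (by linarith), ENNReal.ofReal_natCast]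
  have h2 : (1 - 1 / (N : ℝ)) ^ N ≤ 1 / 2 := by
    refine (Real.one_sub_div_pow_le_exp_neg hN').trans ?_
    rw [Real.exp_neg, ← one_div]
    have := Real.add_one_le_exp 1
    exact one_div_le_one_div_of_le (by norm_num) (by linarith)
  rw [h1, pow_mul, ← ENNReal.ofReal_pow h0, ENNReal.inv_pow]
  refine pow_le_pow_left₀ zero_le ?_ _
  refine (ENNReal.ofReal_le_ofReal h2).trans_eq ?_
  rw [one_div, ENNReal.ofReal_inv_of_pos (by norm_num), ENNReal.ofReal_ofNat]

lemma sq_add_le_four_pow (d : ℕ) : d * d + d + 1 ≤ 2 ^ (2 * d) := by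
  induction d with
  | zero => simp
  | succ d ih =>
    rw [show 2 * (d + 1) = 2 * d + 2 by ring, pow_add]
    nlinarith

/-- The three summands of `kappa` pay for the union bounds: the logarithm for the samples, `2 * d`
for the rounds, and 5 for the constant 32. -/
lemma mul_le_two_pow_kappa (d m : ℕ) : 32 * (m * (d * d + d + 1)) ≤ 2 ^ kappa d m := by
  have h1 : m ≤ 2 ^ Nat.clog 2 m := Nat.le_pow_clog (by norm_num) m
  have h2 : m * (d * d + d + 1) ≤ 2 ^ Nat.clog 2 m * 2 ^ (2 * d) :=
    Nat.mul_le_mul h1 (sq_add_le_four_pow d)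
  rw [kappa, pow_add, pow_add, mul_comm]
  exact Nat.mul_le_mul_right _ h2

section Accept

variable {n d m : ℕ} {f : Cube n → Bool}

lemma prob_tester_true_ge (hn : 0 < n) (hf : IsDepthDT d f) (D : PMF (Cube n)) :
    2 / 3 ≤ prob (tester (params n d m) f (2 * d + 3) (4 * m) D) {true} := by
  obtain ⟨T, hT, hTf⟩ := hf
  obtain rfl : T.eval = f := funext hTf
  refine le_prob_of_le_prob_not (p := 1 / 3) ((prob_tester_false_le (m := m) hn hT D).trans ?_)
    ?_ (by simp)
  · have h1 := one_sub_pow_le (2 ^ d) (kappa d m) (by positivity)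
    rw [Nat.cast_pow, Nat.cast_ofNat] at h1
    have h2 : ((4 * m : ℕ) : ENNReal) * ((d * d + d + 1 : ℕ) * (2 ^ kappa d m)⁻¹) ≤ 8⁻¹ := by
      rw [← mul_assoc, ← div_eq_mul_inv, ← Nat.cast_mul]
      refine ENNReal.div_le_of_le_mul ?_
      rw [mul_comm 8⁻¹, ← div_eq_mul_inv, ENNReal.le_div_iff_mul_le (by simp) (by simp)]
      have := mul_le_two_pow_kappa d m
      have h3 : 4 * m * (d * d + d + 1) * 8 ≤ 2 ^ kappa d m := by linarith
      exact_mod_cast h3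
    calc _ ≤ 8⁻¹ + (4 * m : ℕ) * ((d * d + d + 1 : ℕ) * (2 ^ kappa d m : ENNReal)⁻¹) := by gcongr
      _ ≤ 8⁻¹ + 8⁻¹ := by gcongr
      _ ≤ 1 / 3 := by
        rw [ENNReal.le_div_iff_mul_le (by simp) (by simp), ← one_div, ENNReal.div_add_div_same,
          ← ENNReal.mul_div_right_comm]
        refine ENNReal.div_le_of_le_mul ?_
        norm_num
  · rw [ENNReal.div_add_div_same, show (2 + 1 : ENNReal) = 3 by norm_num,
      ENNReal.div_self (by simp) (by simp)]

lemma prob_tester_false_ge {ε : ℝ} (hn : 0 < n) (hε : 0 < ε) (hε1 : ε ≤ 1) (D : PMF (Cube n))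
    (hm : 1 / ε ≤ m) (hf : FarFromDepthDT D ε (d ^ 2) f) :
    2 / 3 ≤ prob (tester (params n d m) f (2 * d + 3) (4 * m) D) {false} := by
  have hm0 : (0 : ℝ) < m := (by positivity : (0 : ℝ) < 1 / ε).trans_le hm
  refine le_prob_of_le_prob_not (p := 1 / 3)
    ((prob_tester_le (params n d m) f hn hε.le hf (2 * d + 3) (4 * m)).trans ?_) ?_ (by simp)
  · have h1 : ((params n d m).rounds : ENNReal) * (31 / 32) ^ (params n d m).reps ≤
        ENNReal.ofReal (ε / 2) := by
      have h2 := one_sub_pow_le 32 (kappa d m) (by norm_num)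
      have h3 : (1 - ((32 : ℕ) : ENNReal)⁻¹) = 31 / 32 := by
        rw [Nat.cast_ofNat]
        refine ENNReal.sub_eq_of_eq_add (by simp) ?_
        rw [← one_div, ENNReal.div_add_div_same, show (31 + 1 : ENNReal) = 32 by norm_num,
          ENNReal.div_self (by simp) (by simp)]
      rw [h3] at h2
      calc ((d * d + d + 1 : ℕ) : ENNReal) * (31 / 32) ^ (32 * kappa d m)
          ≤ (d * d + d + 1 : ℕ) * (2 ^ kappa d m)⁻¹ := by gcongr
        _ = ENNReal.ofReal ((d * d + d + 1 : ℕ) * (2 ^ kappa d m)⁻¹) := by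
          rw [ENNReal.ofReal_mul (by positivity), ENNReal.ofReal_natCast,
            ENNReal.ofReal_inv_of_pos (by positivity), ENNReal.ofReal_pow (by norm_num),
            ENNReal.ofReal_ofNat]
        _ ≤ ENNReal.ofReal (ε / 2) := by
          refine ENNReal.ofReal_le_ofReal ?_
          rw [← div_eq_mul_inv, div_le_iff₀ (by positivity)]
          have h4 : (32 : ℝ) * (m * (d * d + d + 1 : ℕ)) ≤ 2 ^ kappa d m := by
            exact_mod_cast mul_le_two_pow_kappa d m
          have h5 : 1 ≤ m * ε := by rwa [div_le_iff₀ hε] at hm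
          have h6 : (0 : ℝ) ≤ (d * d + d + 1 : ℕ) := Nat.cast_nonneg _
          nlinarith [mul_le_mul_of_nonneg_left h4 hε.le, mul_le_mul_of_nonneg_right h5 h6]
    have h2 : ENNReal.ofReal (1 - ε) + (params n d m).rounds * (31 / 32) ^ (params n d m).reps ≤
        ENNReal.ofReal (1 - ε / 2) := by
      refine (add_le_add_right h1 _).trans_eq ?_
      rw [← ENNReal.ofReal_add (by linarith) (by linarith)]
      congr 1
      ring
    refine (pow_le_pow_left₀ zero_le h2 _).trans ?_
    rw [← ENNReal.ofReal_pow (by linarith)]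
    have h3 : (1 - ε / 2) ^ (4 * m) ≤ 1 / 3 := by
      have h4 : 1 - ε / 2 ≤ Real.exp (-(ε / 2)) := by
        have := Real.add_one_le_exp (-(ε / 2))
        linarith
      have h5 : 1 ≤ m * ε := by rwa [div_le_iff₀ hε] at hm
      calc (1 - ε / 2) ^ (4 * m) ≤ Real.exp (-(ε / 2)) ^ (4 * m) :=
            pow_le_pow_left₀ (by linarith) h4 _
        _ = Real.exp (-(2 * (m * ε))) := by
            rw [← Real.exp_nat_mul]
            congr 1
            push_cast
            ring
        _ ≤ Real.exp (-2) := Real.exp_le_exp.2 (by linarith)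
        _ ≤ 1 / 3 := by
            rw [Real.exp_neg, ← one_div]
            have := Real.add_one_le_exp 2
            exact one_div_le_one_div_of_le (by norm_num) (by linarith)
    refine (ENNReal.ofReal_le_ofReal h3).trans_eq ?_
    rw [one_div, ENNReal.ofReal_inv_of_pos (by norm_num), ENNReal.ofReal_ofNat, one_div]
  · rw [ENNReal.div_add_div_same, show (2 + 1 : ENNReal) = 3 by norm_num,
      ENNReal.div_self (by simp) (by simp)]

end Accept

/-! ### Numbers of queries and running time -/

/-- A bound for the number of queries of the tester. -/
def queryBound (d m : ℕ) : ℕ := 1440 * (m * 2 ^ (2 * d) * kappa d m ^ 4)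

lemma sampleEvals_le (n d m : ℕ) : sampleEvals (params n d m) ≤ 36 * (2 ^ d * kappa d m ^ 3) := by
  have h1 : 2 * d + 5 ≤ kappa d m := by unfold kappa; omega
  have h2 : 1 ≤ 2 ^ d := Nat.one_le_two_pow
  have h3 : d * d + d + 1 ≤ kappa d m ^ 2 := by nlinarith
  have h4 : 2 ^ d * kappa d m + (2 * d + 4) + 32 * kappa d m + 3 + 1 ≤ 35 * (2 ^ d * kappa d m) := by
    nlinarith
  have h5 : 1 ≤ 2 ^ d * kappa d m ^ 3 := Nat.one_le_iff_ne_zero.2 (by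
    have : kappa d m ≠ 0 := by omega
    positivity)
  simp only [sampleEvals, roundEvals, params]
  calc _ ≤ kappa d m ^ 2 * (35 * (2 ^ d * kappa d m)) + 1 :=
        Nat.add_le_add_right (Nat.mul_le_mul h3 h4) _
    _ = 35 * (2 ^ d * kappa d m ^ 3) + 1 := by ring
    _ ≤ _ := by omega

/-- The third power of `kappa` would suffice for the queries. The fourth is spent in
`testerTime_le`, where the cost `n + d + 1` of handling a point and a monomial is bounded by `kappa
d m * n`. -/
lemma testerQueries_le (n d m : ℕ) : testerQueries n d m ≤ queryBound d m := by
  have h1 : 1 ≤ kappa d m := by unfold kappa; omega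
  calc testerQueries n d m ≤ 4 * m * (36 * (2 ^ d * kappa d m ^ 3) * (10 * 2 ^ d)) :=
        Nat.mul_le_mul_left _ (Nat.mul_le_mul_right _ (sampleEvals_le n d m))
    _ = 1440 * (m * 2 ^ (2 * d) * kappa d m ^ 3) := by rw [two_mul, pow_add]; ring
    _ ≤ _ := Nat.mul_le_mul_left _ (Nat.mul_le_mul_left _ (Nat.pow_le_pow_right h1 (by norm_num)))

lemma testerTime_le {n d m : ℕ} (hn : 1 ≤ n) (hm : 1 ≤ m) :
    testerTime n d m ≤ 200 * (queryBound d m * n) := by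
  have h1 : 2 * d + 5 ≤ kappa d m := by unfold kappa; omega
  have h2 : n + d + 1 ≤ kappa d m * n := by nlinarith
  have h3 : 4 * m * (sampleEvals (params n d m) * (20 * derivTime n d)) ≤
      100 * (queryBound d m * n) := by
    calc _ ≤ 4 * m * (36 * (2 ^ d * kappa d m ^ 3) * (20 * (2 ^ d * (50 * (kappa d m * n))))) := by
          unfold derivTime
          gcongr
          exact sampleEvals_le n d m
      _ = _ := by unfold queryBound; rw [two_mul, pow_add]; ring
  have hk : kappa d m ≤ kappa d m ^ 4 := Nat.le_self_pow (by norm_num) _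
  have hp : 1 ≤ 2 ^ (2 * d) := Nat.one_le_two_pow
  have h4 : 1440 * (m * n) ≤ queryBound d m * n := by
    unfold queryBound
    have : m * 1 * 1 ≤ m * 2 ^ (2 * d) * kappa d m ^ 4 :=
      Nat.mul_le_mul (Nat.mul_le_mul_left _ hp) (by omega)
    nlinarith
  have h5 : 1440 * (kappa d m * n) ≤ queryBound d m * n := by
    unfold queryBound
    have : 1 * 1 * kappa d m ≤ m * 2 ^ (2 * d) * kappa d m ^ 4 :=
      Nat.mul_le_mul (Nat.mul_le_mul hm hp) hk
    nlinarith
  have h6 : m ≤ m * n := Nat.le_mul_of_pos_right _ hn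
  have h7 : (n + 1) * (11 * (2 * d + 3) + 30) ≤ 40 * (kappa d m * n) := by
    calc _ ≤ (2 * n) * (20 * kappa d m) := Nat.mul_le_mul (by omega) (by omega)
      _ = _ := by ring
  have h8 : kappa d m ≤ kappa d m * n := Nat.le_mul_of_pos_right _ hn
  unfold testerTime
  rw [mul_add]
  omega

/-- `2 ^ clog m` is at most `4 / ε`, because rounding up to a power of 2 at most doubles; the base 2
is traded for the natural logarithm by `log 2 > 1 / 2`. -/
lemma kappa_le_log {d m : ℕ} {ε : ℝ} (hε : 0 < ε) (hε1 : ε ≤ 1) (hm : (m : ℝ) ≤ 2 / ε)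
    (hm1 : 1 ≤ m) :
    (kappa d m : ℝ) ≤ 7 * (1 + Real.log (2 ^ (2 * d) / ε)) := by
  have hl : 1 / 2 < Real.log 2 := by have := Real.log_two_gt_d9; linarith
  have h1 : (2 : ℝ) ^ Nat.clog 2 m ≤ 4 / ε := by
    rcases hm1.lt_or_eq with h | h
    · have h2 := Nat.pow_pred_clog_lt_self (b := 2) (by norm_num) h
      have h3 : 0 < Nat.clog 2 m := Nat.clog_pos (by norm_num) h
      obtain ⟨c, hc⟩ := Nat.exists_eq_succ_of_ne_zero h3.ne'
      rw [hc, Nat.pred_succ] at h2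
      have h4 : (2 : ℝ) ^ c ≤ m := by exact_mod_cast h2.le
      rw [hc, pow_succ]
      calc (2 : ℝ) ^ c * 2 ≤ 2 / ε * 2 := by nlinarith
        _ = 4 / ε := by ring
    · rw [← h] at hm ⊢
      simp only [Nat.clog_one_right, pow_zero]
      have : (4 : ℝ) / ε = 2 / ε + 2 / ε := by ring
      have h2 : (1 : ℝ) ≤ 2 / ε := by exact_mod_cast hm
      linarith
  have h2 : (2 : ℝ) ^ (Nat.clog 2 m + 2 * d) ≤ 2 ^ 2 * (2 ^ (2 * d) / ε) := by
    rw [pow_add]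
    calc (2 : ℝ) ^ Nat.clog 2 m * 2 ^ (2 * d) ≤ 4 / ε * 2 ^ (2 * d) := by gcongr
      _ = _ := by ring
  have h3 := Real.log_le_log (by positivity) h2
  rw [Real.log_pow, Real.log_mul (by norm_num) (by positivity), Real.log_pow] at h3
  have h4 : 0 ≤ Real.log (2 ^ (2 * d) / ε) := by
    refine Real.log_nonneg ?_
    rw [le_div_iff₀ hε, one_mul]
    exact hε1.trans (one_le_pow₀ (by norm_num))
  set ℓ := Real.log (2 ^ (2 * d) / ε)
  have h5 : ((Nat.clog 2 m + 2 * d : ℕ) : ℝ) ≤ 2 + 2 * ℓ := by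
    by_contra hc
    push Not at hc
    push_cast at h3 hc
    nlinarith
  have h6 : (kappa d m : ℝ) = ((Nat.clog 2 m + 2 * d : ℕ) : ℝ) + 5 := by
    unfold kappa
    push_cast
    ring
  linarith

lemma queryBound_le {d m : ℕ} {ε : ℝ} (hε : 0 < ε) (hε1 : ε ≤ 1) (hm : (m : ℝ) ≤ 2 / ε)
    (hm1 : 1 ≤ m) : (queryBound d m : ℝ) ≤
      (2880 * 7 ^ 4 : ℕ) * (2 ^ (2 * d) / ε) * (1 + Real.log (2 ^ (2 * d) / ε)) ^ 4 := by
  have hk := kappa_le_log (d := d) hε hε1 hm hm1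
  unfold queryBound
  push_cast
  calc (1440 * (m * 2 ^ (2 * d) * (kappa d m : ℝ) ^ 4) : ℝ)
      ≤ 1440 * (2 / ε * 2 ^ (2 * d) * (7 * (1 + Real.log (2 ^ (2 * d) / ε))) ^ 4) := by gcongr
    _ = _ := by ring

lemma roomy {n d m w : ℕ} {D : PMF (Cube n)} {f : Cube n → Bool} (hn : 1 ≤ n)
    (hw : 16 * (Nat.log 2 n + d + Nat.log 2 m + 1) ≤ w) :
    Roomy ⟨n, w, D, f⟩ d m (2 ^ (Nat.log 2 n + d + Nat.log 2 m + 1)) := by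
  refine ⟨hn, ?_, ?_, Nat.pow_lt_pow_right (by norm_num) (by omega), ?_⟩
  · exact (Nat.lt_pow_succ_log_self (by norm_num) n).trans_le
      (Nat.pow_le_pow_right (by norm_num) (by omega))
  · exact (Nat.lt_pow_succ_log_self (by norm_num) m).trans_le
      (Nat.pow_le_pow_right (by norm_num) (by omega))
  · rw [← pow_mul]
    exact Nat.pow_le_pow_right (by norm_num) (by dsimp only; omega)

end DTTest
end

/-! ### The main theorem -/

theorem mainTheorem2 :
    ∃ (P : DTTest.Cmd) (q : ℕ → ℝ → ℕ) (A a B K : ℕ),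
      (∀ (d : ℕ) (ε : ℝ), 0 < ε → ε ≤ 1 →
        (q d ε : ℝ) ≤ A * (2 ^ (2 * d) / ε) * (1 + Real.log (2 ^ (2 * d) / ε)) ^ a) ∧
      ∀ (n d : ℕ) (ε : ℝ) (w : ℕ), 1 ≤ n → 0 < ε → ε ≤ 1 →
        K * (Nat.log 2 n + d + Nat.log 2 ⌈1 / ε⌉₊ + 1) ≤ w →
        ∀ (D : PMF (DTTest.Cube n)) (f : DTTest.Cube n → Bool),
          DTTest.AnswersWithin P w d ε D f (B * (q d ε * n)) (q d ε) ∧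
          (DTTest.IsDepthDT d f →
            2 / 3 ≤ DTTest.answerProb P w d ε D f (B * (q d ε * n)) true) ∧
          (DTTest.FarFromDepthDT D ε (d ^ 2) f →
            2 / 3 ≤ DTTest.answerProb P w d ε D f (B * (q d ε * n)) false) := by
  have hceil : ∀ ε : ℝ, 0 < ε → ε ≤ 1 → (⌈1 / ε⌉₊ : ℝ) ≤ 2 / ε ∧ 1 ≤ ⌈1 / ε⌉₊ := by
    intro ε hε hε1
    have h1 : 1 ≤ 1 / ε := by rwa [le_div_iff₀ hε, one_mul]
    refine ⟨?_, Nat.one_le_ceil_iff.2 (by linarith)⟩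
    have h2 := Nat.ceil_lt_add_one (by linarith : 0 ≤ 1 / ε)
    rw [show 2 / ε = 1 / ε + 1 / ε by ring]
    linarith
  -- `2880` is `2 * 1440`, with the 2 from `⌈1 / ε⌉ ≤ 2 / ε`; `7 ^ 4` comes from `kappa_le_log`,
  -- `200` from `testerTime_le`, and `16` is the exponent in `Roomy`.
  refine ⟨DTTest.testerCmd, fun d ε => DTTest.queryBound d ⌈1 / ε⌉₊, 2880 * 7 ^ 4, 4, 200, 16,
    fun d ε hε hε1 => DTTest.queryBound_le hε hε1 (hceil ε hε hε1).1 (hceil ε hε hε1).2, ?_⟩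
  intro n d ε w hn hε hε1 hw D f
  obtain ⟨-, hm⟩ := hceil ε hε hε1
  set m := ⌈1 / ε⌉₊ with hmdef
  have hroom := DTTest.roomy (D := D) (f := f) hn hw
  have hX := hroom.two_le
  have hmod : ∀ v, v < 2 ^ (Nat.log 2 n + d + Nat.log 2 m + 1) → v % 2 ^ w = v := fun v hv =>
    Nat.mod_eq_of_lt (hroom.lt (by nlinarith))
  have hy := (DTTest.testerCmd_yields (s := DTTest.initMem n w d m) hroom
    (by simpa [DTTest.initMem] using hmod n hroom.n)
    (by simpa [DTTest.initMem] using hmod d (by have := hroom.d_lt; omega))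
    (by simpa [DTTest.initMem] using hmod m hroom.m)).mono le_rfl (DTTest.testerQueries_le n d m)
  have hT := DTTest.testerTime_le (d := d) hn hm
  refine ⟨hy.answersWithin hT, fun hf => ?_, fun hf => ?_⟩
  · rw [hy.answerProb hT, ← DTTest.prob_singleton]
    exact DTTest.prob_tester_true_ge hn hf D
  · rw [hy.answerProb hT, ← DTTest.prob_singleton]
    exact DTTest.prob_tester_false_ge hn hε hε1 D (Nat.le_ceil _) hf
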